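/- Let $R$ be a nonzero commutative unital ring, $n\ge 0$, let $A=\Lambda[x_1,\dots,x_n]$ be the exterior algebra over $R$ with $R$-basis $x_\sigma=\bigwedge_{i\in\sigma}x_i$ ($\sigma\subseteq[n]=\{1,\dots,n\}$, factors in increasing order), and let $A^e=A\otimes_R A^{\mathrm{op}}$. Let $B_*$ be the normalized bar resolution of the bimodule $A$: $B_k$ is the quotient of $A^{\otimes k+2}$ by the tensors with an inner entry $1$, with differential induced by $a_0\otimes\dots\otimes a_{k+1}\mapsto\sum_{0\le i\le k}(-1)^i a_0\otimes\dots\otimes a_ia_{i+1}\otimes\dots\otimes a_{k+1}$. It is $A^e$-free on the tensors $1\otimes x_{\sigma_1}\otimes\dots\otimes x_{\sigma_k}\otimes 1$ with all $\sigma_j\subseteq[n]$ nonempty. Let $\Gamma$ be the digraph whose vertices are these basis elements and whose edges are weighted by the nonzero entries of the matrices of the differentials. Let $\mathcal M$ be the set of all edges $$1\otimes x_{i_1}\otimes\dots\otimes x_{i_{r-1}}\otimes x_i\otimes x_{\sigma_r\setminus\{i\}}\otimes x_{\sigma_{r+1}}\otimes\dots\otimes x_{\sigma_k}\otimes 1\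 \longrightarrow\ 1\otimes x_{i_1}\otimes\dots\otimes x_{i_{r-1}}\otimes x_{\sigma_r}\otimes x_{\sigma_{r+1}}\otimes\dots\otimes x_{\sigma_k}\otimes 1$$ with $r\ge1$, $|\sigma_r|\geq 2$ and $i_1\le\dots\le i_{r-1}\le i=\max\sigma_r$. Let $\Gamma^{\mathcal M}$ be obtained from $\Gamma$ by reversing the edges in $\mathcal M$, replacing their weights $w$ by $-w^{-1}$; the weight of a directed path is the product of the weights of its edges, in the order of traversal. Then $\mathcal M$ is a Morse matching: its edges have invertible weights and are pairwise disjoint, and $\Gamma^{\mathcal M}$ has no directed cycles and no infinite directed paths in two adjacent degrees. There are only finitely many directed paths in $\Gamma^{\mathcal M}$ between any two vertices. The critical (unmatched) vertices of degree $k$ are exactly the $x_{(\tau)}=1\otimes x_{i_1}\otimes\dots\otimes x_{i_k}\otimes 1$ for the multisets $\tau=(i_1\le\dots\le i_k)$ of elements of $[n]$. Let $\mathring B_k$ be the free $A^e$-module on the critical vertices of degree $k$, and let $$\mathring b(c)=\sum_{c'}\alpha_{c,c'}\,c',\qquad h(c)=\sum_v\alpha_{c,v}\,v,\qquad h^{-1}(v)=\sum_{c}\alpha_{v,c}\,c,$$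 where $\alpha_{u,v}\in A^e$ is the sum of the weights of all directed paths from $u$ to $v$ in $\Gamma^{\mathcal M}$; here $c,c'$ run over critical vertices and $v$ over all vertices, with $\deg c'=\deg c-1$ in $\mathring b$ and $\deg v=\deg c$ in $h$ and $h^{-1}$. Then $(\mathring B_*,\mathring b)$ is a chain complex of $A^e$-modules, and $h:\mathring B_*\to B_*$ and $h^{-1}:B_*\to\mathring B_*$ are chain maps which are homotopy inverse to each other. For a rearrangement $\pi\tau=(j_1,\dots,j_k)$ of $\tau$ let $x_{(\pi\tau)}=1\otimes x_{j_1}\otimes\dots\otimes x_{j_k}\otimes 1$. For all $\tau$, $$h(x_{(\tau)})=\sum_{\pi\tau}x_{(\pi\tau)},$$ the sum being over all distinct rearrangements of $\tau$, and $$h^{-1}(x_{(\pi\tau)})=\begin{cases}x_{(\tau)};&\pi\tau=\tau,\\0;&\pi\tau\ne\tau.\end{cases}$$ Moreover, for each rearrangement $\pi\tau$ of $\tau$ there is exactly one directed path in $\Gamma^{\mathcal M}$ from $x_{(\tau)}$ to $x_{(\pi\tau)}$, and its weight is $1$. -/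

import Mathlib

open CategoryTheory
open scoped TensorProduct

universe u

noncomputable section

namespace NormalizedBar

section Bar

variable (R A : Type u) [CommRing R] [Ring A] [Algebra R A]

/-- The enveloping algebra `A ⊗ Aᵒᵖ`. -/
abbrev Env : Type u := A ⊗[R] Aᵐᵒᵖ

/-- The `(k + 2)`-fold tensor power `A ⊗ ⋯ ⊗ A` over `R`. -/
def Bar (k : ℕ) : Type u := PiTensorProduct R (fun _ : Fin (k + 2) => A)

instance (k : ℕ) : AddCommGroup (Bar R A k) :=
  inferInstanceAs (AddCommGroup (PiTensorProduct R (fun _ : Fin (k + 2) => A)))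

instance (k : ℕ) : Module R (Bar R A k) :=
  inferInstanceAs (Module R (PiTensorProduct R (fun _ : Fin (k + 2) => A)))

/-- The pure tensor `a₀ ⊗ ⋯ ⊗ aₖ₊₁`. -/
def pureTensor (k : ℕ) : MultilinearMap R (fun _ : Fin (k + 2) => A) (Bar R A k) :=
  PiTensorProduct.tprod R

variable {R A} in
lemma bar_ext {k : ℕ} {M : Type*} [AddCommMonoid M] [Module R M] {f g : Bar R A k →ₗ[R] M}
    (h : ∀ a, f (pureTensor R A k a) = g (pureTensor R A k a)) : f = g :=
  PiTensorProduct.ext (MultilinearMap.ext h)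

variable {R A} in
/-- The linear map on `A ⊗ ⋯ ⊗ A` given by a multilinear map. -/
def barLift {k : ℕ} {M : Type*} [AddCommMonoid M] [Module R M]
    (φ : MultilinearMap R (fun _ : Fin (k + 2) => A) M) : Bar R A k →ₗ[R] M :=
  PiTensorProduct.lift φ

variable {R A} in
lemma barLift_pure {k : ℕ} {M : Type*} [AddCommMonoid M] [Module R M]
    (φ : MultilinearMap R (fun _ : Fin (k + 2) => A) M) (a : Fin (k + 2) → A) :
    barLift φ (pureTensor R A k a) = φ a :=
  PiTensorProduct.lift.tprod a

/-- An endomorphism of `A` acting on the `i`-th tensor factor. -/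
def slotMap (k : ℕ) (i : Fin (k + 2)) (f : Module.End R A) : Module.End R (Bar R A k) :=
  barLift ((pureTensor R A k).compLinearMap (Function.update (fun _ => LinearMap.id) i f))

lemma slotMap_pure (k : ℕ) (i : Fin (k + 2)) (f : Module.End R A) (a : Fin (k + 2) → A) :
    slotMap R A k i f (pureTensor R A k a) = pureTensor R A k (Function.update a i (f (a i))) := by
  rw [slotMap, barLift_pure, MultilinearMap.compLinearMap_apply]
  congr 1
  ext j
  by_cases h : j = i
  · subst h; simp
  · simp [h]

/-- Endomorphisms of `A` act on the `i`-th tensor factor. -/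
def slot (k : ℕ) (i : Fin (k + 2)) : Module.End R A →ₐ[R] Module.End R (Bar R A k) :=
  AlgHom.ofLinearMap
    { toFun := slotMap R A k i
      map_add' := fun f g => bar_ext fun a => by
        rw [LinearMap.add_apply, slotMap_pure, slotMap_pure, slotMap_pure, LinearMap.add_apply,
          MultilinearMap.map_update_add]
      map_smul' := fun r f => bar_ext fun a => by
        rw [RingHom.id_apply, LinearMap.smul_apply, slotMap_pure, slotMap_pure,
          LinearMap.smul_apply, MultilinearMap.map_update_smul] }
    (bar_ext fun a => by
      refine (slotMap_pure R A k i 1 a).trans ?_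
      rw [Module.End.one_apply, Module.End.one_apply, Function.update_eq_self])
    (fun f g => bar_ext fun a => by
      refine (slotMap_pure R A k i (f * g) a).trans ?_
      change _ = slotMap R A k i f (slotMap R A k i g (pureTensor R A k a))
      rw [slotMap_pure, slotMap_pure, Function.update_self, Function.update_idem,
        Module.End.mul_apply])

lemma slot_pure (k : ℕ) (i : Fin (k + 2)) (f : Module.End R A) (a : Fin (k + 2) → A) :
    slot R A k i f (pureTensor R A k a) = pureTensor R A k (Function.update a i (f (a i))) :=
  slotMap_pure R A k i f a

lemma slot_comm (k : ℕ) (x : A) (y : Aᵐᵒᵖ) :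
    Commute ((slot R A k 0).comp (Algebra.lsmul R R A) x)
      ((slot R A k (Fin.last (k + 1))).comp (Algebra.lsmul R R A) y) :=
  bar_ext fun a => by
    have h : (0 : Fin (k + 2)) ≠ Fin.last (k + 1) := (Fin.last_pos).ne
    simp only [AlgHom.comp_apply, Module.End.mul_apply, slot_pure,
      Function.update_of_ne h, Function.update_of_ne h.symm]
    rw [Function.update_comm h]

/-- The action of `A ⊗ Aᵒᵖ` on `A ⊗ ⋯ ⊗ A`: the left factor multiplies the first tensor factor on
the left, the right factor multiplies the last tensor factor on the right. -/
def envAction (k : ℕ) : Env R A →ₐ[R] Module.End R (Bar R A k) :=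
  Algebra.TensorProduct.lift
    ((slot R A k 0).comp (Algebra.lsmul R R A))
    ((slot R A k (Fin.last (k + 1))).comp (Algebra.lsmul R R A))
    (slot_comm R A k)

instance (k : ℕ) : Module (Env R A) (Bar R A k) :=
  Module.compHom _ (envAction R A k).toRingHom

lemma smul_pure (k : ℕ) (x : A) (y : Aᵐᵒᵖ) (a : Fin (k + 2) → A) :
    (x ⊗ₜ[R] y : Env R A) • pureTensor R A k a =
      pureTensor R A k (Function.update (Function.update a (Fin.last (k + 1))
        (a (Fin.last (k + 1)) * y.unop)) 0 (x * a 0)) := by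
  have h : (0 : Fin (k + 2)) ≠ Fin.last (k + 1) := (Fin.last_pos).ne
  refine Eq.trans (b := slot R A k 0 (Algebra.lsmul R R A x)
    (slot R A k (Fin.last (k + 1)) (Algebra.lsmul R R A y) (pureTensor R A k a))) ?_ ?_
  · exact LinearMap.congr_fun (Algebra.TensorProduct.lift_tmul _ _ (slot_comm R A k) x y) _
  · rw [slot_pure, slot_pure, Function.update_of_ne h]
    rfl

lemma algebraMap_smul (k : ℕ) (r : R) (z : Bar R A k) :
    (algebraMap R (Env R A) r) • z = r • z :=
  LinearMap.congr_fun ((envAction R A k).commutes r) z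

instance (k : ℕ) : IsScalarTower R (Env R A) (Bar R A k) where
  smul_assoc r x z := by
    rw [Algebra.smul_def r x, mul_smul, algebraMap_smul]

/-- Multiplying the adjacent entries `i` and `i + 1` of a tuple. -/
def mergeAt {k : ℕ} (i : Fin (k + 2)) (a : Fin (k + 3) → A) : Fin (k + 2) → A :=
  Fin.contractNth i.castSucc (· * ·) a

variable {A}

lemma merge_apply {k : ℕ} (i : Fin (k + 2)) (a : Fin (k + 3) → A) (j : Fin (k + 2)) :
    mergeAt A i a j = if j < i then a j.castSucc else if j = i then a j.castSucc * a j.succ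
      else a j.succ := by
  simp only [mergeAt, Fin.contractNth, Fin.lt_def, Fin.val_castSucc, Fin.ext_iff]

lemma exists_nat_tuple {α : Type*} {m : ℕ} (a : Fin (m + 1) → α) :
    ∃ b : ℕ → α, a = fun j : Fin (m + 1) => b (j : ℕ) :=
  ⟨fun j => a (Fin.ofNat _ j), by simp⟩

lemma merge_update {k : ℕ} (i : Fin (k + 2)) (a : Fin (k + 3) → A) (j : Fin (k + 3)) :
    ∃ (l : Fin (k + 2)) (f : A →ₗ[R] A), ∀ x,
      mergeAt A i (Function.update a j x) = Function.update (mergeAt A i a) l (f x) := by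
  rcases lt_trichotomy (j : ℕ) i with h | h | h
  · refine ⟨⟨j, by omega⟩, LinearMap.id, fun x => funext fun m => ?_⟩
    simp only [merge_apply, Function.update_apply, Fin.ext_iff, Fin.lt_def, Fin.val_castSucc,
      Fin.val_succ, LinearMap.id_apply]
    grind
  · refine ⟨i, LinearMap.mulRight R (a i.succ), fun x => funext fun m => ?_⟩
    simp only [merge_apply, Function.update_apply, Fin.ext_iff, Fin.lt_def, Fin.val_castSucc,
      Fin.val_succ, LinearMap.mulRight_apply]
    grind
  · by_cases h' : (j : ℕ) = i + 1
    · refine ⟨i, LinearMap.mulLeft R (a i.castSucc), fun x => funext fun m => ?_⟩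
      simp only [merge_apply, Function.update_apply, Fin.ext_iff, Fin.lt_def, Fin.val_castSucc,
        Fin.val_succ, LinearMap.mulLeft_apply]
      grind
    · refine ⟨⟨j - 1, by omega⟩, LinearMap.id, fun x => funext fun m => ?_⟩
      simp only [merge_apply, Function.update_apply, Fin.ext_iff, Fin.lt_def, Fin.val_castSucc,
        Fin.val_succ, LinearMap.id_apply]
      grind

/-- Multiplying the tensor factors `i` and `i + 1`. -/
def face (k : ℕ) (i : Fin (k + 2)) : Bar R A (k + 1) →ₗ[R] Bar R A k :=
  barLift (.mk' (fun a => pureTensor R A k (mergeAt A i a))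
    (fun a j x y => by
      obtain ⟨l, f, h⟩ := merge_update R i a j
      simp only [h, map_add, MultilinearMap.map_update_add])
    (fun a j r x => by
      obtain ⟨l, f, h⟩ := merge_update R i a j
      simp only [h, map_smul, MultilinearMap.map_update_smul]))

lemma face_pure (k : ℕ) (i : Fin (k + 2)) (a : Fin (k + 3) → A) :
    face R k i (pureTensor R A (k + 1) a) = pureTensor R A k (mergeAt A i a) :=
  barLift_pure _ a

lemma face_smul (k : ℕ) (i : Fin (k + 2)) (c : Env R A) (z : Bar R A (k + 1)) :
    face R k i (c • z) = c • face R k i z := by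
  induction c using TensorProduct.induction_on with
  | zero =>
    exact (congrArg _ (zero_smul (Env R A) z)).trans
      ((map_zero _).trans (zero_smul (Env R A) (face R k i z)).symm)
  | add c d hc hd => rw [add_smul, map_add, hc, hd, add_smul]
  | tmul x y =>
    let T (l : ℕ) : Bar R A l →ₗ[R] Bar R A l := envAction R A l (x ⊗ₜ y)
    suffices (face R k i) ∘ₗ T (k + 1) = T k ∘ₗ face R k i from LinearMap.congr_fun this z
    refine bar_ext fun a => ?_
    change face R k i ((x ⊗ₜ[R] y : Env R A) • pureTensor R A (k + 1) a) =
      (x ⊗ₜ[R] y : Env R A) • face R k i (pureTensor R A (k + 1) a)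
    rw [smul_pure, face_pure, face_pure, smul_pure]
    congr 1
    funext m
    obtain ⟨b, rfl⟩ := exists_nat_tuple a
    simp only [merge_apply, Function.update_apply, Fin.ext_iff, Fin.lt_def, Fin.val_castSucc,
      Fin.val_succ, Fin.val_last, Fin.val_zero]
    have := m.2
    have := i.2
    grind

/-- The bar differential `∑ (-1)ⁱ a₀ ⊗ ⋯ ⊗ aᵢ aᵢ₊₁ ⊗ ⋯ ⊗ aₖ₊₂`. -/
def barD (k : ℕ) : Bar R A (k + 1) →ₗ[Env R A] Bar R A k where
  toFun z := ∑ i : Fin (k + 2), (-1 : ℤ) ^ (i : ℕ) • face R k i z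
  map_add' z w := by simp only [map_add, smul_add, Finset.sum_add_distrib]
  map_smul' c z := by
    simp only [face_smul, RingHom.id_apply, Finset.smul_sum]
    exact Finset.sum_congr rfl fun i _ => smul_comm _ _ _

lemma face_face (k : ℕ) (i : Fin (k + 2)) (j : Fin (k + 3)) (h : (j : ℕ) ≤ i)
    (z : Bar R A (k + 2)) :
    face R k i (face R (k + 1) j z) =
      face R k (j.castLT (by omega)) (face R (k + 1) i.succ z) := by
  suffices face R k i ∘ₗ face R (k + 1) j =
      face R k (j.castLT (by omega)) ∘ₗ face (A := A) R (k + 1) i.succ from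
    LinearMap.congr_fun this z
  refine bar_ext fun a => ?_
  simp only [LinearMap.comp_apply, face_pure]
  congr 1
  funext m
  obtain ⟨b, rfl⟩ := exists_nat_tuple a
  simp only [merge_apply, Fin.ext_iff, Fin.lt_def, Fin.val_castSucc,
      Fin.val_succ, Fin.val_castLT]
  grind

lemma barD_barD (k : ℕ) (z : Bar R A (k + 2)) : barD R k (barD R (k + 1) z) = 0 := by
  change ∑ i : Fin (k + 2), (-1 : ℤ) ^ (i : ℕ) • face R k i
    (∑ j : Fin (k + 3), (-1 : ℤ) ^ (j : ℕ) • face R (k + 1) j z) = 0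
  simp only [map_sum, map_zsmul, Finset.smul_sum, ← Finset.sum_product']
  let S : Finset (Fin (k + 2) × Fin (k + 3)) := {ij | (ij.2 : ℕ) ≤ (ij.1 : ℕ)}
  rw [Finset.univ_product_univ, ← Finset.sum_add_sum_compl S, ← eq_neg_iff_add_eq_zero,
    ← Finset.sum_neg_distrib]
  let φ : ∀ ij : Fin (k + 2) × Fin (k + 3), ij ∈ S → Fin (k + 2) × Fin (k + 3) := fun ij hij =>
    (Fin.castLT ij.2 (lt_of_le_of_lt (Finset.mem_filter.mp hij).right (Fin.is_lt ij.1)), ij.1.succ)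
  apply Finset.sum_bij φ
  · intro ij hij
    simp_rw [S, φ, Finset.compl_filter, Finset.mem_filter_univ, Fin.val_succ,
      Fin.val_castLT] at hij ⊢
    omega
  · rintro ⟨i, j⟩ hij ⟨i', j'⟩ hij' h
    simp only [φ, Prod.mk.injEq, Fin.ext_iff, Fin.val_castLT, Fin.val_succ] at h ⊢
    omega
  · rintro ⟨i', j'⟩ hij'
    simp_rw [S, Finset.compl_filter, Finset.mem_filter_univ, not_le] at hij'
    refine ⟨(⟨j' - 1, by omega⟩, Fin.castSucc i'), ?_, ?_⟩
    · simp only [S, Finset.mem_filter_univ, Fin.val_castSucc]; omega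
    · simp only [φ, Prod.mk.injEq, Fin.ext_iff, Fin.val_castLT, Fin.val_succ, Fin.val_castSucc,
        true_and]
      omega
  · rintro ⟨i, j⟩ hij
    simp only [S, Finset.mem_filter_univ] at hij
    simp only [φ, Fin.val_succ, Fin.val_castLT, smul_smul, ← neg_smul]
    rw [face_face R k i j hij z]
    congr 1
    ring

variable (A)

/-- The submodule spanned by the tensors with an inner entry equal to `1`. -/
def degenerate (k : ℕ) : Submodule (Env R A) (Bar R A k) :=
  Submodule.span (Env R A)
    {z | ∃ a : Fin (k + 2) → A, (∃ i, i ≠ 0 ∧ i ≠ Fin.last (k + 1) ∧ a i = 1) ∧ pureTensor R A k a = z}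

variable {A}

lemma degenerate_of_eq_one {k : ℕ} {a : Fin (k + 2) → A} {i : Fin (k + 2)} (h0 : i ≠ 0)
    (hl : i ≠ Fin.last (k + 1)) (h : a i = 1) : pureTensor R A k a ∈ degenerate R A k :=
  Submodule.subset_span ⟨a, ⟨i, h0, hl, h⟩, rfl⟩

lemma degenerate_le_comap (k : ℕ) :
    degenerate R A (k + 1) ≤ (degenerate R A k).comap (barD R k) := by
  refine Submodule.span_le.2 ?_
  rintro _ ⟨a, ⟨i, h0, hl, h⟩, rfl⟩
  change ∑ j : Fin (k + 2), (-1 : ℤ) ^ (j : ℕ) • face R k j (pureTensor R A (k + 1) a) ∈ degenerate R A k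
  simp only [face_pure]
  have h0' : (i : ℕ) ≠ 0 := fun h => h0 (Fin.ext h)
  have hl' : (i : ℕ) ≠ k + 2 := fun h => hl (Fin.ext h)
  have hi := i.2
  let p : Fin (k + 2) := ⟨i - 1, by omega⟩
  let q : Fin (k + 2) := ⟨i, by omega⟩
  have hpq : p ≠ q := by simp only [p, q, ne_eq, Fin.mk.injEq]; omega
  have hp : i = p.succ := Fin.ext (by simp only [p, Fin.val_succ]; omega)
  have hq : i = q.castSucc := Fin.ext (by simp only [q, Fin.val_castSucc])
  have key : mergeAt A p a = mergeAt A q a := by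
    funext m
    have e1 : a p.succ = 1 := hp ▸ h
    have e2 : a q.castSucc = 1 := hq ▸ h
    have e3 : (q : ℕ) = p + 1 := by simp only [p, q]; omega
    simp only [merge_apply]
    rcases lt_trichotomy (m : ℕ) p with hm | hm | hm
    · rw [if_pos (Fin.lt_def.2 hm), if_pos (Fin.lt_def.2 (by omega))]
    · obtain rfl : m = p := Fin.ext hm
      rw [if_neg (lt_irrefl _), if_pos rfl, if_pos (Fin.lt_def.2 (by omega)), e1, mul_one]
    · rw [if_neg (by rw [Fin.lt_def]; omega), if_neg (by rw [Fin.ext_iff]; omega)]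
      by_cases hm' : m = q
      · subst hm'
        rw [if_neg (lt_irrefl _), if_pos rfl, e2, one_mul]
      · rw [if_neg (by rw [Fin.lt_def]; rw [Fin.ext_iff] at hm'; omega), if_neg hm']
  rw [← Finset.add_sum_erase _ _ (Finset.mem_univ p),
    ← Finset.add_sum_erase _ _ (Finset.mem_erase.2 ⟨hpq.symm, Finset.mem_univ q⟩), ← add_assoc]
  refine Submodule.add_mem _ ?_ (Submodule.sum_mem _ fun j hj => ?_)
  · have e3 : (q : ℕ) = p + 1 := by simp only [p, q]; omega
    rw [key, e3, pow_succ, mul_neg_one, neg_smul, add_neg_cancel]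
    exact Submodule.zero_mem _
  · simp only [Finset.mem_erase, Finset.mem_univ, and_true, ne_eq, Fin.ext_iff, p, q] at hj
    refine zsmul_mem ?_ _
    have hj2 := j.2
    rcases lt_or_gt_of_ne hj.1 with h' | h'
    · refine degenerate_of_eq_one R (i := p) ?_ ?_ ?_
      · simp only [p, ne_eq, Fin.ext_iff, Fin.val_zero]; omega
      · simp only [p, ne_eq, Fin.ext_iff, Fin.val_last]; omega
      · rw [merge_apply, if_neg, if_neg, ← hp, h]
        · simp only [p, Fin.ext_iff]; omega
        · simp only [p, Fin.lt_def]; omega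
    · refine degenerate_of_eq_one R (i := q) ?_ ?_ ?_
      · simp only [q, ne_eq, Fin.ext_iff, Fin.val_zero]; omega
      · simp only [q, ne_eq, Fin.ext_iff, Fin.val_last]; omega
      · rw [merge_apply, if_pos, ← hq, h]
        simp only [q, Fin.lt_def]; omega

variable (A)

/-- The normalized bar complex in degree `k`: the quotient of `A ⊗ ⋯ ⊗ A` (`k + 2` factors) by the
tensors with an inner entry equal to `1`, that is `A ⊗ (A / R) ⊗ ⋯ ⊗ (A / R) ⊗ A`. -/
abbrev NBar (k : ℕ) : Type u := Bar R A k ⧸ degenerate R A k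

/-- The differential of the normalized bar complex. -/
def nbarD (k : ℕ) : NBar R A (k + 1) →ₗ[Env R A] NBar R A k :=
  Submodule.mapQ _ _ (barD R k) (degenerate_le_comap R k)

lemma nbarD_nbarD (k : ℕ) : nbarD R A k ∘ₗ nbarD R A (k + 1) = 0 := by
  refine LinearMap.ext fun z => ?_
  obtain ⟨z, rfl⟩ := Submodule.Quotient.mk_surjective _ z
  simp only [LinearMap.comp_apply, nbarD, Submodule.mapQ_apply, barD_barD]
  rfl

/-- The normalized bar resolution of the bimodule `A`, as a chain complex of left
`A ⊗ Aᵒᵖ`-modules. -/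
def barComplex : ChainComplex (ModuleCat.{u} (Env R A)) ℕ :=
  ChainComplex.of (fun k => ModuleCat.of (Env R A) (NBar R A k))
    (fun k => ModuleCat.ofHom (nbarD R A k))
    (fun k => by rw [← ModuleCat.ofHom_comp, nbarD_nbarD]; rfl)

variable {A}

/-- The class of the tensor `1 ⊗ a₁ ⊗ ⋯ ⊗ aₖ ⊗ 1`. -/
def tensor {k : ℕ} (a : Fin k → A) : NBar R A k :=
  (degenerate R A k).mkQ (pureTensor R A k (Fin.cons 1 (Fin.snoc a 1 : Fin (k + 1) → A)))

section Basis

variable {R} {I : Type} (e : Module.Basis I R A) (o : I)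

lemma smul_pure_frame {k : ℕ} (x y : A) (a : Fin k → A) :
    (x ⊗ₜ[R] MulOpposite.op y : Env R A) •
      pureTensor R A k (Fin.cons 1 (Fin.snoc a 1 : Fin (k + 1) → A)) =
      pureTensor R A k (Fin.cons x (Fin.snoc a y : Fin (k + 1) → A)) := by
  rw [smul_pure]
  congr 1
  funext j
  refine Fin.cases ?_ (fun j => ?_) j
  · simp
  · rw [Function.update_of_ne (Fin.succ_ne_zero j), ← Fin.succ_last]
    refine Fin.lastCases ?_ (fun j => ?_) j
    · simp
    · rw [Function.update_of_ne (by simp [Fin.ext_iff, j.2.ne])]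
      simp

lemma frame_eta {k : ℕ} {α : Type*} (c : Fin (k + 2) → α) :
    c = Fin.cons (c 0) (Fin.snoc (fun i : Fin k => c i.castSucc.succ) (c (Fin.last (k + 1))) :
      Fin (k + 1) → α) := by
  funext j
  refine Fin.cases ?_ (fun j => ?_) j
  · simp
  · refine Fin.lastCases ?_ (fun j => ?_) j
    · simp
    · simp

lemma span_tensor (he : e o = 1) (k : ℕ) :
    ⊤ ≤ Submodule.span (Env R A)
      (Set.range fun v : Fin k → {i // i ≠ o} => tensor R (fun j => e (v j).1)) := by
  rintro z -
  obtain ⟨z, rfl⟩ := Submodule.mkQ_surjective _ z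
  let S := (Submodule.span (Env R A)
    (Set.range fun v : Fin k → {i // i ≠ o} => tensor R (fun j => e (v j).1))).comap
      (degenerate R A k).mkQ
  suffices (⊤ : Submodule R (Bar R A k)) ≤ S.restrictScalars R from this (Submodule.mem_top)
  have hs := (Basis.piTensorProduct (fun _ : Fin (k + 2) => e)).span_eq
  refine (le_of_eq hs.symm).trans (Submodule.span_le.2 ?_)
  rintro _ ⟨p, rfl⟩
  rw [Basis.piTensorProduct_apply]
  change (degenerate R A k).mkQ (pureTensor R A k (fun i => e (p i))) ∈ Submodule.span _ _
  by_cases h : ∃ i : Fin k, p i.castSucc.succ = o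
  · obtain ⟨i, hi⟩ := h
    have : pureTensor R A k (fun i => e (p i)) ∈ degenerate R A k :=
      degenerate_of_eq_one R (i := i.castSucc.succ) (Fin.succ_ne_zero _)
        (by simp [Fin.ext_iff, i.2.ne]) (by rw [hi, he])
    rw [Submodule.mkQ_apply, (Submodule.Quotient.mk_eq_zero _).2 this]
    exact Submodule.zero_mem _
  · push Not at h
    rw [frame_eta (fun i => e (p i)), ← smul_pure_frame, map_smul]
    exact Submodule.smul_mem _ _ (Submodule.subset_span ⟨fun i => ⟨_, h i⟩, rfl⟩)

/-- The value `(∏ᵢ e_{vᵢ}^*(aᵢ)) a₀ ⊗ aₖ₊₁` at `a₀ ⊗ ⋯ ⊗ aₖ₊₁`. -/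
def coeffVal {k : ℕ} (v : Fin k → I) (a : Fin (k + 2) → A) : Env R A :=
  (∏ i, e.coord (v i) (a i.castSucc.succ)) • (a 0 ⊗ₜ[R] MulOpposite.op (a (Fin.last (k + 1))))

lemma coeffVal_update {k : ℕ} (v : Fin k → I) (a : Fin (k + 2) → A) (j : Fin (k + 2)) :
    ∃ f : A →ₗ[R] Env R A, ∀ x, coeffVal e v (Function.update a j x) = f x := by
  have h0 : (0 : Fin (k + 2)) ≠ Fin.last (k + 1) := (Fin.last_pos).ne
  have hs : ∀ i : Fin k, i.castSucc.succ ≠ Fin.last (k + 1) := fun i => by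
    simp [Fin.ext_iff, i.2.ne]
  refine Fin.cases ?_ (fun j => ?_) j
  · refine ⟨(∏ i, e.coord (v i) (a i.castSucc.succ)) •
      (TensorProduct.mk R A Aᵐᵒᵖ).flip (MulOpposite.op (a (Fin.last (k + 1)))), fun x => ?_⟩
    simp only [coeffVal, Function.update_of_ne h0.symm, Function.update_self,
      Function.update_of_ne (Fin.succ_ne_zero _)]
    rfl
  · refine Fin.lastCases ?_ (fun j => ?_) j
    · refine ⟨(∏ i, e.coord (v i) (a i.castSucc.succ)) •
        (TensorProduct.mk R A Aᵐᵒᵖ (a 0) ∘ₗ (MulOpposite.opLinearEquiv R).toLinearMap),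
        fun x => ?_⟩
      rw [Fin.succ_last]
      simp only [coeffVal, Function.update_of_ne h0, Function.update_self,
        Function.update_of_ne (hs _)]
      rfl
    · refine ⟨(e.coord (v j)).smulRight ((∏ i ∈ Finset.univ.erase j,
        e.coord (v i) (a i.castSucc.succ)) •
          (a 0 ⊗ₜ[R] MulOpposite.op (a (Fin.last (k + 1))))), fun x => ?_⟩
      rw [LinearMap.smulRight_apply, smul_smul, coeffVal,
        Function.update_of_ne (Fin.succ_ne_zero _).symm, Function.update_of_ne (hs j).symm,
        ← Finset.mul_prod_erase _ _ (Finset.mem_univ j), Function.update_self]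
      congr 2
      refine Finset.prod_congr rfl fun i hi => ?_
      rw [Function.update_of_ne]
      intro h
      exact (Finset.mem_erase.1 hi).1 (Fin.castSucc_injective _ (Fin.succ_injective _ h))

/-- The coefficient at `1 ⊗ e_{v₁} ⊗ ⋯ ⊗ e_{vₖ} ⊗ 1` on the unnormalized complex. -/
def barCoeff {k : ℕ} (v : Fin k → I) : Bar R A k →ₗ[R] Env R A :=
  barLift (.mk' (coeffVal e v)
    (fun a j x y => by
      obtain ⟨f, h⟩ := coeffVal_update e v a j
      simp only [h, map_add])
    (fun a j r x => by
      obtain ⟨f, h⟩ := coeffVal_update e v a j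
      simp only [h, map_smul]))

lemma barCoeff_pure {k : ℕ} (v : Fin k → I) (a : Fin (k + 2) → A) :
    barCoeff e v (pureTensor R A k a) = coeffVal e v a :=
  barLift_pure _ a

lemma barCoeff_smul {k : ℕ} (v : Fin k → I) (c : Env R A) (z : Bar R A k) :
    barCoeff e v (c • z) = c • barCoeff e v z := by
  induction c using TensorProduct.induction_on with
  | zero =>
    exact (congrArg _ (zero_smul (Env R A) z)).trans
      ((map_zero _).trans (zero_smul (Env R A) (barCoeff e v z)).symm)
  | add c d hc hd => rw [add_smul, map_add, hc, hd, add_smul]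
  | tmul x y =>
    let T : Bar R A k →ₗ[R] Bar R A k := envAction R A k (x ⊗ₜ y)
    suffices (barCoeff e v) ∘ₗ T = LinearMap.mulLeft R (x ⊗ₜ y) ∘ₗ barCoeff e v from
      LinearMap.congr_fun this z
    refine bar_ext fun a => ?_
    change barCoeff e v ((x ⊗ₜ[R] y : Env R A) • pureTensor R A k a) =
      (x ⊗ₜ[R] y : Env R A) * barCoeff e v (pureTensor R A k a)
    have h0 : (0 : Fin (k + 2)) ≠ Fin.last (k + 1) := (Fin.last_pos).ne
    have hs : ∀ i : Fin k, i.castSucc.succ ≠ Fin.last (k + 1) := fun i => by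
      simp [Fin.ext_iff, i.2.ne]
    rw [smul_pure, barCoeff_pure, barCoeff_pure, coeffVal, coeffVal, mul_smul_comm,
      Algebra.TensorProduct.tmul_mul_tmul]
    simp only [Function.update_of_ne h0.symm, Function.update_self,
      Function.update_of_ne (Fin.succ_ne_zero _), Function.update_of_ne (hs _)]
    rfl

/-- The coefficient at `1 ⊗ e_{v₁} ⊗ ⋯ ⊗ e_{vₖ} ⊗ 1` on the normalized complex. -/
def nbarCoeff (he : e o = 1) {k : ℕ} (v : Fin k → {i // i ≠ o}) : NBar R A k →ₗ[Env R A] Env R A :=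
  Submodule.liftQ _
    { toFun := barCoeff e (fun i => (v i).1)
      map_add' := map_add _
      map_smul' := barCoeff_smul e _ }
    (by
      refine Submodule.span_le.2 ?_
      rintro _ ⟨a, ⟨i, h0, hl, h⟩, rfl⟩
      change barCoeff e (fun i => (v i).1) (pureTensor R A k a) = 0
      obtain ⟨j, rfl⟩ := Fin.exists_succ_eq.2 h0
      obtain ⟨j, rfl⟩ := Fin.exists_castSucc_eq.2 (fun h : j = Fin.last k => hl (by rw [h]; rfl))
      rw [barCoeff_pure, coeffVal, Finset.prod_eq_zero (Finset.mem_univ j), zero_smul]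
      rw [h, ← he, Module.Basis.coord_apply, Module.Basis.repr_self, Finsupp.single_eq_of_ne]
      exact (v j).2)

lemma nbarCoeff_tensor (he : e o = 1) {k : ℕ} (v w : Fin k → {i // i ≠ o}) [Decidable (v = w)] :
    nbarCoeff e o he v (tensor R fun i => e (w i).1) = if v = w then 1 else 0 := by
  change barCoeff e (fun i => (v i).1) (pureTensor R A k _) = _
  rw [barCoeff_pure, coeffVal, ← Fin.succ_last]
  simp only [Fin.cons_succ, Fin.snoc_castSucc, Fin.cons_zero, Fin.snoc_last,
    Module.Basis.coord_apply, Module.Basis.repr_self]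
  split_ifs with h
  · subst h
    simp only [Finsupp.single_eq_same, Finset.prod_const_one, one_smul]
    rfl
  · obtain ⟨i, hi⟩ := Function.ne_iff.1 h
    rw [Finset.prod_eq_zero (Finset.mem_univ i), zero_smul]
    exact Finsupp.single_eq_of_ne fun h => hi (Subtype.ext h)

/-- If `e` is an `R`-basis of `A` containing `1 = e o`, then the tensors
`1 ⊗ e_{i₁} ⊗ ⋯ ⊗ e_{iₖ} ⊗ 1` with all `iⱼ ≠ o` form an `A ⊗ Aᵒᵖ`-basis of the normalized bar
complex in degree `k`. -/
def tensorBasis (he : e o = 1) (k : ℕ) : Module.Basis (Fin k → {i // i ≠ o}) (Env R A) (NBar R A k) :=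
  .mk (v := fun v => tensor R (fun j => e (v j).1))
    (LinearIndependent.of_pairwise_dual_eq_zero_one _ (nbarCoeff e o he)
      (fun v w h => by classical exact (nbarCoeff_tensor e o he v w).trans (if_neg h))
      (fun v => by classical exact (nbarCoeff_tensor e o he v v).trans (if_pos rfl)))
    (span_tensor e o he k)

lemma tensorBasis_apply (he : e o = 1) (k : ℕ) (v : Fin k → {i // i ≠ o}) :
    tensorBasis e o he k v = tensor R fun j => e (v j).1 :=
  Module.Basis.mk_apply _ _ _

end Basis

end Bar
end NormalizedBar

namespace AlgMorse

section Morse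

variable {S : Type u} [Ring S] {C : ChainComplex (ModuleCat.{u} S) ℕ} {ι : ℕ → Type}
  (β : ∀ k, Module.Basis (ι k) S (C.X k)) (M : (Σ k, ι k) → (Σ k, ι k) → Prop)

/-- The weight of `u → v`: the entry at `(u, v)` of the matrix of the differential. The digraph
of a based complex has as vertices all basis elements, and an edge wherever the weight is
nonzero. -/
def edgeWeight (u v : Σ k, ι k) : S :=
  (β v.1).repr (C.d u.1 v.1 (β u.1 u.2)) v.2

/-- The edges of the digraph in which all the edges of `M` have been reversed. -/
def MorseStep (u v : Σ k, ι k) : Prop :=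
  (edgeWeight β u v ≠ 0 ∧ ¬ M u v) ∨ M v u

open Classical in
/-- The weights of the modified digraph: reversing an edge of weight `w` gives weight `-w⁻¹`. -/
def stepWeight (u v : Σ k, ι k) : S :=
  if M v u then -Ring.inverse (edgeWeight β v u) else edgeWeight β u v

/-- Directed paths (zig-zag paths) in the modified digraph. -/
inductive ZigZag : (Σ k, ι k) → (Σ k, ι k) → Type
  | nil (u : Σ k, ι k) : ZigZag u u
  | cons {u v z : Σ k, ι k} (h : MorseStep β M u v) (p : ZigZag v z) : ZigZag u z

variable {β M} in
/-- The weight of a path: the product of the weights of its steps, in the order of traversal (the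
modules are left modules, so this is the order in which coefficients are collected). -/
def ZigZag.weight : {u v : Σ k, ι k} → ZigZag β M u v → S
  | _, _, .nil _ => 1
  | _, _, .cons (u := u) (v := v) _ p => stepWeight β M u v * p.weight

/-- The sum of the weights of all directed paths from `u` to `v`. -/
def pathSum (u v : Σ k, ι k) : S :=
  ∑ᶠ p : ZigZag β M u v, p.weight

/-- `M` is a Morse matching: a set of edges with invertible weights, no two of them sharing a
vertex, such that the modified digraph has no directed cycle and no infinite directed path in two
adjacent degrees. -/
structure IsMorseMatching : Prop where
  edge : ∀ u v, M u v → edgeWeight β u v ≠ 0 ∧ IsUnit (edgeWeight β u v)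
  matching : ∀ u v u' v', M u v → M u' v' → (u = u' ∨ u = v' ∨ v = u' ∨ v = v') →
    u = u' ∧ v = v'
  acyclic : ∀ u, ¬ Relation.TransGen (MorseStep β M) u u
  noInfinitePath : ∀ (k : ℕ) (f : ℕ → Σ k, ι k), (∀ i, (f i).1 = k ∨ (f i).1 = k + 1) →
    ¬ ∀ i, MorseStep β M (f i) (f (i + 1))

/-- A vertex is critical if it is not an endpoint of an edge of `M`. -/
def IsCritical (u : Σ k, ι k) : Prop := ∀ v, ¬ M u v ∧ ¬ M v u

/-- The critical vertices in degree `k`. -/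
abbrev Crit (k : ℕ) : Type := {u : ι k // IsCritical M ⟨k, u⟩}

/-- The Morse complex in degree `k`: the free module on the critical vertices. -/
abbrev morseX (S : Type u) [Ring S] (k : ℕ) : ModuleCat.{u} S := ModuleCat.of S (Crit M k →₀ S)

variable [∀ k, Finite (ι k)]

/-- The Morse differential `c ↦ ∑ (sum of the weights of the paths from c to c') c'`. -/
def morseD (k : ℕ) : morseX M S (k + 1) ⟶ morseX M S k :=
  ModuleCat.ofHom (Finsupp.linearCombination S fun c : Crit M (k + 1) =>
    Finsupp.equivFunOnFinite.symm fun c' : Crit M k => pathSum β M ⟨k + 1, c.1⟩ ⟨k, c'.1⟩)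

/-- The map `h` from the Morse complex to `C`,
`c ↦ ∑ (sum of the weights of the paths from c to v) v`. -/
def morseHom (k : ℕ) : morseX M S k ⟶ C.X k :=
  ModuleCat.ofHom (Finsupp.linearCombination S fun c : Crit M k =>
    (β k).repr.symm (Finsupp.equivFunOnFinite.symm fun v : ι k => pathSum β M ⟨k, c.1⟩ ⟨k, v⟩))

/-- The map `h⁻¹` from `C` to the Morse complex,
`v ↦ ∑ (sum of the weights of the paths from v to c) c`. -/
def morseInv (k : ℕ) : C.X k ⟶ morseX M S k :=
  ModuleCat.ofHom ((Finsupp.linearCombination S fun v : ι k =>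
    (Finsupp.equivFunOnFinite.symm fun c : Crit M k => pathSum β M ⟨k, v⟩ ⟨k, c.1⟩ :
      Crit M k →₀ S)) ∘ₗ (β k).repr.toLinearMap)

end Morse

end AlgMorse

namespace ExteriorBar

open NormalizedBar AlgMorse

section Exterior

variable (R : Type u) [CommRing R] (n : ℕ)

/-- The exterior algebra `Λ[x₁, …, xₙ]`. -/
abbrev ExtAlg : Type u := ExteriorAlgebra R (Fin n → R)

variable {n} in
/-- The generators `xᵢ`. -/
def xGen (i : Fin n) : ExtAlg R n := ExteriorAlgebra.ι R (Pi.single i 1)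

/-- The basis of the exterior algebra consisting of the `x_σ`, the products in increasing order of
the generators `xᵢ` with `i ∈ σ`. -/
def extBasis : Module.Basis (Finset (Fin n)) R (ExtAlg R n) :=
  (Pi.basisFun R (Fin n)).ExteriorAlgebra

lemma extBasis_apply (σ : Finset (Fin n)) :
    extBasis R n σ = ((σ.sort (· ≤ ·)).map (xGen R)).prod := by
  have h : (σ.sort (· ≤ ·)) = List.ofFn (σ.orderEmbOfFin rfl) := by
    refine List.ext_getElem (by simp) fun i h1 h2 => ?_
    simp [Finset.orderEmbOfFin_apply]
  rw [extBasis, ExteriorAlgebra.basis_apply_ofCard _ (rfl : σ.card = σ.card), h, List.map_ofFn]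
  change ExteriorAlgebra.ιMulti R _ _ = _
  rw [ExteriorAlgebra.ιMulti_apply]
  congr 2
  funext i
  simp only [Function.comp_apply, Pi.basisFun_apply, xGen]
  rfl

lemma extBasis_empty : extBasis R n ∅ = 1 := by
  simp [extBasis_apply]

/-- The nonempty subsets of `{1, …, n}`. -/
abbrev NE : Type := {σ : Finset (Fin n) // σ ≠ ∅}

/-- The normalized bar resolution of the exterior algebra. -/
abbrev extBar : ChainComplex (ModuleCat.{u} (Env R (ExtAlg R n))) ℕ := barComplex R (ExtAlg R n)

/-- The basis of the normalized bar resolution consisting of the tensors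
`1 ⊗ x_{σ₁} ⊗ ⋯ ⊗ x_{σₖ} ⊗ 1` with nonempty `σ₁, …, σₖ`. -/
def barBasis (k : ℕ) : Module.Basis (Fin k → NE n) (Env R (ExtAlg R n)) ((extBar R n).X k) :=
  tensorBasis (extBasis R n) ∅ (extBasis_empty R n) k

lemma barBasis_apply (k : ℕ) (v : Fin k → NE n) :
    barBasis R n k v = tensor R fun j => extBasis R n (v j).1 :=
  tensorBasis_apply _ _ _ _ _

/-- The vertices of the digraph of the bar resolution. -/
abbrev Vertex : Type := Σ k, Fin k → NE n

variable {n}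

/-- The list `σ₁, …, σₖ` of a vertex. -/
def Vertex.sets (v : Vertex n) : List (Finset (Fin n)) := List.ofFn fun j => (v.2 j).1

/-- The matching: the edges from
`1 ⊗ x_{i₁} ⊗ ⋯ ⊗ x_{i_{r-1}} ⊗ x_i ⊗ x_{σ ∖ {i}} ⊗ ⋯ ⊗ 1` to
`1 ⊗ x_{i₁} ⊗ ⋯ ⊗ x_{i_{r-1}} ⊗ x_σ ⊗ ⋯ ⊗ 1` with `i₁ ≤ ⋯ ≤ i_{r-1} ≤ i = max σ`. -/
def matching (u v : Vertex n) : Prop :=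
  ∃ (L : List (Fin n)) (i : Fin n) (σ : Finset (Fin n)) (T : List (Finset (Fin n))),
    u.sets = L.map ({·}) ++ {i} :: σ.erase i :: T ∧ v.sets = L.map ({·}) ++ σ :: T ∧
    (L ++ [i]).Pairwise (· ≤ ·) ∧ i ∈ σ ∧ ∀ j ∈ σ, j ≤ i

/-- The vertex `1 ⊗ x_{a₁} ⊗ ⋯ ⊗ x_{aₖ} ⊗ 1`. -/
def vars {k : ℕ} (a : Fin k → Fin n) : Fin k → NE n :=
  fun j => ⟨{a j}, Finset.singleton_ne_empty _⟩

lemma isCritical_vars {k : ℕ} {τ : Fin k → Fin n} (hτ : Monotone τ) :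
    IsCritical (matching (n := n)) ⟨k, vars τ⟩ := by
  have key : Vertex.sets (⟨k, vars τ⟩ : Vertex n) = (List.ofFn τ).map ({·}) := by
    rw [List.map_ofFn]; rfl
  rintro ⟨l, v⟩
  constructor
  · rintro ⟨L, i, σ, T, h1, -, -, hi, hm⟩
    rw [key, List.map_eq_append_iff] at h1
    obtain ⟨P, Q, hPQ, -, hQ⟩ := h1
    rw [List.map_eq_cons_iff] at hQ
    obtain ⟨i', Q', rfl, hi', hQ⟩ := hQ
    rw [List.map_eq_cons_iff] at hQ
    obtain ⟨j, Q'', rfl, hj, -⟩ := hQ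
    obtain rfl := Finset.singleton_injective hi'
    have hs : (List.ofFn τ).Pairwise (· ≤ ·) := by
      rw [List.pairwise_ofFn]; exact fun a b h => hτ h.le
    rw [hPQ, List.pairwise_append, List.pairwise_cons] at hs
    have h1 : i' ≤ j := hs.2.1.1 j (by simp)
    have h2 : j ∈ σ.erase i' := hj ▸ Finset.mem_singleton_self j
    rw [Finset.mem_erase] at h2
    exact h2.1 (le_antisymm (hm _ h2.2) h1)
  · rintro ⟨L, i, σ, T, h1, h2, -, hi, hm⟩
    rw [key, List.map_eq_append_iff] at h2
    obtain ⟨P, Q, -, -, hQ⟩ := h2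
    rw [List.map_eq_cons_iff] at hQ
    obtain ⟨j, Q', -, rfl, -⟩ := hQ
    have : ({j} : Finset (Fin n)).erase i ∈ Vertex.sets (⟨l, v⟩ : Vertex n) := by rw [h1]; simp
    obtain ⟨m, hm'⟩ := (List.mem_ofFn' _ _).1 this
    refine (v m).2 (hm'.trans ?_)
    rw [Finset.mem_singleton.1 hi, Finset.erase_singleton]

/-- The generator `x_(τ)` of the Morse complex. -/
def xMulti {k : ℕ} (τ : Fin k → Fin n) (hτ : Monotone τ) :
    morseX (matching (n := n)) (Env R (ExtAlg R n)) k :=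
  Finsupp.single ⟨vars τ, isCritical_vars hτ⟩ 1

/-- The tensor `1 ⊗ x_{a₁} ⊗ ⋯ ⊗ x_{aₖ} ⊗ 1` of the bar resolution. -/
def xTensor {k : ℕ} (a : Fin k → Fin n) : (extBar R n).X k :=
  tensor R fun j => xGen R (a j)

end Exterior

end ExteriorBar

end

open NormalizedBar AlgMorse ExteriorBar

/-!
The theorem combines algebraic Morse theory for a based chain complex with an analysis of one
matching on the basis of the bar resolution of an exterior algebra.

*Morse theory.* On the free module on all vertices, the differential is `D + E`, where `E` consists
of the edges in the matching and `D` of the other ones, and `U` is given by the reversed edges. That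
the edges are disjoint with invertible weights means `E * E = 0`, `U * U = 0`, `U * E * U = -U` and
`E * U * E = -E`, and `π = 1 + U * E + E * U` is the projection onto the critical vertices. If there
is no infinite path, then `1 - D * U` and `1 - U * D` have inverses `X` and `Y`, the sums over the
alternating paths (`exists_resolvent`). Two steps up never follow each other, so the paths of the
right total degree between a critical vertex and another vertex are exactly the alternating ones.
Hence `h`, `h⁻¹` and the Morse differential are the restrictions of `Y * π`, `π * X` and
`π * X * D * π` (`exists_zigzag_operators`, `exists_restrictions`). What is to be shown for them are
ring identities: `π * X * Y * π = π` (`crit_inv_inv_crit`), compatibility with the differentials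
(`diff_inv_crit`, `crit_inv_diff`), and `Y * π * X = 1 + (D + E) * Θ + Θ * (D + E)` with `Θ = U * X`
as the homotopy (`flow_eq`). The result is `exists_homotopyEquiv`.

*The matching.* A basis element is a list of nonempty subsets of `Fin n`. An edge either drops an
outer set or merges two disjoint neighbours `A, B` into `A ∪ B` (`edge_cases`); distinct faces never
give the same basis element if one of them is inner, so the weight of a merging is a sign
(`edgeWeight_of_merge`). All steps lower the lexicographic `rank`: dropping a set lowers the number
of entries, which merging preserves; merging lowers the number of pairs `a < b` in different sets,
`a` left of `b`, by the number of such pairs in `A × B`. In the remaining case `A > B`, a step down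
to the lower end of an edge of the matching is that edge itself or starts at such a lower end as
well (`Matched.split`); so after a reversed edge, the path can only go down until one of the two
numbers drops. The rank excludes cycles
and infinite paths. A list is unmatched exactly if it consists of weakly increasing singletons
(`isCritical_iff_sets`).

*Paths between words.* A list of singletons is a word in `Fin n`. Paths do not increase the number
of entries, so in a path from a word back to the same degree `k` the lists of `k` sets with at most
`k` entries are words again. If the target has a first descent `i > j`, then the path must end with
the reversed edge from the list with `{i, j}` merged, preceded by the step from the word with
`j, i` instead of `i, j` (`exists_eq_append_swap`); these two steps have total weight `1` because
`x_j x_i = -x_i x_j` (`swap_steps`). Induction by sorting gives exactly one path from a weakly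
increasing word to each rearrangement, of weight `1`, and none to other vertices of degree `k`
(`exists_unique_path`, `perm_of_path`), which is the formula for `h`. A word is never the lower end
of an edge of the matching, so no path from it starts upwards and it cannot reach a critical vertex
of the same degree other than itself (`eq_of_path_word`), which is the formula for `h⁻¹`.
-/

/-! ### Identities in a ring

Here `D` stands for the steps down outside the matching, `E` for the edges of the matching, `U` for
the reversed edges, `1 + U * E + E * U` for the projection `π` onto the critical vertices, and `X`,
`Y`, `P` for the inverses of `1 - D * U`, `1 - U * D` and `1 - (D + U)`. They will be endomorphisms,
so that the step taken first is the right factor of a product. -/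

namespace AlgMorse

section Ring

variable {A : Type*} [Ring A] {D E U X Y P : A}

lemma crit_mul_up (hU : U * U = 0) (hUEU : U * E * U = -U) : (1 + U * E + E * U) * U = 0 := by
  calc (1 + U * E + E * U) * U = U + U * E * U + E * (U * U) := by noncomm_ring
    _ = 0 := by rw [hU, hUEU]; simp

lemma up_mul_crit (hU : U * U = 0) (hUEU : U * E * U = -U) : U * (1 + U * E + E * U) = 0 := by
  calc U * (1 + U * E + E * U) = U + U * E * U + U * U * E := by noncomm_ring
    _ = 0 := by rw [hU, hUEU]; simp

lemma crit_mul_crit (hU : U * U = 0) (hE : E * E = 0) (hUEU : U * E * U = -U)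
    (hEUE : E * U * E = -E) :
    (1 + U * E + E * U) * (1 + U * E + E * U) = 1 + U * E + E * U := by
  have h := crit_mul_up hU hUEU
  calc (1 + U * E + E * U) * (1 + U * E + E * U)
      = (1 + U * E + E * U) + ((1 + U * E + E * U) * U) * E +
        (E + U * (E * E) + E * U * E) * U := by noncomm_ring
    _ = 1 + U * E + E * U := by rw [h, hE, hEUE]; simp

/-- The composite `Y * π * X`, from the complex to the Morse complex and back, differs from the
identity by the boundary of the homotopy `U * X`. -/
lemma flow_eq (hW : (D + E) * (D + E) = 0) (hE : E * E = 0)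
    (hX : (1 - D * U) * X = 1) (hY : Y * (1 - U * D) = 1) :
    Y * (1 + U * E + E * U) * X = 1 + (D + E) * (U * X) + (U * X) * (D + E) := by
  have hΘ : Y * U = U * X := by
    calc Y * U = Y * (U * ((1 - D * U) * X)) := by rw [hX, mul_one]
      _ = Y * (1 - U * D) * U * X := by noncomm_ring
      _ = U * X := by rw [hY, one_mul]
  have key : (1 - U * D) * (1 - D * U) + (1 - U * D) * (D + E) * U + U * (D + E) * (1 - D * U) =
      1 + U * E + E * U := by
    calc _ = 1 + U * E + E * U - U * ((D + E) * (D + E)) * U + U * (E * E) * U := by noncomm_ring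
      _ = 1 + U * E + E * U := by rw [hW, hE]; simp
  -- substitute the left side of `key` for the projection; each factor meets its inverse
  rw [← key]
  calc _ = (Y * (1 - U * D)) * ((1 - D * U) * X) + (Y * (1 - U * D)) * (D + E) * (U * X) +
      (Y * U) * (D + E) * ((1 - D * U) * X) := by noncomm_ring
    _ = _ := by rw [hX, hY, hΘ]; simp

/-- The composite from the Morse complex to the complex and back is the identity: each product in
`X * Y` other than `1` begins or ends with `U`, which the projection annihilates. -/
lemma crit_inv_inv_crit (hU : U * U = 0) (hE : E * E = 0) (hUEU : U * E * U = -U)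
    (hEUE : E * U * E = -E) (hX : X * (1 - D * U) = 1) (hY : (1 - U * D) * Y = 1) :
    (1 + U * E + E * U) * X * (Y * (1 + U * E + E * U)) = 1 + U * E + E * U := by
  have hX1 : X = 1 + X * D * U := by
    calc X = X * (1 - D * U) + X * D * U := by noncomm_ring
      _ = _ := by rw [hX]
  have hY1 : Y = 1 + U * D * Y := by
    calc Y = (1 - U * D) * Y + U * D * Y := by noncomm_ring
      _ = _ := by rw [hY]
  have h1 := crit_mul_up hU hUEU
  have h2 := up_mul_crit hU hUEU
  have h3 := crit_mul_crit hU hE hUEU hEUE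
  generalize hc : 1 + U * E + E * U = c at h1 h2 h3 ⊢
  have hXY : X * Y = 1 + X * D * U + U * D * Y := by
    calc X * Y = (1 + X * D * U) * (1 + U * D * Y) := by rw [← hX1, ← hY1]
      _ = 1 + X * D * U + U * D * Y + X * D * (U * U) * D * Y := by noncomm_ring
      _ = _ := by rw [hU]; simp
  calc c * X * (Y * c) = c * (X * Y) * c := by noncomm_ring
    _ = c * c + c * X * D * (U * c) + (c * U) * D * Y * c := by rw [hXY]; noncomm_ring
    _ = c := by rw [h1, h2, h3]; simp

/-- The boundary `D + E` of the complex, transported to the Morse complex, is the sum over the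
alternating paths that start with a step downwards. -/
lemma crit_diff_crit (hU : U * U = 0) (hE : E * E = 0) (hUEU : U * E * U = -U)
    (hEUE : E * U * E = -E) (hX' : X * (1 - D * U) = 1) (hY : (1 - U * D) * Y = 1) :
    (1 + U * E + E * U) * X * (D + E) * (Y * (1 + U * E + E * U)) =
      (1 + U * E + E * U) * X * D * (1 + U * E + E * U) := by
  have hX1 : X = 1 + X * D * U := by
    calc X = X * (1 - D * U) + X * D * U := by noncomm_ring
      _ = _ := by rw [hX']
  have hY1 : Y = 1 + U * D * Y := by
    calc Y = (1 - U * D) * Y + U * D * Y := by noncomm_ring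
      _ = _ := by rw [hY]
  have hDY : D * Y = X * D := by
    calc D * Y = X * (1 - D * U) * D * Y := by rw [hX', one_mul]
      _ = X * D * ((1 - U * D) * Y) := by noncomm_ring
      _ = _ := by rw [hY, mul_one]
  have h1 := crit_mul_up hU hUEU
  have h2 : E * (1 + U * E + E * U) = 0 := by
    calc E * (1 + U * E + E * U) = E + E * U * E + E * E * U := by noncomm_ring
      _ = 0 := by rw [hEUE, hE]; simp
  have h3 := crit_mul_crit hU hE hUEU hEUE
  have h4 : (1 + U * E + E * U) * X * (1 + E * U) = 1 + U * E + E * U := by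
    calc (1 + U * E + E * U) * X * (1 + E * U)
        = (1 + U * E + E * U) * (1 + X * D * U) * (1 + E * U) := by rw [← hX1]
      _ = (1 + U * E + E * U) * (1 + U * E + E * U) - ((1 + U * E + E * U) * U) * E +
          (1 + U * E + E * U) * X * D * (U + U * E * U) := by noncomm_ring
      _ = _ := by rw [h1, h3, hUEU]; simp
  generalize hc : 1 + U * E + E * U = c at h1 h2 h3 h4 ⊢
  have h5 : (D + E) * (Y * c) = (1 + E * U) * D * Y * c := by
    calc (D + E) * (Y * c) = D * Y * c + E * (Y * c) := by noncomm_ring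
      _ = D * Y * c + E * ((1 + U * D * Y) * c) := by rw [← hY1]
      _ = (1 + E * U) * D * Y * c + E * c := by noncomm_ring
      _ = _ := by rw [h2, add_zero]
  calc c * X * (D + E) * (Y * c) = c * X * ((D + E) * (Y * c)) := by noncomm_ring
    _ = (c * X * (1 + E * U)) * (D * Y) * c := by rw [h5]; noncomm_ring
    _ = (c * X) * D * c := by
      rw [h4, hDY]
      calc c * (X * D) * c = (c * X) * D * c := by noncomm_ring
    _ = _ := by noncomm_ring

/-- The map `Y * π` from the Morse complex to the complex commutes with the differentials. -/
lemma diff_inv_crit (hW : (D + E) * (D + E) = 0) (hU : U * U = 0) (hE : E * E = 0)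
    (hUEU : U * E * U = -U) (hEUE : E * U * E = -E) (hX : (1 - D * U) * X = 1)
    (hX' : X * (1 - D * U) = 1) (hY : (1 - U * D) * Y = 1) (hY' : Y * (1 - U * D) = 1) :
    (D + E) * (Y * (1 + U * E + E * U)) =
      Y * (1 + U * E + E * U) * ((1 + U * E + E * U) * X * D * (1 + U * E + E * U)) := by
  have h1 := flow_eq hW hE hX hY'
  have h2 := crit_inv_inv_crit hU hE hUEU hEUE hX' hY
  have h3 := crit_diff_crit hU hE hUEU hEUE hX' hY
  have h4 := crit_mul_crit hU hE hUEU hEUE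
  generalize hc : 1 + U * E + E * U = c at h1 h2 h3 h4 ⊢
  have h5 : (D + E) * (Y * c * X) = (Y * c * X) * (D + E) := by
    rw [h1]
    calc _ = (D + E) + (D + E) * (D + E) * U * X + (D + E) * (U * X) * (D + E) := by noncomm_ring
      _ = (D + E) + U * X * ((D + E) * (D + E)) + (D + E) * (U * X) * (D + E) := by
        rw [hW]; simp
      _ = _ := by noncomm_ring
  calc (D + E) * (Y * c) = (D + E) * (Y * (c * X * (Y * c))) := by rw [h2]
    _ = (D + E) * (Y * c * X) * (Y * c) := by noncomm_ring
    _ = Y * c * X * (D + E) * (Y * c) := by rw [h5]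
    _ = Y * (c * c) * X * (D + E) * (Y * c) := by rw [h4]
    _ = Y * c * (c * X * (D + E) * (Y * c)) := by noncomm_ring
    _ = _ := by rw [h3]

/-- The map `π * X` from the complex to the Morse complex commutes with the differentials. -/
lemma crit_inv_diff (hW : (D + E) * (D + E) = 0) (hU : U * U = 0) (hE : E * E = 0)
    (hUEU : U * E * U = -U) (hEUE : E * U * E = -E) (hX : (1 - D * U) * X = 1)
    (hX' : X * (1 - D * U) = 1) (hY : (1 - U * D) * Y = 1) (hY' : Y * (1 - U * D) = 1) :
    (1 + U * E + E * U) * X * (D + E) =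
      (1 + U * E + E * U) * X * D * (1 + U * E + E * U) * ((1 + U * E + E * U) * X) := by
  have h1 := flow_eq hW hE hX hY'
  have h2 := crit_inv_inv_crit hU hE hUEU hEUE hX' hY
  have h3 := crit_diff_crit hU hE hUEU hEUE hX' hY
  have h4 := crit_mul_crit hU hE hUEU hEUE
  generalize hc : 1 + U * E + E * U = c at h1 h2 h3 h4 ⊢
  have h5 : (D + E) * (Y * c * X) = (Y * c * X) * (D + E) := by
    rw [h1]
    calc _ = (D + E) + (D + E) * (D + E) * U * X + (D + E) * (U * X) * (D + E) := by noncomm_ring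
      _ = (D + E) + U * X * ((D + E) * (D + E)) + (D + E) * (U * X) * (D + E) := by
        rw [hW]; simp
      _ = _ := by noncomm_ring
  calc c * X * (D + E) = c * X * (Y * c) * X * (D + E) := by rw [h2]
    _ = c * X * (Y * c * X * (D + E)) := by noncomm_ring
    _ = c * X * (D + E) * (Y * c) * X := by rw [← h5]; noncomm_ring
    _ = c * X * D * (c * c) * X := by rw [h3, h4]
    _ = _ := by noncomm_ring

/-- A path into a critical vertex alternates between steps up and steps down, up first, or has an
alternating beginning that is followed by another step down. -/
lemma crit_mul_paths (hU : U * U = 0) (hUEU : U * E * U = -U) (hX : (1 - D * U) * X = 1)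
    (hP : P * (1 - (D + U)) = 1) :
    (1 + U * E + E * U) * P =
      (1 + U * E + E * U) * X + (1 + U * E + E * U) * P * D * X := by
  have h1 := crit_mul_up hU hUEU
  generalize 1 + U * E + E * U = c at h1 ⊢
  have hP1 : P = 1 + P * D + P * U := by
    calc P = P * (1 - (D + U)) + P * D + P * U := by noncomm_ring
      _ = _ := by rw [hP]
  have h2 : c * P * U = c * P * D * U := by
    calc c * P * U = c * (1 + P * D + P * U) * U := by rw [← hP1]
      _ = c * U + c * P * D * U + c * P * (U * U) := by noncomm_ring
      _ = _ := by rw [h1, hU]; simp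
  calc c * P = c * P * ((1 - D * U) * X) := by rw [hX, mul_one]
    _ = (c * P - c * P * D * U) * X := by noncomm_ring
    _ = (c * (1 + P * D + P * U) - c * P * D * U) * X := by rw [← hP1]
    _ = (c + c * P * D + (c * P * U - c * P * D * U)) * X := by noncomm_ring
    _ = c * X + c * P * D * X := by rw [h2]; noncomm_ring

/-- A path from a critical vertex alternates between steps down and steps up, down first, or has an
alternating end that another step down precedes. -/
lemma paths_mul_crit (hU : U * U = 0) (hUEU : U * E * U = -U) (hY : Y * (1 - U * D) = 1)
    (hP : (1 - (D + U)) * P = 1) :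
    P * (1 + U * E + E * U) =
      Y * (1 + U * E + E * U) + Y * D * P * (1 + U * E + E * U) := by
  have h1 := up_mul_crit hU hUEU
  generalize 1 + U * E + E * U = c at h1 ⊢
  have hP1 : P = 1 + D * P + U * P := by
    calc P = (1 - (D + U)) * P + D * P + U * P := by noncomm_ring
      _ = _ := by rw [hP]
  have h2 : U * P * c = U * D * P * c := by
    calc U * P * c = U * (1 + D * P + U * P) * c := by rw [← hP1]
      _ = U * c + U * D * P * c + (U * U) * P * c := by noncomm_ring
      _ = _ := by rw [h1, hU]; simp
  calc P * c = (Y * (1 - U * D)) * P * c := by rw [hY, one_mul]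
    _ = Y * (P * c - U * D * P * c) := by noncomm_ring
    _ = Y * ((1 + D * P + U * P) * c - U * D * P * c) := by rw [← hP1]
    _ = Y * (c + D * P * c + (U * P * c - U * D * P * c)) := by noncomm_ring
    _ = _ := by rw [h2]; noncomm_ring

end Ring
end AlgMorse

/-! ### Endomorphisms of free modules, and paths -/

namespace AlgMorse

section Resolvent

variable {S : Type*} [Ring S] {V : Type*}

/-- If `T` only leads downwards along a well-founded relation, then `1 - T` is invertible, and the
inverse leads only along chains of `T`. -/
lemma exists_resolvent (T : Module.End S (V →₀ S)) {r : V → V → Prop} (hr : WellFounded r)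
    (hT : ∀ u v, T (.single u 1) v ≠ 0 → r v u) :
    ∃ X : Module.End S (V →₀ S), (1 - T) * X = 1 ∧ X * (1 - T) = 1 ∧
      ∀ u v, X (.single u 1) v ≠ 0 →
        Relation.ReflTransGen (fun u v => T (.single u 1) v ≠ 0) u v := by
  classical
  let row : V → (V →₀ S) := hr.fix fun u ih =>
    .single u 1 + ∑ v ∈ (T (.single u 1)).support.attach,
      T (.single u 1) v • ih v (hT u v (Finsupp.mem_support_iff.1 v.2))
  have hrow : ∀ u, row u = .single u 1 + Finsupp.linearCombination S row (T (.single u 1)) := by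
    intro u
    refine (hr.fix_eq _ u).trans ?_
    rw [Finsupp.linearCombination_apply, Finsupp.sum,
      ← Finset.sum_attach (T (.single u 1)).support]
  refine ⟨Finsupp.linearCombination S row, ?_, ?_, ?_⟩
  · refine Finsupp.lhom_ext' fun u => LinearMap.ext_ring ?_
    simp only [LinearMap.comp_apply, Finsupp.lsingle_apply, Module.End.mul_apply,
      Finsupp.linearCombination_single, one_smul, Module.End.one_apply]
    induction u using hr.induction with
    | _ u ih =>
    have : (1 - T) (Finsupp.linearCombination S row (T (.single u 1))) = T (.single u 1) := by
      rw [Finsupp.linearCombination_apply, Finsupp.sum, map_sum]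
      conv_rhs => rw [← Finsupp.sum_single (T (.single u 1)), Finsupp.sum]
      refine Finset.sum_congr rfl fun v hv => ?_
      rw [map_smul, ih v (hT u v (Finsupp.mem_support_iff.1 hv)), Finsupp.smul_single, smul_eq_mul,
        mul_one]
    rw [hrow, map_add, this]
    simp
  · refine Finsupp.lhom_ext' fun u => LinearMap.ext_ring ?_
    simp only [LinearMap.comp_apply, Finsupp.lsingle_apply, Module.End.mul_apply,
      LinearMap.sub_apply, map_sub, Finsupp.linearCombination_single, one_smul,
      Module.End.one_apply]
    rw [hrow]
    simp
  · intro u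
    induction u using hr.induction with
    | _ u ih =>
    intro v h
    rw [Finsupp.linearCombination_single, one_smul, hrow, Finsupp.add_apply] at h
    by_cases huv : u = v
    · exact huv ▸ .refl
    rw [Finsupp.single_eq_of_ne (Ne.symm huv), zero_add, Finsupp.linearCombination_apply,
      Finsupp.sum, Finsupp.finsetSum_apply] at h
    obtain ⟨w, hw, h⟩ := Finset.exists_ne_zero_of_sum_ne_zero h
    have hw' := Finsupp.mem_support_iff.1 hw
    refine .head hw' (ih w (hT u w hw') v fun h' => h ?_)
    rw [Finsupp.linearCombination_single, one_smul] at h'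
    rw [Finsupp.smul_apply, h', smul_zero]

/-- The endomorphism of the free module on `V` with matrix `T`. -/
noncomputable def rowOp (T : V → V → S) (hT : ∀ u, (Function.support (T u)).Finite) :
    Module.End S (V →₀ S) :=
  Finsupp.linearCombination S fun u => Finsupp.ofSupportFinite (T u) (hT u)

@[simp] lemma rowOp_single (T : V → V → S) (hT : ∀ u, (Function.support (T u)).Finite) (u v : V) :
    rowOp T hT (.single u 1) v = T u v := by
  rw [rowOp, Finsupp.linearCombination_single, one_smul]
  rfl

lemma apply_eq_sum (T : Module.End S (V →₀ S)) (z : V →₀ S) (v : V) :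
    T z v = z.sum fun u s => s * T (.single u 1) v := by
  conv_lhs => rw [← Finsupp.sum_single z, Finsupp.sum, map_sum, Finsupp.finsetSum_apply]
  refine Finset.sum_congr rfl fun u _ => ?_
  rw [← mul_one (z u), ← smul_eq_mul, ← Finsupp.smul_single, map_smul]
  simp

lemma exists_of_apply_ne_zero {T : Module.End S (V →₀ S)} {z : V →₀ S} {v : V} (h : T z v ≠ 0) :
    ∃ u, z u ≠ 0 ∧ T (.single u 1) v ≠ 0 := by
  rw [apply_eq_sum] at h
  obtain ⟨u, hu, h⟩ := Finset.exists_ne_zero_of_sum_ne_zero h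
  exact ⟨u, Finsupp.mem_support_iff.1 hu, right_ne_zero_of_mul h⟩

lemma end_ext {T T' : Module.End S (V →₀ S)} (h : ∀ u, T (.single u 1) = T' (.single u 1)) :
    T = T' :=
  Finsupp.lhom_ext' fun u => LinearMap.ext_ring (h u)

end Resolvent

section Paths

variable {S : Type u} [Ring S] {C : ChainComplex (ModuleCat.{u} S) ℕ} {ι : ℕ → Type}
  {β : ∀ k, Module.Basis (ι k) S (C.X k)} {M : (Σ k, ι k) → (Σ k, ι k) → Prop}

lemma edgeWeight_ne_zero {u v : Σ k, ι k} (h : edgeWeight β u v ≠ 0) : u.1 = v.1 + 1 := by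
  by_contra h'
  refine h ?_
  rw [edgeWeight, C.shape _ _ (fun h => h' h.symm)]
  simp

/-- A path is trivial, or a step followed by a path. -/
def ZigZag.unfold (u z : Σ k, ι k) :
    ZigZag β M u z ≃ PLift (u = z) ⊕ Σ v : {v // MorseStep β M u v}, ZigZag β M v.1 z where
  toFun
    | .nil _ => .inl ⟨rfl⟩
    | .cons h p => .inr ⟨⟨_, h⟩, p⟩
  invFun
    | .inl ⟨h⟩ => h ▸ .nil u
    | .inr ⟨⟨_, h⟩, p⟩ => .cons h p
  left_inv p := by cases p <;> rfl
  right_inv p := by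
    rcases p with ⟨⟨rfl⟩⟩ | ⟨⟨v, h⟩, p⟩ <;> rfl

/-- The concatenation of two paths. -/
def ZigZag.append {u v w : Σ k, ι k} : ZigZag β M u v → ZigZag β M v w → ZigZag β M u w
  | .nil _, q => q
  | .cons h p, q => .cons h (p.append q)

lemma ZigZag.weight_append {u v w : Σ k, ι k} (p : ZigZag β M u v) (q : ZigZag β M v w) :
    (p.append q).weight = p.weight * q.weight := by
  induction p with
  | nil => simp [ZigZag.append, ZigZag.weight]
  | cons h p ih => rw [ZigZag.append, ZigZag.weight, ZigZag.weight, ih, mul_assoc]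

/-- A path is trivial, or a path followed by a step. -/
lemma ZigZag.eq_nil_or_snoc {u w : Σ k, ι k} (p : ZigZag β M u w) :
    (∃ h : u = w, p = h ▸ .nil u) ∨
      ∃ (v : Σ k, ι k) (q : ZigZag β M u v) (h : MorseStep β M v w),
        p = q.append (.cons h (.nil w)) := by
  induction p with
  | nil u => exact .inl ⟨rfl, rfl⟩
  | @cons u v w h p ih =>
    rcases ih with ⟨rfl, rfl⟩ | ⟨v', q, h', rfl⟩
    · exact .inr ⟨u, .nil u, h, rfl⟩
    · exact .inr ⟨v', .cons h q, h', rfl⟩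

lemma ZigZag.reflTransGen {u v : Σ k, ι k} (p : ZigZag β M u v) :
    Relation.ReflTransGen (MorseStep β M) u v := by
  induction p with
  | nil => exact .refl
  | cons h _ ih => exact .head h ih

variable [∀ k, Finite (ι k)]

/-- A set of vertices of bounded degree is finite, as there are finitely many vertices in each
degree. -/
lemma finite_of_degree_le {s : Set (Σ k, ι k)} (m : ℕ) (hs : ∀ v ∈ s, v.1 ≤ m) : s.Finite := by
  refine (Set.finite_range fun x : Σ k : Fin (m + 1), ι k =>
    (⟨x.1, x.2⟩ : Σ k, ι k)).subset fun v hv => ?_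
  exact ⟨⟨⟨v.1, Nat.lt_succ_of_le (hs v hv)⟩, v.2⟩, rfl⟩

lemma finite_morseStep (hM : ∀ u v, M u v → edgeWeight β u v ≠ 0) (u : Σ k, ι k) :
    {v | MorseStep β M u v}.Finite := by
  refine finite_of_degree_le (u.1 + 1) ?_
  rintro v (⟨h, -⟩ | h)
  · have := edgeWeight_ne_zero h; omega
  · exact (edgeWeight_ne_zero (hM _ _ h)).le

lemma finite_zigZag (hM : ∀ u v, M u v → edgeWeight β u v ≠ 0)
    (hwf : WellFounded fun v u => MorseStep β M u v) (u z : Σ k, ι k) :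
    Finite (ZigZag β M u z) := by
  induction u using hwf.induction with
  | _ u ih =>
  have : ∀ v : {v // MorseStep β M u v}, Finite (ZigZag β M v.1 z) := fun v => ih v.1 v.2
  have : Finite {v // MorseStep β M u v} := (finite_morseStep hM u).to_subtype
  exact Finite.of_equiv _ (ZigZag.unfold u z).symm

open Classical in
/-- The recursion for path sums by the first step of a path. -/
lemma pathSum_eq (hM : ∀ u v, M u v → edgeWeight β u v ≠ 0)
    (hwf : WellFounded fun v u => MorseStep β M u v) (u z : Σ k, ι k) :
    pathSum β M u z = (if u = z then 1 else 0) +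
      ∑ v ∈ (finite_morseStep hM u).toFinset, stepWeight β M u v * pathSum β M v z := by
  have hfin : ∀ u, Finite (ZigZag β M u z) := fun u => finite_zigZag hM hwf u z
  have : ∀ u, Fintype (ZigZag β M u z) := fun u => Fintype.ofFinite _
  have : Finite {v // MorseStep β M u v} := (finite_morseStep hM u).to_subtype
  have : Fintype {v // MorseStep β M u v} := Fintype.ofFinite _
  have : Fintype (PLift (u = z)) := Fintype.ofFinite _
  have hps : ∀ u, pathSum β M u z = ∑ p : ZigZag β M u z, p.weight := fun u =>
    finsum_eq_sum_of_fintype _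
  have h1 : ∀ f : (Σ k, ι k) → S, ∑ v ∈ (finite_morseStep hM u).toFinset, f v =
      ∑ v : {v // MorseStep β M u v}, f v := fun f => by
    refine Finset.sum_subtype _ (fun v => ?_) _
    rw [Set.Finite.mem_toFinset]; rfl
  rw [h1, hps, ← (ZigZag.unfold u z).symm.sum_comp, Fintype.sum_sum_type, Fintype.sum_sigma]
  congr 1
  · split_ifs with h
    · subst h
      have : Unique (PLift (u = u)) := ⟨⟨⟨rfl⟩⟩, fun _ => rfl⟩
      rw [Fintype.sum_unique]
      rfl
    · have : IsEmpty (PLift (u = z)) := ⟨fun x => h x.down⟩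
      rw [Fintype.sum_empty]
  · refine Finset.sum_congr rfl fun v _ => ?_
    rw [hps, Finset.mul_sum]
    rfl

end Paths
end AlgMorse

/-! ### The operators of a matching -/

namespace AlgMorse

section Operators

variable {S : Type u} [Ring S] {C : ChainComplex (ModuleCat.{u} S) ℕ} {ι : ℕ → Type}
  (β : ∀ k, Module.Basis (ι k) S (C.X k)) (M : (Σ k, ι k) → (Σ k, ι k) → Prop)
  [∀ k, Finite (ι k)]

open Classical in
/-- The part of the differential given by the edges outside `M`, as an endomorphism of the free
module on all vertices. -/
noncomputable def downOp : Module.End S ((Σ k, ι k) →₀ S) :=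
  rowOp (fun u v => if M u v then 0 else edgeWeight β u v) fun u =>
    finite_of_degree_le u.1 fun v hv => by
      have := edgeWeight_ne_zero (β := β) (u := u) (v := v) fun h => hv (by simp [h])
      omega

open Classical in
/-- The part of the differential given by the edges in `M`. -/
noncomputable def matchedOp : Module.End S ((Σ k, ι k) →₀ S) :=
  rowOp (fun u v => if M u v then edgeWeight β u v else 0) fun u =>
    finite_of_degree_le u.1 fun v hv => by
      have := edgeWeight_ne_zero (β := β) (u := u) (v := v) fun h => hv (by simp [h])
      omega

open Classical in
/-- The endomorphism given by the reversed edges. The weights in `M` are units for a Morse matching;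
otherwise `Ring.inverse` has the value `0`. -/
noncomputable def upOp : Module.End S ((Σ k, ι k) →₀ S) :=
  rowOp (fun v u => if M u v then -Ring.inverse (edgeWeight β u v) else 0) fun v =>
    finite_of_degree_le (v.1 + 1) fun u hu => by
      have := edgeWeight_ne_zero (β := β) (u := u) (v := v) fun h => hu (by simp [h])
      omega

/-- The projection onto the span of the critical vertices, for a Morse matching `M`. -/
noncomputable def critOp : Module.End S ((Σ k, ι k) →₀ S) :=
  1 + upOp β M * matchedOp β M + matchedOp β M * upOp β M

variable {β M}

lemma downOp_ne_zero {u v : Σ k, ι k} (h : downOp β M (.single u 1) v ≠ 0) :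
    MorseStep β M u v ∧ u.1 = v.1 + 1 := by
  rw [downOp, rowOp_single] at h
  split_ifs at h with h'
  · exact absurd rfl h
  · exact ⟨.inl ⟨h, h'⟩, edgeWeight_ne_zero h⟩

lemma upOp_ne_zero {u v : Σ k, ι k} (h : upOp β M (.single u 1) v ≠ 0) :
    M v u ∧ v.1 = u.1 + 1 := by
  rw [upOp, rowOp_single] at h
  split_ifs at h with h'
  · refine ⟨h', edgeWeight_ne_zero (β := β) fun h0 => h ?_⟩
    rw [h0, Ring.inverse_zero, neg_zero]
  · exact absurd rfl h

lemma down_add_matched_single (u v : Σ k, ι k) :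
    (downOp β M + matchedOp β M) (.single u 1) v = edgeWeight β u v := by
  rw [LinearMap.add_apply, Finsupp.add_apply, downOp, matchedOp, rowOp_single, rowOp_single]
  split_ifs <;> simp

section Matching

variable (hM : IsMorseMatching β M)
include hM

lemma upOp_single {u v : Σ k, ι k} (h : M u v) :
    upOp β M (.single v 1) = .single u (-Ring.inverse (edgeWeight β u v)) := by
  ext w
  rw [upOp, rowOp_single]
  split_ifs with hw
  · obtain ⟨rfl, -⟩ := hM.matching _ _ _ _ h hw (by simp)
    rw [Finsupp.single_eq_same]
  · rw [Finsupp.single_eq_of_ne]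
    rintro rfl
    exact hw h

omit hM in
lemma upOp_eq_zero {v : Σ k, ι k} (h : ∀ u, ¬ M u v) : upOp β M (.single v 1) = 0 := by
  ext w
  rw [upOp, rowOp_single, if_neg (h w), Finsupp.zero_apply]

lemma matchedOp_single {u v : Σ k, ι k} (h : M u v) :
    matchedOp β M (.single u 1) = .single v (edgeWeight β u v) := by
  ext w
  rw [matchedOp, rowOp_single]
  split_ifs with hw
  · obtain ⟨-, rfl⟩ := hM.matching _ _ _ _ h hw (by simp)
    rw [Finsupp.single_eq_same]
  · rw [Finsupp.single_eq_of_ne]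
    rintro rfl
    exact hw h

omit hM in
lemma matchedOp_eq_zero {u : Σ k, ι k} (h : ∀ v, ¬ M u v) : matchedOp β M (.single u 1) = 0 := by
  ext w
  rw [matchedOp, rowOp_single, if_neg (h w), Finsupp.zero_apply]

omit [∀ k, Finite (ι k)] in
lemma IsMorseMatching.not_up_down {u v w : Σ k, ι k} (h : M u v) : ¬ M v w := fun h' => by
  obtain ⟨rfl, rfl⟩ := hM.matching _ _ _ _ h h' (by simp)
  have := edgeWeight_ne_zero (hM.edge _ _ h).1
  omega

omit hM in
lemma single_eq_smul {V : Type*} (v : V) (s : S) :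
    (Finsupp.single v s : V →₀ S) = s • Finsupp.single v 1 := by
  rw [Finsupp.smul_single, smul_eq_mul, mul_one]

lemma upOp_mul_upOp : upOp β M * upOp β M = 0 := end_ext fun v => by
  rw [Module.End.mul_apply, LinearMap.zero_apply]
  by_cases h : ∃ u, M u v
  · obtain ⟨u, h⟩ := h
    rw [upOp_single hM h, single_eq_smul, map_smul,
      upOp_eq_zero fun w hw => hM.not_up_down hw h, smul_zero]
  · rw [upOp_eq_zero (not_exists.1 h), map_zero]

lemma matchedOp_mul_matchedOp : matchedOp β M * matchedOp β M = 0 := end_ext fun u => by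
  rw [Module.End.mul_apply, LinearMap.zero_apply]
  by_cases h : ∃ v, M u v
  · obtain ⟨v, h⟩ := h
    rw [matchedOp_single hM h, single_eq_smul, map_smul,
      matchedOp_eq_zero fun w hw => hM.not_up_down h hw, smul_zero]
  · rw [matchedOp_eq_zero (not_exists.1 h), map_zero]

lemma matchedOp_upOp_single {u v : Σ k, ι k} (h : M u v) :
    matchedOp β M (upOp β M (.single v 1)) = -.single v 1 := by
  rw [upOp_single hM h, single_eq_smul, map_smul, matchedOp_single hM h, Finsupp.smul_single,
    smul_eq_mul, neg_mul, Ring.inverse_mul_cancel _ (hM.edge _ _ h).2, Finsupp.single_neg]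

lemma upOp_matchedOp_single {u v : Σ k, ι k} (h : M u v) :
    upOp β M (matchedOp β M (.single u 1)) = -.single u 1 := by
  rw [matchedOp_single hM h, single_eq_smul, map_smul, upOp_single hM h, Finsupp.smul_single,
    smul_eq_mul, mul_neg, Ring.mul_inverse_cancel _ (hM.edge _ _ h).2, Finsupp.single_neg]

lemma upOp_mul_matchedOp_mul_upOp : upOp β M * matchedOp β M * upOp β M = -upOp β M :=
  end_ext fun v => by
    rw [Module.End.mul_apply, Module.End.mul_apply, LinearMap.neg_apply]
    by_cases h : ∃ u, M u v
    · obtain ⟨u, h⟩ := h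
      rw [matchedOp_upOp_single hM h, map_neg]
    · rw [upOp_eq_zero (not_exists.1 h)]; simp

lemma matchedOp_mul_upOp_mul_matchedOp :
    matchedOp β M * upOp β M * matchedOp β M = -matchedOp β M :=
  end_ext fun v => by
    rw [Module.End.mul_apply, Module.End.mul_apply, LinearMap.neg_apply]
    by_cases h : ∃ u, M v u
    · obtain ⟨u, h⟩ := h
      rw [upOp_matchedOp_single hM h, map_neg]
    · rw [matchedOp_eq_zero (not_exists.1 h)]; simp

omit hM in
lemma critOp_single_of_isCritical {u : Σ k, ι k} (h : IsCritical M u) :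
    critOp β M (.single u 1) = .single u 1 := by
  simp [critOp, upOp_eq_zero fun w => (h w).2, matchedOp_eq_zero fun w => (h w).1]

lemma critOp_single_of_not_isCritical {u : Σ k, ι k} (h : ¬ IsCritical M u) :
    critOp β M (.single u 1) = 0 := by
  rw [IsCritical] at h
  push Not at h
  obtain ⟨v, h⟩ := h
  simp only [critOp, LinearMap.add_apply, Module.End.mul_apply, Module.End.one_apply]
  by_cases h1 : M u v
  · rw [upOp_matchedOp_single hM h1, upOp_eq_zero fun w hw => hM.not_up_down hw h1]
    simp
  · rw [matchedOp_upOp_single hM (h h1), matchedOp_eq_zero fun w => hM.not_up_down (h h1)]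
    simp

open Classical in
lemma critOp_apply (z : (Σ k, ι k) →₀ S) (v : Σ k, ι k) :
    critOp β M z v = if IsCritical M v then z v else 0 := by
  induction z using Finsupp.induction_linear with
  | zero => simp
  | add z w hz hw => rw [map_add, Finsupp.add_apply, hz, hw]; split_ifs <;> simp
  | single u s =>
    rw [single_eq_smul, map_smul]
    by_cases h : IsCritical M u
    · rw [critOp_single_of_isCritical h]
      split_ifs with hv
      · rfl
      · rw [Finsupp.smul_apply, Finsupp.single_eq_of_ne, smul_zero]
        rintro rfl
        exact hv h
    · rw [critOp_single_of_not_isCritical hM h, smul_zero]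
      split_ifs with hv
      · rw [Finsupp.smul_apply, Finsupp.single_eq_of_ne, smul_zero, Finsupp.zero_apply]
        rintro rfl
        exact h hv
      · rfl

end Matching

section Embedding

variable (β M)

/-- The embedding of `C` in degree `k` into the free module on all vertices. -/
noncomputable def incl (k : ℕ) : C.X k →ₗ[S] ((Σ k, ι k) →₀ S) :=
  Finsupp.lmapDomain S S (Sigma.mk k) ∘ₗ (β k).repr.toLinearMap

/-- The embedding of the Morse complex in degree `k` into the free module on all vertices. -/
noncomputable def critIncl (k : ℕ) : morseX M S k →ₗ[S] ((Σ k, ι k) →₀ S) :=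
  Finsupp.lmapDomain S S fun c : Crit M k => (⟨k, c.1⟩ : Σ k, ι k)

variable {β M}

omit [∀ k, Finite (ι k)] in
lemma incl_injective (k : ℕ) : Function.Injective (incl β k) :=
  (Finsupp.mapDomain_injective sigma_mk_injective).comp (β k).repr.injective

omit [∀ k, Finite (ι k)] in
lemma critIncl_injective (k : ℕ) : Function.Injective (critIncl (S := S) M k) :=
  Finsupp.mapDomain_injective fun _ _ h => Subtype.ext (sigma_mk_injective h)

omit [∀ k, Finite (ι k)] in
lemma incl_basis (k : ℕ) (x : ι k) : incl β k (β k x) = .single ⟨k, x⟩ 1 := by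
  simp [incl]

omit [∀ k, Finite (ι k)] in
lemma incl_apply (k : ℕ) (z : C.X k) (x : ι k) : incl β k z ⟨k, x⟩ = (β k).repr z x :=
  Finsupp.mapDomain_apply sigma_mk_injective _ _

omit [∀ k, Finite (ι k)] in
lemma incl_apply_of_ne {k : ℕ} (z : C.X k) {v : Σ k, ι k} (h : v.1 ≠ k) : incl β k z v = 0 :=
  Finsupp.mapDomain_of_notMem_range _ _ (by rintro ⟨x, rfl⟩; exact h rfl)

omit [∀ k, Finite (ι k)] in
lemma critIncl_single (k : ℕ) (c : Crit M k) :
    critIncl (S := S) M k (.single c 1) = .single ⟨k, c.1⟩ 1 := by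
  simp [critIncl]

omit [∀ k, Finite (ι k)] in
lemma critIncl_apply (k : ℕ) (z : morseX M S k) (c : Crit M k) :
    critIncl M k z ⟨k, c.1⟩ = z c :=
  Finsupp.mapDomain_apply (f := fun c : Crit M k => (⟨k, c.1⟩ : Σ k, ι k))
    (fun _ _ h => Subtype.ext (sigma_mk_injective h)) _ _

omit [∀ k, Finite (ι k)] in
lemma critIncl_apply_of_ne {k : ℕ} (z : morseX M S k) {v : Σ k, ι k}
    (h : v.1 ≠ k ∨ ¬ IsCritical M v) : critIncl M k z v = 0 :=
  Finsupp.mapDomain_of_notMem_range _ _ (by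
    rintro ⟨c, rfl⟩; exact h.elim (fun h => h rfl) (fun h => h c.2))

/-- On the image of `C`, the endomorphism `D + E` is the differential. -/
lemma diff_incl (k : ℕ) (z : C.X (k + 1)) :
    (downOp β M + matchedOp β M) (incl β (k + 1) z) = incl β k (C.d (k + 1) k z) := by
  suffices (downOp β M + matchedOp β M) ∘ₗ incl β (k + 1) = incl β k ∘ₗ (C.d (k + 1) k).hom from
    LinearMap.congr_fun this z
  refine (β (k + 1)).ext fun x => ?_
  rw [LinearMap.comp_apply, LinearMap.comp_apply, incl_basis]
  ext v
  rw [down_add_matched_single]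
  by_cases h : v.1 = k
  · obtain ⟨k, v⟩ := v
    obtain rfl : k = _ := h
    rw [incl_apply]
    rfl
  · rw [incl_apply_of_ne _ h]
    by_contra h'
    exact h (Nat.succ.inj (edgeWeight_ne_zero h')).symm

lemma diff_incl_zero (z : C.X 0) : (downOp β M + matchedOp β M) (incl β 0 z) = 0 := by
  suffices (downOp β M + matchedOp β M) ∘ₗ incl β 0 = 0 from LinearMap.congr_fun this z
  refine (β 0).ext fun x => ?_
  rw [LinearMap.comp_apply, incl_basis]
  ext v
  rw [down_add_matched_single]
  by_contra h'
  have := edgeWeight_ne_zero h'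
  simp at this

lemma diff_mul_diff :
    (downOp β M + matchedOp β M) * (downOp β M + matchedOp β M) = 0 := end_ext fun u => by
  obtain ⟨k, x⟩ := u
  rw [Module.End.mul_apply, ← incl_basis, LinearMap.zero_apply]
  rcases k with _ | _ | k
  · rw [diff_incl_zero, map_zero]
  · rw [diff_incl, diff_incl_zero]
  · rw [diff_incl, diff_incl]
    have : C.d (k + 1) k (C.d (k + 2) (k + 1) (β (k + 2) x)) = 0 := by
      rw [← ModuleCat.comp_apply, C.d_comp_d]; rfl
    rw [this, map_zero]

end Embedding

end Operators
end AlgMorse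

/-! ### Path sums and degrees -/

namespace AlgMorse

section PathSums

variable {S : Type u} [Ring S] {C : ChainComplex (ModuleCat.{u} S) ℕ} {ι : ℕ → Type}
  {β : ∀ k, Module.Basis (ι k) S (C.X k)} {M : (Σ k, ι k) → (Σ k, ι k) → Prop}

open Classical in
/-- Two consecutive steps of a path never both go up, so a path goes up by at most one degree in
total, and only if it starts at the lower end of an edge of the matching. -/
lemma degree_add_low_le (hM : IsMorseMatching β M) {u v : Σ k, ι k}
    (h : Relation.ReflTransGen (MorseStep β M) u v) :
    v.1 + (if ∃ w, M w v then 1 else 0) ≤ u.1 + (if ∃ w, M w u then 1 else 0) := by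
  induction h using Relation.ReflTransGen.head_induction_on with
  | refl => exact le_rfl
  | @head u u' h _ ih =>
    refine ih.trans ?_
    rcases h with ⟨h, -⟩ | h
    · have := edgeWeight_ne_zero h
      split_ifs <;> omega
    · have := edgeWeight_ne_zero (hM.edge _ _ h).1
      rw [if_neg (not_exists.2 fun w hw => hM.not_up_down hw h), if_pos ⟨u', h⟩]
      omega

open Classical in
/-- The counterpart of `degree_add_low_le` at the other end: a path goes up in total only if it ends
at the upper end of an edge of the matching. -/
lemma degree_add_up_le (hM : IsMorseMatching β M) {u v : Σ k, ι k}
    (h : Relation.ReflTransGen (MorseStep β M) u v) :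
    v.1 + (if ∃ w, M u w then 1 else 0) ≤ u.1 + (if ∃ w, M v w then 1 else 0) := by
  induction h using Relation.ReflTransGen.head_induction_on with
  | refl => exact le_rfl
  | @head u u' h _ ih =>
    rcases h with ⟨h, -⟩ | h
    · have := edgeWeight_ne_zero h
      split_ifs at ih ⊢ <;> omega
    · have := edgeWeight_ne_zero (hM.edge _ _ h).1
      rw [if_pos ⟨u, h⟩] at ih
      rw [if_neg (not_exists.2 fun w hw => hM.not_up_down h hw)]
      omega

lemma IsCritical.degree_le_of_path_to (hM : IsMorseMatching β M) {u c : Σ k, ι k}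
    (hc : IsCritical M c) (h : Relation.ReflTransGen (MorseStep β M) u c) : c.1 ≤ u.1 := by
  have := degree_add_up_le hM h
  rw [if_neg (c := ∃ w, M c w) (not_exists.2 fun w => (hc w).1)] at this
  omega

lemma IsCritical.degree_le_of_path_from (hM : IsMorseMatching β M) {c v : Σ k, ι k}
    (hc : IsCritical M c) (h : Relation.ReflTransGen (MorseStep β M) c v) : v.1 ≤ c.1 := by
  have := degree_add_low_le hM h
  rw [if_neg (c := ∃ w, M w c) (not_exists.2 fun w => (hc w).2)] at this
  omega

variable [∀ k, Finite (ι k)]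

lemma down_add_up_ne_zero {u v : Σ k, ι k}
    (h : (downOp β M + upOp β M) (.single u 1) v ≠ 0) : MorseStep β M u v := by
  rw [LinearMap.add_apply, Finsupp.add_apply] at h
  by_cases h' : upOp β M (.single u 1) v = 0
  · rw [h', add_zero] at h
    exact (downOp_ne_zero h).1
  · exact .inr (upOp_ne_zero h').1

lemma down_add_up_single (hM : IsMorseMatching β M) {u v : Σ k, ι k} (h : MorseStep β M u v) :
    (downOp β M + upOp β M) (.single u 1) v = stepWeight β M u v := by
  rw [LinearMap.add_apply, Finsupp.add_apply, downOp, upOp, rowOp_single, rowOp_single, stepWeight]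
  rcases h with ⟨h, h'⟩ | h
  · have : ¬ M v u := fun hvu => by
      have h1 := edgeWeight_ne_zero (hM.edge _ _ hvu).1
      have h2 := edgeWeight_ne_zero h
      omega
    rw [if_neg h', if_neg this, if_neg this, add_zero]
  · have h0 : edgeWeight β u v = 0 := by
      by_contra h2
      have h1 := edgeWeight_ne_zero (hM.edge _ _ h).1
      have h2 := edgeWeight_ne_zero h2
      omega
    rw [if_pos h, if_pos h, h0, ite_self, zero_add]

/-- The matrix of path sums is the inverse of `1 - D - U`, where `D` is given by the edges outside
the matching and `U` by the reversed edges. -/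
lemma pathSum_eq_resolvent (hM : IsMorseMatching β M)
    (hwf : WellFounded fun v u => MorseStep β M u v) {P : Module.End S ((Σ k, ι k) →₀ S)}
    (hP : P * (1 - (downOp β M + upOp β M)) = 1) (u z : Σ k, ι k) :
    P (.single u 1) z = pathSum β M u z := by
  classical
  induction u using hwf.induction with
  | _ u ih =>
  have h1 : P (.single u 1) = .single u 1 + P ((downOp β M + upOp β M) (.single u 1)) := by
    have := LinearMap.congr_fun hP (.single u 1)
    rw [Module.End.mul_apply, LinearMap.sub_apply, map_sub, Module.End.one_apply] at this
    exact sub_eq_iff_eq_add.1 this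
  rw [h1, pathSum_eq (fun u v h => (hM.edge u v h).1) hwf, Finsupp.add_apply,
    Finsupp.single_apply, apply_eq_sum P, Finsupp.sum]
  congr 1
  refine Finset.sum_subset_zero_on_sdiff (fun v hv => ?_) (fun v hv => ?_) (fun v hv => ?_)
  · rw [Set.Finite.mem_toFinset]
    exact down_add_up_ne_zero (Finsupp.mem_support_iff.1 hv)
  · rw [Finset.mem_sdiff, Set.Finite.mem_toFinset, Finsupp.mem_support_iff, not_not] at hv
    rw [← down_add_up_single hM hv.1, hv.2, zero_mul]
  · have hv' := down_add_up_ne_zero (Finsupp.mem_support_iff.1 hv)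
    rw [ih v hv', down_add_up_single hM hv']

/-- The path sums that enter into the Morse complex, and the maps to and from it, in terms of the
paths that go down and up alternately. -/
lemma exists_zigzag_operators (hM : IsMorseMatching β M)
    (hwf : WellFounded fun v u => MorseStep β M u v) :
    ∃ X Y : Module.End S ((Σ k, ι k) →₀ S),
      (1 - downOp β M * upOp β M) * X = 1 ∧ X * (1 - downOp β M * upOp β M) = 1 ∧
      (1 - upOp β M * downOp β M) * Y = 1 ∧ Y * (1 - upOp β M * downOp β M) = 1 ∧
      (∀ u v, X (.single u 1) v ≠ 0 → u.1 = v.1) ∧ (∀ u v, Y (.single u 1) v ≠ 0 → u.1 = v.1) ∧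
      (∀ u c, IsCritical M c → u.1 = c.1 → pathSum β M u c = X (.single u 1) c) ∧
      (∀ c v, IsCritical M c → c.1 = v.1 → pathSum β M c v = Y (.single c 1) v) ∧
      ∀ c c', IsCritical M c → IsCritical M c' → c.1 = c'.1 + 1 →
        pathSum β M c c' = X (downOp β M (.single c 1)) c' := by
  have hDU : ∀ u v, (downOp β M * upOp β M) (.single u 1) v ≠ 0 →
      Relation.TransGen (fun v u => MorseStep β M u v) v u ∧ u.1 = v.1 := fun u v h => by
    rw [Module.End.mul_apply] at h
    obtain ⟨w, h1, h2⟩ := exists_of_apply_ne_zero h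
    have h1 := upOp_ne_zero h1
    have h2 := downOp_ne_zero h2
    exact ⟨.head h2.1 (.single (.inr h1.1)), by omega⟩
  have hUD : ∀ u v, (upOp β M * downOp β M) (.single u 1) v ≠ 0 →
      Relation.TransGen (fun v u => MorseStep β M u v) v u ∧ u.1 = v.1 := fun u v h => by
    rw [Module.End.mul_apply] at h
    obtain ⟨w, h1, h2⟩ := exists_of_apply_ne_zero h
    have h1 := downOp_ne_zero h1
    have h2 := upOp_ne_zero h2
    exact ⟨.head (.inr h2.1) (.single h1.1), by omega⟩
  have hdeg : ∀ {T : Module.End S ((Σ k, ι k) →₀ S)} {u v},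
      (∀ u v, T (.single u 1) v ≠ 0 → u.1 = v.1) →
      Relation.ReflTransGen (fun u v => T (.single u 1) v ≠ 0) u v → u.1 = v.1 := by
    intro T u v hT h
    induction h with
    | refl => rfl
    | tail _ h ih => exact ih.trans (hT _ _ h)
  obtain ⟨X, hX, hX', hXr⟩ := exists_resolvent (downOp β M * upOp β M) hwf.transGen
    fun u v h => (hDU u v h).1
  obtain ⟨Y, hY, hY', hYr⟩ := exists_resolvent (upOp β M * downOp β M) hwf.transGen
    fun u v h => (hUD u v h).1
  obtain ⟨P, hP, hP', hPr⟩ := exists_resolvent (downOp β M + upOp β M) hwf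
    fun u v => down_add_up_ne_zero
  have hXd := fun u v h => hdeg (fun u v h => (hDU u v h).2) (hXr u v h)
  have hYd := fun u v h => hdeg (fun u v h => (hUD u v h).2) (hYr u v h)
  have hPath : ∀ {u v}, P (.single u 1) v ≠ 0 → Relation.ReflTransGen (MorseStep β M) u v :=
    fun {u v} h => Relation.ReflTransGen.mono (fun u v => down_add_up_ne_zero) _ _ (hPr u v h)
  have hPs := pathSum_eq_resolvent hM hwf hP'
  have hU := upOp_mul_upOp hM
  have hUEU := upOp_mul_matchedOp_mul_upOp hM
  have key1 := crit_mul_paths (A := Module.End S ((Σ k, ι k) →₀ S)) hU hUEU hX hP'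
  have key2 := paths_mul_crit (A := Module.End S ((Σ k, ι k) →₀ S)) hU hUEU hY' hP
  rw [← critOp] at key1 key2
  have hto : ∀ z : (Σ k, ι k) →₀ S, ∀ c, IsCritical M c →
      P z c = X z c + P (downOp β M (X z)) c := by
    intro z c hc
    have := DFunLike.congr_fun (LinearMap.congr_fun key1 z) c
    simpa only [Module.End.mul_apply, LinearMap.add_apply, Finsupp.add_apply, critOp_apply hM,
      if_pos hc] using this
  have hX1 : ∀ u c, IsCritical M c → u.1 = c.1 → pathSum β M u c = X (.single u 1) c := by
    intro u c hc huc
    rw [← hPs, hto _ _ hc, add_eq_left]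
    -- the other paths go down by one degree and would have to climb back to a critical vertex
    by_contra h
    obtain ⟨w, h1, h2⟩ := exists_of_apply_ne_zero h
    obtain ⟨w', h3, h4⟩ := exists_of_apply_ne_zero h1
    have := hc.degree_le_of_path_to hM (hPath h2)
    have := (downOp_ne_zero h4).2
    have := hXd _ _ h3
    omega
  refine ⟨X, Y, hX, hX', hY, hY', hXd, hYd, hX1, fun c v hc hcv => ?_, fun c c' hc hc' hcc' => ?_⟩
  · have := DFunLike.congr_fun (LinearMap.congr_fun key2 (.single c 1)) v
    simp only [Module.End.mul_apply, LinearMap.add_apply, Finsupp.add_apply,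
      critOp_single_of_isCritical hc] at this
    rw [← hPs, this, add_eq_left]
    by_contra h
    obtain ⟨w, h1, h2⟩ := exists_of_apply_ne_zero h
    obtain ⟨w', h3, h4⟩ := exists_of_apply_ne_zero h1
    have := hc.degree_le_of_path_from hM (hPath h3)
    have := (downOp_ne_zero h4).2
    have := hYd _ _ h2
    omega
  · have h1 : P (.single c 1) = .single c 1 + P (downOp β M (.single c 1)) := by
      have := LinearMap.congr_fun hP' (.single c 1)
      simp only [Module.End.mul_apply, LinearMap.sub_apply, map_sub, Module.End.one_apply,
        LinearMap.add_apply, upOp_eq_zero fun w => (hc w).2, add_zero] at this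
      exact sub_eq_iff_eq_add.1 this
    rw [← hPs, h1, Finsupp.add_apply, Finsupp.single_eq_of_ne (by rintro rfl; omega), zero_add,
      apply_eq_sum P, apply_eq_sum X, Finsupp.sum, Finsupp.sum]
    refine Finset.sum_congr rfl fun v hv => ?_
    have := (downOp_ne_zero (Finsupp.mem_support_iff.1 hv)).2
    rw [hPs, hX1 v c' hc' (by omega)]

lemma morseInv_basis (k : ℕ) (x : ι k) (c : Crit M k) :
    morseInv β M k (β k x) c = pathSum β M ⟨k, x⟩ ⟨k, c.1⟩ := by
  rw [morseInv, ModuleCat.ofHom_apply]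
  simp

lemma morseHom_single (k : ℕ) (c : Crit M k) (x : ι k) :
    (β k).repr (morseHom β M k (Finsupp.single c 1)) x = pathSum β M ⟨k, c.1⟩ ⟨k, x⟩ := by
  rw [morseHom, ModuleCat.ofHom_apply]
  simp

lemma morseD_single (k : ℕ) (c : Crit M (k + 1)) (c' : Crit M k) :
    morseD β M k (Finsupp.single c 1) c' = pathSum β M ⟨k + 1, c.1⟩ ⟨k, c'.1⟩ := by
  rw [morseD, ModuleCat.ofHom_apply]
  simp

end PathSums
end AlgMorse

/-! ### The homotopy equivalence with the Morse complex -/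

namespace AlgMorse

section Equivalence

variable {S : Type u} [Ring S] {C : ChainComplex (ModuleCat.{u} S) ℕ} {ι : ℕ → Type}
  {β : ∀ k, Module.Basis (ι k) S (C.X k)} {M : (Σ k, ι k) → (Σ k, ι k) → Prop}
  [∀ k, Finite (ι k)]

lemma critOp_critIncl {k : ℕ} (z : morseX M S k) :
    critOp β M (critIncl M k z) = critIncl M k z := by
  suffices critOp β M ∘ₗ critIncl M k = critIncl M k from LinearMap.congr_fun this z
  refine Finsupp.lhom_ext' fun c => LinearMap.ext_ring ?_
  rw [LinearMap.comp_apply, LinearMap.comp_apply, LinearMap.comp_apply, Finsupp.lsingle_apply,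
    critIncl_single, critOp_single_of_isCritical c.2]

/-- The maps to and from the Morse complex and its differential are restrictions of endomorphisms of
the free module on all vertices. -/
lemma exists_restrictions (hM : IsMorseMatching β M)
    (hwf : WellFounded fun v u => MorseStep β M u v) :
    ∃ X Y : Module.End S ((Σ k, ι k) →₀ S),
      (1 - downOp β M * upOp β M) * X = 1 ∧ X * (1 - downOp β M * upOp β M) = 1 ∧
      (1 - upOp β M * downOp β M) * Y = 1 ∧ Y * (1 - upOp β M * downOp β M) = 1 ∧
      (∀ u v, X (.single u 1) v ≠ 0 → u.1 = v.1) ∧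
      (∀ k (z : morseX M S k), incl β k (morseHom β M k z) = Y (critIncl M k z)) ∧
      (∀ k (z : C.X k), critIncl M k (morseInv β M k z) = (critOp β M * X) (incl β k z)) ∧
      ∀ k (z : morseX M S (k + 1)), critIncl M k (morseD β M k z) =
        (critOp β M * X * downOp β M * critOp β M) (critIncl M (k + 1) z) := by
  obtain ⟨X, Y, hX, hX', hY, hY', hXd, hYd, hPX, hPY, hPD⟩ := exists_zigzag_operators hM hwf
  refine ⟨X, Y, hX, hX', hY, hY', hXd, fun k z => ?_, fun k z => ?_, fun k z => ?_⟩
  · suffices incl β k ∘ₗ (morseHom β M k).hom = Y ∘ₗ critIncl M k from LinearMap.congr_fun this z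
    refine Finsupp.lhom_ext' fun c => LinearMap.ext_ring ?_
    rw [LinearMap.comp_apply, LinearMap.comp_apply, LinearMap.comp_apply, LinearMap.comp_apply,
      Finsupp.lsingle_apply, critIncl_single]
    ext v
    by_cases h : v.1 = k
    · obtain ⟨k, v⟩ := v
      obtain rfl : k = _ := h
      rw [incl_apply, ← hPY ⟨k, c.1⟩ ⟨k, v⟩ c.2 rfl]
      exact morseHom_single _ _ _
    · rw [incl_apply_of_ne _ h]
      by_contra h'
      exact h (hYd _ _ (Ne.symm h')).symm
  · suffices critIncl M k ∘ₗ (morseInv β M k).hom = (critOp β M * X) ∘ₗ incl β k from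
      LinearMap.congr_fun this z
    refine (β k).ext fun x => ?_
    rw [LinearMap.comp_apply, LinearMap.comp_apply, incl_basis]
    ext v
    rw [Module.End.mul_apply, critOp_apply hM]
    split_ifs with hv
    · by_cases h : v.1 = k
      · obtain ⟨k, v⟩ := v
        obtain rfl : k = _ := h
        rw [← hPX ⟨k, x⟩ ⟨k, v⟩ hv rfl]
        exact (critIncl_apply _ _ (⟨v, hv⟩ : Crit M k)).trans (morseInv_basis _ _ _)
      · rw [critIncl_apply_of_ne _ (.inl h)]
        by_contra h'
        exact h (hXd _ _ (Ne.symm h')).symm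
    · rw [critIncl_apply_of_ne _ (.inr hv)]
  · suffices critIncl M k ∘ₗ (morseD β M k).hom =
        (critOp β M * X * downOp β M * critOp β M) ∘ₗ critIncl M (k + 1) from
      LinearMap.congr_fun this z
    refine Finsupp.lhom_ext' fun c => LinearMap.ext_ring ?_
    rw [LinearMap.comp_apply, LinearMap.comp_apply, LinearMap.comp_apply, LinearMap.comp_apply,
      Finsupp.lsingle_apply, critIncl_single, Module.End.mul_apply,
      critOp_single_of_isCritical c.2, Module.End.mul_apply, Module.End.mul_apply]
    ext v
    rw [critOp_apply hM]
    split_ifs with hv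
    · by_cases h : v.1 = k
      · obtain ⟨k, v⟩ := v
        obtain rfl : k = _ := h
        rw [← hPD ⟨k + 1, c.1⟩ ⟨k, v⟩ c.2 hv rfl]
        exact (critIncl_apply _ _ (⟨v, hv⟩ : Crit M k)).trans (morseD_single _ _ _)
      · rw [critIncl_apply_of_ne _ (.inl h)]
        by_contra h'
        obtain ⟨w, h1, h2⟩ := exists_of_apply_ne_zero (Ne.symm h')
        have h3 := (downOp_ne_zero h1).2
        have h4 := hXd _ _ h2
        exact h (by simpa [← h4] using h3.symm)
    · rw [critIncl_apply_of_ne _ (.inr hv)]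

/-- The Morse complex of a based chain complex, and the homotopy equivalence given by the sums over
directed paths. -/
theorem exists_homotopyEquiv (hM : IsMorseMatching β M)
    (hwf : WellFounded fun v u => MorseStep β M u v) :
    ∃ hd : ∀ k, morseD β M (k + 1) ≫ morseD β M k = 0,
      ∃ E : HomotopyEquiv (ChainComplex.of (morseX M S) (morseD β M) hd) C,
        ∀ k, E.hom.f k = morseHom β M k ∧ E.inv.f k = morseInv β M k := by
  obtain ⟨X, Y, hX, hX', hY, hY', hXd, hhom, hinv, hdiff⟩ := exists_restrictions hM hwf
  have hW := diff_mul_diff (β := β) (M := M)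
  have hU := upOp_mul_upOp hM
  have hE := matchedOp_mul_matchedOp hM
  have hUEU := upOp_mul_matchedOp_mul_upOp hM
  have hEUE := matchedOp_mul_upOp_mul_matchedOp hM
  have flow := flow_eq (A := Module.End S ((Σ k, ι k) →₀ S)) hW hE hX hY'
  have inv_hom := crit_inv_inv_crit (A := Module.End S ((Σ k, ι k) →₀ S)) hU hE hUEU hEUE hX' hY
  have hom_comm := diff_inv_crit (A := Module.End S ((Σ k, ι k) →₀ S))
    hW hU hE hUEU hEUE hX hX' hY hY'
  have inv_comm := crit_inv_diff (A := Module.End S ((Σ k, ι k) →₀ S))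
    hW hU hE hUEU hEUE hX hX' hY hY'
  rw [← critOp] at flow inv_hom hom_comm inv_comm
  have hom_d : ∀ k (z : morseX M S (k + 1)),
      morseHom β M k (morseD β M k z) = C.d (k + 1) k (morseHom β M (k + 1) z) := by
    intro k z
    refine incl_injective (β := β) k ?_
    rw [hhom, ← diff_incl (M := M), hhom, ← critOp_critIncl (β := β), hdiff]
    have := LinearMap.congr_fun hom_comm (critIncl M (k + 1) z)
    simp only [Module.End.mul_apply] at this ⊢
    rw [critOp_critIncl] at this ⊢
    exact this.symm
  have inv_d : ∀ k (z : C.X (k + 1)),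
      morseInv β M k (C.d (k + 1) k z) = morseD β M k (morseInv β M (k + 1) z) := by
    intro k z
    refine critIncl_injective k ?_
    rw [hinv, hdiff, hinv, ← diff_incl (M := M)]
    have := LinearMap.congr_fun inv_comm (incl β (k + 1) z)
    simp only [Module.End.mul_apply] at this ⊢
    exact this
  have hom_inv : ∀ k (z : morseX M S k), morseInv β M k (morseHom β M k z) = z := by
    intro k z
    refine critIncl_injective k ?_
    rw [hinv, hhom, ← critOp_critIncl (β := β)]
    have := LinearMap.congr_fun inv_hom (critIncl M k z)
    simp only [Module.End.mul_apply] at this ⊢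
    exact this
  have hd : ∀ k, morseD β M (k + 1) ≫ morseD β M k = 0 := by
    intro k
    ext1
    refine LinearMap.ext fun z => ?_
    change morseD β M k (morseD β M (k + 1) z) = 0
    have h0 : ∀ y, C.d (k + 1) k (C.d (k + 2) (k + 1) y) = 0 := fun y => by
      rw [← ModuleCat.comp_apply, C.d_comp_d]; rfl
    -- `C` retracts onto the Morse complex, so `d ∘ d = 0` is inherited from `C`
    rw [← hom_inv _ (morseD β M k (morseD β M (k + 1) z)), hom_d, hom_d, h0, map_zero]
  -- the homotopy, a restriction of `U * X`
  let θ (k : ℕ) : C.X k ⟶ C.X (k + 1) := ModuleCat.ofHom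
    ((β (k + 1)).repr.symm.toLinearMap ∘ₗ
      Finsupp.lcomapDomain (Sigma.mk (k + 1)) sigma_mk_injective ∘ₗ
        (upOp β M * X) ∘ₗ incl β k)
  have hθ : ∀ k (z : C.X k), incl β (k + 1) (θ k z) = (upOp β M * X) (incl β k z) := by
    intro k z
    ext v
    by_cases h : v.1 = k + 1
    · obtain ⟨l, v⟩ := v
      obtain rfl : l = _ := h
      rw [incl_apply]
      simp [θ]
    · rw [incl_apply_of_ne _ h]
      by_contra h'
      rw [Module.End.mul_apply] at h'
      obtain ⟨w, h1, h2⟩ := exists_of_apply_ne_zero (Ne.symm h')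
      obtain ⟨w', h3, h4⟩ := exists_of_apply_ne_zero h1
      have h5 : w'.1 = k := by
        by_contra h5
        exact h3 (incl_apply_of_ne _ h5)
      have := (upOp_ne_zero h2).2
      have := hXd _ _ h4
      omega
  have hflow : ∀ k (z : C.X k), incl β k (morseHom β M k (morseInv β M k z)) =
      incl β k z + (downOp β M + matchedOp β M) ((upOp β M * X) (incl β k z)) +
        (upOp β M * X) ((downOp β M + matchedOp β M) (incl β k z)) := by
    intro k z
    rw [hhom, hinv]
    have := LinearMap.congr_fun flow (incl β k z)
    simp only [Module.End.mul_apply, LinearMap.add_apply, Module.End.one_apply] at this ⊢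
    exact this
  have hof : ∀ k, (ChainComplex.of (morseX M S) (morseD β M) hd).d (k + 1) k = morseD β M k :=
    fun k => ChainComplex.of_d _ _ _
  let hom : ChainComplex.of (morseX M S) (morseD β M) hd ⟶ C :=
    { f := fun k => morseHom β M k
      comm' := by
        rintro _ k rfl
        rw [hof]
        ext1
        exact LinearMap.ext fun z => (hom_d k z).symm }
  let inv : C ⟶ ChainComplex.of (morseX M S) (morseD β M) hd :=
    { f := fun k => morseInv β M k
      comm' := by
        rintro _ k rfl
        rw [hof]
        ext1
        exact LinearMap.ext fun z => (inv_d k z).symm }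
  refine ⟨hd, ⟨hom, inv, ?_, ?_⟩, fun k => ⟨rfl, rfl⟩⟩
  · refine Homotopy.ofEq ?_
    ext k : 2
    exact LinearMap.ext fun z => hom_inv k z
  · refine
      { hom := fun k l => if h : k + 1 = l then θ k ≫ eqToHom (by rw [h]) else 0
        zero := fun k l h => dif_neg h
        comm := fun k => ?_ }
    ext1
    refine LinearMap.ext fun z => incl_injective (β := β) k ?_
    have hL : incl β k ((inv ≫ hom).f k z) =
        incl β k (morseHom β M k (morseInv β M k z)) := rfl
    refine hL.trans ((hflow k z).trans ?_)
    rcases k with _ | k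
    · rw [Homotopy.dNext_zero_chainComplex, Homotopy.prevD_chainComplex, dif_pos rfl, eqToHom_refl,
        Category.comp_id, zero_add, diff_incl_zero, map_zero, add_zero, ← hθ, diff_incl, ← map_add,
        add_comm]
      rfl
    · rw [Homotopy.dNext_succ_chainComplex, Homotopy.prevD_chainComplex, dif_pos rfl, dif_pos rfl,
        eqToHom_refl, eqToHom_refl, Category.comp_id, Category.comp_id, diff_incl, ← hθ, ← hθ,
        diff_incl, ← map_add, ← map_add]
      refine congrArg (incl β (k + 1)) ?_
      change _ = θ k (C.d (k + 1) k z) + C.d (k + 2) (k + 1) (θ (k + 1) z) + z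
      abel

end Equivalence
end AlgMorse

/-! ### The matching on lists of sets -/

namespace ExteriorBar

section Lists

variable {n : ℕ}

/-- The relation `matching` on lists of sets, as a recursion along the list: behind weakly
increasing singletons that are at least `b`, a further such singleton `{i}` is merged with the set `B` next to
it, where `B` is nonempty and lies below `i`. In the recursion `b` is the last singleton passed; it
is a natural number so that `b = 0` is no condition, also for `n = 0`. -/
inductive Matched : ℕ → List (Finset (Fin n)) → List (Finset (Fin n)) → Prop
  | here {b : ℕ} {A B σ : Finset (Fin n)} {T : List (Finset (Fin n))} (i : Fin n) (hA : A = {i})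
      (hb : b ≤ i) (hne : B ≠ ∅) (hlt : ∀ j ∈ B, j < i) (hσ : σ = insert i B) :
      Matched b (A :: B :: T) (σ :: T)
  | there {b : ℕ} {A : Finset (Fin n)} {l m : List (Finset (Fin n))} (j : Fin n) (hA : A = {j})
      (hb : b ≤ j) (h : Matched j l m) : Matched b (A :: l) (A :: m)

lemma Matched.exists_mem_head {b : ℕ} {A : Finset (Fin n)} {l m : List (Finset (Fin n))}
    (h : Matched b (A :: l) m) : ∃ j ∈ A, b ≤ j := by
  cases h with
  | here i hA hb => exact ⟨i, by simp [hA], hb⟩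
  | there i hA hb => exact ⟨i, by simp [hA], hb⟩

lemma insert_ne_singleton {i j : Fin n} {B : Finset (Fin n)} (hne : B ≠ ∅)
    (hlt : ∀ j ∈ B, j < i) : insert i B ≠ {j} := by
  intro h
  obtain ⟨k, hk⟩ := Finset.nonempty_iff_ne_empty.2 hne
  have h1 : i ∈ ({j} : Finset (Fin n)) := h ▸ Finset.mem_insert_self i B
  have h2 : k ∈ ({j} : Finset (Fin n)) := h ▸ Finset.mem_insert_of_mem hk
  rw [Finset.mem_singleton] at h1 h2
  exact (hlt k hk).ne (h2.trans h1.symm)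

lemma Matched.target_unique {b b' : ℕ} {l m m' : List (Finset (Fin n))} (h : Matched b l m)
    (h' : Matched b' l m') : m = m' := by
  induction h generalizing b' m' with
  | here i hA hb hne hlt hσ =>
    cases h' with
    | here i' hA' hb' hne' hlt' hσ' =>
      obtain rfl := Finset.singleton_injective (hA.symm.trans hA')
      rw [hσ, hσ']
    | there j hA' hb' h' =>
      obtain rfl := Finset.singleton_injective (hA.symm.trans hA')
      obtain ⟨k, hk, hik⟩ := h'.exists_mem_head
      exact absurd (Fin.lt_def.1 (hlt k hk)) (not_lt.2 hik)
  | there j hA hb h ih =>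
    cases h' with
    | here i' hA' hb' hne' hlt' hσ' =>
      obtain rfl := Finset.singleton_injective (hA.symm.trans hA')
      obtain ⟨k, hk, hik⟩ := h.exists_mem_head
      exact absurd (Fin.lt_def.1 (hlt' k hk)) (not_lt.2 hik)
    | there j' hA' hb' h' => rw [ih h']

lemma Matched.source_unique {b b' : ℕ} {l l' m : List (Finset (Fin n))} (h : Matched b l m)
    (h' : Matched b' l' m) : l = l' := by
  induction h generalizing b' l' with
  | here i hA hb hne hlt hσ =>
    cases h' with
    | here i' hA' hb' hne' hlt' hσ' =>
      have hB : insert i _ = insert i' _ := hσ.symm.trans hσ'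
      have hii : i = i' := by
        have h1 : i ∈ insert i' _ := hB ▸ Finset.mem_insert_self i _
        have h2 : i' ∈ insert i _ := hB ▸ Finset.mem_insert_self i' _
        rcases Finset.mem_insert.1 h1 with h1 | h1
        · exact h1
        · rcases Finset.mem_insert.1 h2 with h2 | h2
          · exact h2.symm
          · exact absurd (hlt' _ h1) (hlt _ h2).asymm
      subst hii
      rw [hA, hA', ← Finset.erase_insert fun h => (hlt i h).false, hB,
        Finset.erase_insert fun h => (hlt' i h).false]
    | there j hA' hb' h' => exact absurd (hσ.symm.trans hA') (insert_ne_singleton hne hlt)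
  | there j hA hb h ih =>
    cases h' with
    | here i' hA' hb' hne' hlt' hσ' =>
      exact absurd (hσ'.symm.trans hA) (insert_ne_singleton hne' hlt')
    | there j' hA' hb' h' => rw [ih h']

/-- No list is both the lower end of one edge and the upper end of another. -/
lemma Matched.not_matched {b b' : ℕ} {l m w : List (Finset (Fin n))} (h : Matched b l m) :
    ¬ Matched b' m w := by
  intro h'
  induction h generalizing b' w with
  | here i hA hb hne hlt hσ =>
    cases h' with
    | here i' hA' => exact absurd (hσ.symm.trans hA') (insert_ne_singleton hne hlt)
    | there i' hA' => exact absurd (hσ.symm.trans hA') (insert_ne_singleton hne hlt)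
  | there j hA hb h ih =>
    cases h' with
    | here i' hA' hb' hne' hlt' hσ' =>
      obtain rfl := Finset.singleton_injective (hA.symm.trans hA')
      cases h with
      | here i'' hA'' hb'' hne'' hlt'' hσ'' =>
        exact absurd (Fin.lt_def.1 (hlt' i'' (hσ'' ▸ Finset.mem_insert_self _ _))) (not_lt.2 hb'')
      | there j' hA'' hb'' =>
        exact absurd (Fin.lt_def.1 (hlt' j' (hA'' ▸ Finset.mem_singleton_self _))) (not_lt.2 hb'')
    | there j' hA' hb' h' => exact ih h'

/-- Every list of nonempty sets is matched, unless it consists of singletons in weakly increasing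
order, or its first set lies below the bound. -/
lemma matched_or_sorted (b : ℕ) (l : List (Finset (Fin n))) (hl : ∅ ∉ l) :
    (∃ m, Matched b l m) ∨ (∃ m, ∅ ∉ m ∧ Matched b m l) ∨
      (∃ t : List (Fin n), l = t.map ({·}) ∧ t.Pairwise (· ≤ ·) ∧ ∀ j ∈ t, b ≤ j) ∨
      ∃ A T, l = A :: T ∧ ∀ j ∈ A, (j : ℕ) < b := by
  induction l generalizing b with
  | nil => exact .inr (.inr (.inl ⟨[], rfl, .nil, by simp⟩))
  | cons A l ih =>
    rw [List.mem_cons, not_or] at hl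
    have hA : A.Nonempty := Finset.nonempty_iff_ne_empty.2 (Ne.symm hl.1)
    by_cases hmax : (A.max' hA : ℕ) < b
    · exact .inr (.inr (.inr ⟨A, l, rfl, fun j hj =>
        (Fin.le_def.1 (A.le_max' j hj)).trans_lt hmax⟩))
    rw [not_lt] at hmax
    by_cases hA1 : A.erase (A.max' hA) = ∅
    · have hA2 : A = {A.max' hA} := by
        rw [Finset.erase_eq_empty_iff] at hA1
        exact hA1.resolve_left hA.ne_empty
      generalize A.max' hA = j at hmax hA2
      rcases ih j hl.2 with ⟨m, h⟩ | ⟨m, hm, h⟩ | ⟨t, rfl, ht, hj⟩ | ⟨B, T, rfl, hB⟩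
      · exact .inl ⟨_, .there j hA2 hmax h⟩
      · refine .inr (.inl ⟨_, ?_, .there j hA2 hmax h⟩)
        rw [List.mem_cons, not_or]
        exact ⟨hl.1, hm⟩
      · refine .inr (.inr (.inl ⟨j :: t, by rw [hA2]; rfl, List.pairwise_cons.2 ⟨hj, ht⟩, ?_⟩))
        intro k hk
        rcases List.mem_cons.1 hk with rfl | hk
        · exact hmax
        · exact hmax.trans (hj k hk)
      · refine .inl ⟨_, .here j hA2 hmax (fun h => hl.2 ?_) hB rfl⟩
        rw [h]; exact List.mem_cons_self
    · refine .inr (.inl ⟨_, ?_, .here (T := l) _ rfl hmax hA1 (fun j hj => ?_)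
        (Finset.insert_erase (A.max'_mem hA)).symm⟩)
      · simp only [List.mem_cons, not_or]
        exact ⟨(Finset.singleton_ne_empty _).symm, Ne.symm hA1, hl.2⟩
      · exact lt_of_le_of_ne (A.le_max' j (Finset.mem_of_mem_erase hj)) (Finset.ne_of_mem_erase hj)

lemma Matched.exists_append {b : ℕ} {l m : List (Finset (Fin n))} (h : Matched b l m) :
    ∃ (L : List (Fin n)) (i : Fin n) (B : Finset (Fin n)) (T : List (Finset (Fin n))),
      l = L.map ({·}) ++ {i} :: B :: T ∧ m = L.map ({·}) ++ insert i B :: T ∧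
      (L ++ [i]).Pairwise (· ≤ ·) ∧ (∀ j ∈ L ++ [i], b ≤ j) ∧ B ≠ ∅ ∧ ∀ j ∈ B, j < i := by
  induction h with
  | here i hA hb hne hlt hσ =>
    exact ⟨[], i, _, _, by rw [hA]; rfl, by rw [hσ]; rfl, by simp, by simpa using hb, hne, hlt⟩
  | there j hA hb h ih =>
    obtain ⟨L, i, B, T, rfl, rfl, hs, hL, hne, hlt⟩ := ih
    refine ⟨j :: L, i, B, T, by rw [hA]; rfl, by rw [hA]; rfl, List.pairwise_cons.2 ⟨hL, hs⟩, ?_,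
      hne, hlt⟩
    intro k hk
    rcases List.mem_cons.1 hk with rfl | hk
    · exact hb
    · exact hb.trans (hL k hk)

lemma matched_append {b : ℕ} {i : Fin n} {B : Finset (Fin n)} (L : List (Fin n))
    (T : List (Finset (Fin n))) (hs : (L ++ [i]).Pairwise (· ≤ ·)) (hL : ∀ j ∈ L ++ [i], b ≤ j)
    (hne : B ≠ ∅) (hlt : ∀ j ∈ B, j < i) :
    Matched b (L.map ({·}) ++ {i} :: B :: T) (L.map ({·}) ++ insert i B :: T) := by
  induction L generalizing b with
  | nil => exact .here i rfl (hL i (by simp)) hne hlt rfl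
  | cons j L ih =>
    rw [List.cons_append, List.pairwise_cons] at hs
    exact .there j rfl (hL j (by simp)) (ih hs.2 hs.1)

lemma empty_notMem_sets (v : Vertex n) : ∅ ∉ v.sets := by
  intro h
  obtain ⟨j, hj⟩ := (List.mem_ofFn' _ _).1 h
  exact (v.2 j).2 hj

lemma matching_iff (u v : Vertex n) : matching u v ↔ Matched 0 u.sets v.sets := by
  constructor
  · rintro ⟨L, i, σ, T, hu, hv, hs, hi, hmax⟩
    rw [hu, hv]
    nth_rewrite 2 [← Finset.insert_erase hi]
    refine matched_append L T hs (fun _ _ => Nat.zero_le _) (fun h => ?_) fun j hj =>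
      lt_of_le_of_ne (hmax j (Finset.mem_of_mem_erase hj)) (Finset.ne_of_mem_erase hj)
    apply empty_notMem_sets u
    rw [hu, h]
    simp
  · intro h
    obtain ⟨L, i, B, T, hu, hv, hs, -, hne, hlt⟩ := h.exists_append
    refine ⟨L, i, insert i B, T, ?_, hv, hs, Finset.mem_insert_self _ _, ?_⟩
    · rw [Finset.erase_insert fun h => (hlt i h).false, hu]
    · intro j hj
      rcases Finset.mem_insert.1 hj with rfl | hj
      · exact le_rfl
      · exact (hlt j hj).le

lemma Vertex.sets_injective : Function.Injective (Vertex.sets (n := n)) := by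
  rintro ⟨k, u⟩ ⟨l, v⟩ h
  have hkl : k = l := by simpa [Vertex.sets] using congrArg List.length h
  subst hkl
  have := List.ofFn_injective h
  congr
  funext j
  exact Subtype.ext (congrFun this j)

lemma exists_sets_eq {l : List (Finset (Fin n))} (hl : ∅ ∉ l) : ∃ v : Vertex n, v.sets = l := by
  refine ⟨⟨l.length, fun j => ⟨l.get j, fun h => hl (h ▸ l.get_mem j)⟩⟩, ?_⟩
  rw [Vertex.sets]
  exact List.ofFn_get l

lemma length_sets (v : Vertex n) : v.sets.length = v.1 := List.length_ofFn

/-- The critical vertices are the weakly increasing lists of singletons. -/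
lemma isCritical_iff_sets (v : Vertex n) : IsCritical (matching (n := n)) v ↔
    ∃ t : List (Fin n), v.sets = t.map ({·}) ∧ t.Pairwise (· ≤ ·) := by
  constructor
  · intro h
    rcases matched_or_sorted 0 v.sets (empty_notMem_sets v) with
      ⟨m, hm⟩ | ⟨m, hm, hm'⟩ | ⟨t, ht, ht', -⟩ | ⟨A, T, h, hA⟩
    · obtain ⟨w, hw⟩ : ∃ w : Vertex n, w.sets = m := by
        refine exists_sets_eq fun h0 => ?_
        obtain ⟨L, i, B, T, hu, rfl, -, -, hne, hlt⟩ := hm.exists_append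
        rw [List.mem_append, List.mem_cons] at h0
        rcases h0 with h0 | h0 | h0
        · simp at h0
        · exact Finset.insert_ne_empty _ _ h0.symm
        · exact empty_notMem_sets v (hu ▸ by simp [h0])
      exact absurd ((matching_iff _ _).2 (hw ▸ hm)) (h w).1
    · obtain ⟨w, rfl⟩ := exists_sets_eq hm
      exact absurd ((matching_iff _ _).2 hm') (h w).2
    · exact ⟨t, ht, ht'⟩
    · obtain ⟨j, hj⟩ : A.Nonempty := by
        rw [Finset.nonempty_iff_ne_empty]
        rintro rfl
        exact empty_notMem_sets v (h ▸ List.mem_cons_self)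
      exact absurd (hA j hj) (Nat.not_lt_zero _)
  · rintro ⟨t, ht, hs⟩
    have : v = ⟨t.length, vars t.get⟩ := by
      refine Vertex.sets_injective (ht.trans ?_)
      change _ = List.ofFn (({·}) ∘ t.get)
      rw [← List.map_ofFn, List.ofFn_get]
    rw [this]
    refine isCritical_vars fun i j h => ?_
    exact List.SortedLE.monotone_get hs.sortedLE h

end Lists

end ExteriorBar

/-! ### A rank that decreases along the steps -/

namespace ExteriorBar

section Potential

variable {n : ℕ}

/-- The number of entries of a list of sets. -/
def size (l : List (Finset (Fin n))) : ℕ := (l.map Finset.card).sum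

/-- The number of pairs `a < b` with `a ∈ A` and `b ∈ B`. -/
def ascents (A B : Finset (Fin n)) : ℕ := ((A ×ˢ B).filter fun p => p.1 < p.2).card

/-- The number of pairs `a < b` with `a` and `b` in different sets of the list, `a` to the left of
`b`. -/
def noninv : List (Finset (Fin n)) → ℕ
  | [] => 0
  | A :: l => (l.map (ascents A)).sum + noninv l

lemma ascents_union_left {A B : Finset (Fin n)} (h : Disjoint A B) (D : Finset (Fin n)) :
    ascents (A ∪ B) D = ascents A D + ascents B D := by
  rw [ascents, Finset.union_product, Finset.filter_union, Finset.card_union_of_disjoint]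
  · rfl
  · exact Finset.disjoint_filter_filter (Finset.disjoint_product.2 (.inl h))

lemma ascents_union_right {A B : Finset (Fin n)} (h : Disjoint A B) (D : Finset (Fin n)) :
    ascents D (A ∪ B) = ascents D A + ascents D B := by
  rw [ascents, Finset.product_union, Finset.filter_union, Finset.card_union_of_disjoint]
  · rfl
  · exact Finset.disjoint_filter_filter (Finset.disjoint_product.2 (.inr h))

lemma ascents_eq_zero {A B : Finset (Fin n)} :
    ascents A B = 0 ↔ ∀ a ∈ A, ∀ b ∈ B, b ≤ a := by
  rw [ascents, Finset.card_eq_zero, Finset.filter_eq_empty_iff]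
  simp only [Finset.mem_product, not_lt, Prod.forall]
  exact ⟨fun h a ha b hb => h a b ⟨ha, hb⟩, fun h a b hab => h a hab.1 b hab.2⟩

lemma size_append (l m : List (Finset (Fin n))) : size (l ++ m) = size l + size m := by
  simp [size]

lemma size_cons (A : Finset (Fin n)) (l : List (Finset (Fin n))) :
    size (A :: l) = A.card + size l := by
  simp [size]

lemma size_merge (P T : List (Finset (Fin n))) {A B : Finset (Fin n)} (h : Disjoint A B) :
    size (P ++ A :: B :: T) = size (P ++ (A ∪ B) :: T) := by
  simp only [size_append, size_cons, Finset.card_union_of_disjoint h]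
  omega

lemma noninv_merge (P T : List (Finset (Fin n))) {A B : Finset (Fin n)} (h : Disjoint A B) :
    noninv (P ++ A :: B :: T) = noninv (P ++ (A ∪ B) :: T) + ascents A B := by
  induction P with
  | nil =>
    have : ∀ T : List (Finset (Fin n)), (T.map (ascents (A ∪ B))).sum =
        (T.map (ascents A)).sum + (T.map (ascents B)).sum := fun T => by
      rw [← List.sum_map_add]
      exact congrArg List.sum (List.map_congr_left fun D _ => ascents_union_left h D)
    simp only [List.nil_append, noninv, List.map_cons, List.sum_cons, this]
    omega
  | cons D P ih =>
    simp only [List.cons_append, noninv, ih, List.map_append, List.map_cons, List.sum_append,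
      List.sum_cons, ascents_union_right h]
    omega

/-- Merging two neighbouring sets `A > B` of a list does not create the lower end of an edge of the
matching, unless this edge is the one that comes from the merging. -/
lemma Matched.split {b : ℕ} {w P T : List (Finset (Fin n))} {A B : Finset (Fin n)}
    (h : Matched b w (P ++ (A ∪ B) :: T)) (hA : A ≠ ∅) (hB : B ≠ ∅) (hAB : Disjoint A B)
    (hlt : ∀ a ∈ A, ∀ b ∈ B, b ≤ a) :
    Matched b (P ++ A :: B :: T) (P ++ (A ∪ B) :: T) ∨ ∃ w', Matched b w' (P ++ A :: B :: T) := by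
  have hlt' : ∀ a ∈ A, ∀ b ∈ B, b < a := fun a ha b hb =>
    lt_of_le_of_ne (hlt a ha b hb) fun h => Finset.disjoint_left.1 hAB ha (h ▸ hb)
  induction P generalizing b w with
  | nil =>
    rw [List.nil_append] at h
    cases h with
    | @here _ _ D _ _ i hi hb hne hD hσ =>
      have hiA : i ∈ A := by
        rcases Finset.mem_union.1 (hσ.symm ▸ Finset.mem_insert_self i D) with h | h
        · exact h
        · obtain ⟨a, ha⟩ := Finset.nonempty_iff_ne_empty.2 hA
          have h1 := hlt' a ha i h
          have h2 : a ∈ insert i D := hσ ▸ Finset.mem_union_left B ha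
          rcases Finset.mem_insert.1 h2 with h2 | h2
          · exact absurd h2 h1.ne'
          · exact absurd (hD a h2) h1.asymm
      have hmax : ∀ a ∈ A, a ≠ i → a < i := fun a ha hai => by
        have h2 : a ∈ insert i D := hσ ▸ Finset.mem_union_left B ha
        exact hD a ((Finset.mem_insert.1 h2).resolve_left hai)
      by_cases hAi : A.erase i = ∅
      · have hAi' : A = {i} := by
          rw [Finset.erase_eq_empty_iff] at hAi
          exact hAi.resolve_left hA
        exact .inl (.here i hAi' hb hB (fun j hj => hlt' i hiA j hj) (by rw [hAi']; rfl))
      · exact .inr ⟨_, .here (T := B :: T) i rfl hb hAi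
          (fun j hj => hmax j (Finset.mem_of_mem_erase hj) (Finset.ne_of_mem_erase hj))
          (Finset.insert_erase hiA).symm⟩
    | there j hj hb h =>
      obtain ⟨a, ha⟩ := Finset.nonempty_iff_ne_empty.2 hA
      obtain ⟨c, hc⟩ := Finset.nonempty_iff_ne_empty.2 hB
      have h1 : a ∈ ({j} : Finset (Fin n)) := hj ▸ Finset.mem_union_left B ha
      have h2 : c ∈ ({j} : Finset (Fin n)) := hj ▸ Finset.mem_union_right A hc
      rw [Finset.mem_singleton] at h1 h2
      exact absurd (h2.trans h1.symm) (hlt' a ha c hc).ne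
  | cons D P ih =>
    rw [List.cons_append] at h
    cases h with
    | here i hi hb hne hD hσ => exact .inr ⟨_, .here i hi hb hne hD hσ⟩
    | there j hj hb h =>
      rcases ih h with h | ⟨w', h⟩
      · exact .inl (.there j hj hb h)
      · exact .inr ⟨_, .there j hj hb h⟩

lemma Matched.exists_merge {b : ℕ} {l m : List (Finset (Fin n))} (h : Matched b l m) :
    ∃ (P T : List (Finset (Fin n))) (A B : Finset (Fin n)), l = P ++ A :: B :: T ∧
      m = P ++ (A ∪ B) :: T ∧ Disjoint A B ∧ ascents A B = 0 := by
  obtain ⟨L, i, B, T, hl, hm, -, -, -, hlt⟩ := h.exists_append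
  refine ⟨_, _, _, _, hl, hm, ?_, ?_⟩
  · rw [Finset.disjoint_singleton_left]
    exact fun h => (hlt i h).false
  · rw [ascents_eq_zero]
    intro a ha b hb
    rw [Finset.mem_singleton.1 ha]
    exact (hlt b hb).le

open Classical in
/-- A quantity that decreases along the steps of the modified digraph. In lexicographic order: the
number of entries, which only the outer faces lower; the number of non-inversions, which merging `A`
and `B` lowers unless `A > B`; whether the vertex is the lower end of an edge of the matching, which
a reversed edge changes from `1` to `0`; and the degree. -/
noncomputable def rank (v : Vertex n) : ℕ ×ₗ ℕ ×ₗ ℕ ×ₗ ℕ :=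
  toLex (size v.sets, toLex (noninv v.sets,
    toLex (if ∃ w, Matched 0 w v.sets then 1 else 0, v.1)))

/-- An inner face lowers the rank: if neither the size nor the number of non-inversions drops, then
`Matched.split` shows that the third entry does not grow, and the degree drops. -/
lemma rank_lt_of_merge {u v : Vertex n} {P T : List (Finset (Fin n))} {A B : Finset (Fin n)}
    (hu : u.sets = P ++ A :: B :: T) (hv : v.sets = P ++ (A ∪ B) :: T) (hAB : Disjoint A B)
    (hM : ¬ matching u v) : rank v < rank u := by
  have hA : A ≠ ∅ := fun h => empty_notMem_sets u (by rw [hu, h]; simp)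
  have hB : B ≠ ∅ := fun h => empty_notMem_sets u (by rw [hu, h]; simp)
  have hk : u.1 = v.1 + 1 := by
    rw [← length_sets, ← length_sets, hu, hv]; simp; omega
  have hN : noninv u.sets = noninv v.sets + ascents A B := by rw [hu, hv, noninv_merge P T hAB]
  have hS : size u.sets = size v.sets := by rw [hu, hv, size_merge P T hAB]
  simp only [rank, Prod.Lex.toLex_lt_toLex, hS, lt_self_iff_false, true_and, false_or]
  rcases Nat.eq_zero_or_pos (ascents A B) with h0 | h0
  · refine .inr ⟨by omega, ?_⟩
    by_cases hl : ∃ w, Matched 0 w v.sets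
    · obtain ⟨w, hw⟩ := hl
      rw [hv] at hw
      rcases hw.split hA hB hAB (ascents_eq_zero.1 h0) with h | h
      · exact absurd ((matching_iff u v).2 (by rw [hu, hv]; exact h)) hM
      · rw [if_pos (c := ∃ w, Matched 0 w u.sets) (by rw [hu]; exact h)]
        split_ifs <;> omega
    · rw [if_neg hl]
      split_ifs <;> omega
  · exact .inl (by omega)

lemma rank_lt_of_matching {u v : Vertex n} (h : matching u v) : rank u < rank v := by
  rw [matching_iff] at h
  obtain ⟨P, T, A, B, hu, hv, hAB, h0⟩ := h.exists_merge
  have hN : noninv u.sets = noninv v.sets + ascents A B := by rw [hu, hv, noninv_merge P T hAB]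
  have hS : size u.sets = size v.sets := by rw [hu, hv, size_merge P T hAB]
  simp only [rank, Prod.Lex.toLex_lt_toLex, hS, lt_self_iff_false, true_and, false_or, hN, h0,
    add_zero]
  rw [if_pos (c := ∃ w, Matched 0 w v.sets) ⟨_, h⟩, if_neg (fun ⟨w, hw⟩ => hw.not_matched h)]
  exact .inl Nat.zero_lt_one

lemma rank_lt_of_size_lt {u v : Vertex n} (h : size v.sets < size u.sets) : rank v < rank u :=
  Prod.Lex.toLex_lt_toLex.2 (.inl h)

end Potential

end ExteriorBar

/-! ### Structure constants and the bar differential -/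

namespace ExteriorBar

section Products

variable {R : Type u} [CommRing R] {n : ℕ}

lemma xGen_mul_self (i : Fin n) : xGen R i * xGen R i = 0 := ExteriorAlgebra.ι_sq_zero _

lemma xGen_mul_comm (i j : Fin n) : xGen R i * xGen R j = -(xGen R j * xGen R i) :=
  eq_neg_of_add_eq_zero_left (ExteriorAlgebra.ι_add_mul_swap _ _)

lemma extBasis_singleton (i : Fin n) : extBasis R n {i} = xGen R i := by
  simp [extBasis_apply]

/-- Rearranging a product of generators changes at most its sign. -/
lemma prod_xGen_perm {l l' : List (Fin n)} (h : l.Perm l') :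
    (l.map (xGen R)).prod = (l'.map (xGen R)).prod ∨
      (l.map (xGen R)).prod = -(l'.map (xGen R)).prod := by
  induction h with
  | nil => exact .inl rfl
  | cons x _ ih =>
    simp only [List.map_cons, List.prod_cons]
    rcases ih with h | h
    · exact .inl (by rw [h])
    · exact .inr (by rw [h, mul_neg])
  | swap x y l =>
    simp only [List.map_cons, List.prod_cons, ← mul_assoc]
    exact .inr (by rw [xGen_mul_comm y x, neg_mul])
  | trans _ _ ih1 ih2 =>
    rcases ih1 with h1 | h1 <;> rcases ih2 with h2 | h2 <;> rw [h1, h2] <;> simp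

lemma prod_xGen_eq_zero {l : List (Fin n)} (h : ¬ l.Nodup) : (l.map (xGen R)).prod = 0 := by
  obtain ⟨i, hi⟩ : ∃ i, List.Duplicate i l := by
    by_contra h'
    exact h (List.nodup_iff_forall_not_duplicate.2 (not_exists.1 h'))
  obtain ⟨l', hl'⟩ := (List.duplicate_iff_sublist.1 hi).exists_perm_append
  have h0 : (([i, i] ++ l').map (xGen R)).prod = 0 := by
    simp [← mul_assoc, xGen_mul_self]
  rcases prod_xGen_perm (R := R) hl' with h | h <;> rw [h, h0]
  rw [neg_zero]

lemma prod_xGen_nodup {l : List (Fin n)} (h : l.Nodup) :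
    (l.map (xGen R)).prod = extBasis R n l.toFinset ∨
      (l.map (xGen R)).prod = -extBasis R n l.toFinset := by
  rw [extBasis_apply]
  exact prod_xGen_perm (((Finset.sort_perm_toList _ _).trans (List.toFinset_toList h)).symm)

lemma extBasis_mul (A B : Finset (Fin n)) : extBasis R n A * extBasis R n B =
    ((A.sort (· ≤ ·) ++ B.sort (· ≤ ·)).map (xGen R)).prod := by
  rw [extBasis_apply, extBasis_apply, List.map_append, List.prod_append]

lemma extBasis_mul_of_disjoint {A B : Finset (Fin n)} (h : Disjoint A B) :
    extBasis R n A * extBasis R n B = extBasis R n (A ∪ B) ∨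
      extBasis R n A * extBasis R n B = -extBasis R n (A ∪ B) := by
  rw [extBasis_mul]
  have : (A.sort (· ≤ ·) ++ B.sort (· ≤ ·)).toFinset = A ∪ B := by
    rw [List.toFinset_append, Finset.sort_toFinset, Finset.sort_toFinset]
  rw [← this]
  refine prod_xGen_nodup (List.nodup_append'.2 ⟨Finset.sort_nodup _ _, Finset.sort_nodup _ _, ?_⟩)
  intro a ha hb
  rw [Finset.mem_sort] at ha hb
  exact Finset.disjoint_left.1 h ha hb

lemma extBasis_mul_of_not_disjoint {A B : Finset (Fin n)} (h : ¬ Disjoint A B) :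
    extBasis R n A * extBasis R n B = 0 := by
  rw [extBasis_mul]
  refine prod_xGen_eq_zero fun h' => h ?_
  rw [List.nodup_append'] at h'
  rw [Finset.disjoint_left]
  intro a ha hb
  exact h'.2.2 ((Finset.mem_sort _).2 ha) ((Finset.mem_sort _).2 hb)

lemma extBasis_singleton_mul {i j : Fin n} (h : i < j) :
    extBasis R n {i} * extBasis R n {j} = extBasis R n {i, j} := by
  rw [extBasis_mul, extBasis_apply]
  congr 2
  have h1 : ({i, j} : Finset (Fin n)).sort (· ≤ ·) = [i, j] := by
    rw [Finset.sort_insert, Finset.sort_singleton]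
    · simpa using h.le
    · simpa using h.ne
  rw [h1]; simp

/-- The coefficient of `x_σ` in `x_A x_B`. -/
noncomputable def mulCoeff (R : Type u) [CommRing R] (A B σ : Finset (Fin n)) : R :=
  (extBasis R n).coord σ (extBasis R n A * extBasis R n B)

lemma mulCoeff_ne_zero {A B σ : Finset (Fin n)} (h : mulCoeff R A B σ ≠ 0) :
    Disjoint A B ∧ σ = A ∪ B := by
  by_cases hAB : Disjoint A B
  · refine ⟨hAB, ?_⟩
    by_contra hσ
    refine h ?_
    rcases extBasis_mul_of_disjoint (R := R) hAB with h' | h' <;>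
      simp [mulCoeff, h', Finsupp.single_eq_of_ne hσ]
  · exact absurd (by rw [mulCoeff, extBasis_mul_of_not_disjoint hAB, map_zero]) h

lemma isUnit_mulCoeff {A B : Finset (Fin n)} (h : Disjoint A B) :
    IsUnit (mulCoeff R A B (A ∪ B)) := by
  rcases extBasis_mul_of_disjoint (R := R) h with h' | h' <;> simp [mulCoeff, h']

lemma mulCoeff_of_lt {i j : Fin n} (h : i < j) :
    mulCoeff R {i} {j} {i, j} = 1 ∧ mulCoeff R {j} {i} {i, j} = -1 := by
  have h1 := extBasis_singleton_mul (R := R) h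
  have h2 : extBasis R n {j} * extBasis R n {i} = -extBasis R n {i, j} := by
    rw [← h1, extBasis_singleton, extBasis_singleton, xGen_mul_comm]
  simp [mulCoeff, h1, h2]

end Products

end ExteriorBar

namespace NormalizedBar

section Coefficients

variable {R A : Type u} [CommRing R] [Ring A] [Algebra R A] {I : Type} (e : Module.Basis I R A)
  (o : I)

lemma tensorBasis_repr (he : e o = 1) {k : ℕ} (z : NBar R A k) (v : Fin k → {i // i ≠ o}) :
    (tensorBasis e o he k).repr z v = nbarCoeff e o he v z := by
  classical
  suffices (tensorBasis e o he k).coord v = nbarCoeff e o he v from LinearMap.congr_fun this z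
  refine (tensorBasis e o he k).ext fun w => ?_
  rw [Module.Basis.coord_apply, Module.Basis.repr_self, tensorBasis_apply, nbarCoeff_tensor,
    Finsupp.single_apply]
  exact if_congr eq_comm rfl rfl

/-- The tuple `a` with the entries `m` and `m + 1` replaced by their product. -/
def innerMerge {k : ℕ} (m : Fin k) (a : Fin (k + 1) → A) (j : Fin k) : A :=
  if j < m then a j.castSucc else if j = m then a j.castSucc * a j.succ else a j.succ

omit [CommRing R] [Ring A] [Algebra R A] in
/-- The entries of a tuple `a` with `x` and `y` put around it. The tuple is given by a sequence,
which turns identities between merged tuples into case distinctions on natural numbers. -/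
lemma frame_apply {k : ℕ} (x y : A) (a : ℕ → A) (j : Fin (k + 2)) :
    (Fin.cons x (Fin.snoc (fun i : Fin k => a i) y : Fin (k + 1) → A) : Fin (k + 2) → A) j =
      if (j : ℕ) = 0 then x else if (j : ℕ) = k + 1 then y else a (j - 1) := by
  refine Fin.cases (by simp) (fun j => ?_) j
  refine Fin.lastCases (by simp) (fun j => ?_) j
  simp [j.2.ne]

omit [CommRing R] [Algebra R A] in
lemma mergeAt_frame_zero {k : ℕ} (a : Fin (k + 1) → A) :
    mergeAt A 0 (Fin.cons 1 (Fin.snoc a 1 : Fin (k + 2) → A)) =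
      Fin.cons (a 0) (Fin.snoc (fun j : Fin k => a j.succ) 1 : Fin (k + 1) → A) := by
  obtain ⟨b, rfl⟩ := exists_nat_tuple a
  funext j
  have := frame_apply (k := k) (b 0) 1 (fun i => b (i + 1)) j
  simp only [merge_apply, Fin.val_succ, Fin.val_zero, this, frame_apply, Fin.val_castSucc,
    Fin.ext_iff, Fin.lt_def]
  have := j.2
  split_ifs <;> grind

omit [CommRing R] [Algebra R A] in
lemma mergeAt_frame_inner {k : ℕ} (a : Fin (k + 1) → A) (m : Fin k) :
    mergeAt A m.castSucc.succ (Fin.cons 1 (Fin.snoc a 1 : Fin (k + 2) → A)) =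
      Fin.cons 1 (Fin.snoc (innerMerge m a) 1 : Fin (k + 1) → A) := by
  obtain ⟨b, rfl⟩ := exists_nat_tuple a
  funext j
  have h : innerMerge m (fun j : Fin (k + 1) => b j) = fun j : Fin k =>
      (fun i : ℕ => if i < m then b i else if i = m then b i * b (i + 1) else b (i + 1)) j := by
    funext j
    simp only [innerMerge, Fin.ext_iff, Fin.lt_def, Fin.val_castSucc, Fin.val_succ]
  rw [h, frame_apply 1 1
    (fun i : ℕ => if i < m then b i else if i = m then b i * b (i + 1) else b (i + 1))]
  simp only [merge_apply, Fin.val_succ, frame_apply, Fin.val_castSucc,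
    Fin.ext_iff, Fin.lt_def]
  have := j.2
  have := m.2
  split_ifs <;> grind

omit [CommRing R] [Algebra R A] in
lemma mergeAt_frame_last {k : ℕ} (a : Fin (k + 1) → A) :
    mergeAt A (Fin.last k).succ (Fin.cons 1 (Fin.snoc a 1 : Fin (k + 2) → A)) =
      Fin.cons 1 (Fin.snoc (fun j : Fin k => a j.castSucc) (a (Fin.last k)) :
        Fin (k + 1) → A) := by
  obtain ⟨b, rfl⟩ := exists_nat_tuple a
  funext j
  have := frame_apply (k := k) 1 (b k) b j
  simp only [merge_apply, Fin.val_succ, this, frame_apply, Fin.val_castSucc,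
    Fin.ext_iff, Fin.lt_def, Fin.val_last]
  have := j.2
  split_ifs <;> grind

lemma coeffVal_frame {k : ℕ} (v : Fin k → I) (x y : A) (a : Fin k → A) :
    coeffVal e v (Fin.cons x (Fin.snoc a y : Fin (k + 1) → A)) =
      (∏ j, e.coord (v j) (a j)) • (x ⊗ₜ[R] MulOpposite.op y) := by
  rw [coeffVal, ← Fin.succ_last]
  simp only [Fin.cons_succ, Fin.snoc_castSucc, Fin.cons_zero, Fin.snoc_last]

/-- The coefficient of the differential of `1 ⊗ a₀ ⊗ ⋯ ⊗ aₖ ⊗ 1` at a basis element. The two outer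
faces contribute their outer factor to the coefficient, the inner ones only scalars. -/
lemma nbarCoeff_nbarD_tensor (he : e o = 1) {k : ℕ} (v : Fin k → {i // i ≠ o})
    (a : Fin (k + 1) → A) :
    nbarCoeff e o he v (nbarD R A k (tensor R a)) =
      (∏ j, e.coord (v j).1 (a j.succ)) • (a 0 ⊗ₜ[R] 1) +
      ((∑ m : Fin k, (-1 : ℤ) ^ (m + 1 : ℕ) •
        (∏ j, e.coord (v j).1 (innerMerge m a j)) • (1 : Env R A)) +
      (-1 : ℤ) ^ (k + 1) •
        (∏ j, e.coord (v j).1 (a j.castSucc)) • (1 ⊗ₜ[R] MulOpposite.op (a (Fin.last k)))) := by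
  have h : nbarCoeff e o he v (nbarD R A k (tensor R a)) =
      ∑ i : Fin (k + 2), (-1 : ℤ) ^ (i : ℕ) • coeffVal e (fun i => (v i).1)
        (mergeAt A i (Fin.cons 1 (Fin.snoc a 1 : Fin (k + 2) → A))) := by
    change barCoeff e (fun i => (v i).1) (∑ i : Fin (k + 2), (-1 : ℤ) ^ (i : ℕ) •
      face R k i (pureTensor R A (k + 1) _)) = _
    rw [map_sum]
    refine Finset.sum_congr rfl fun i _ => ?_
    rw [map_zsmul, face_pure, barCoeff_pure]
  rw [h, Fin.sum_univ_succ, Fin.sum_univ_castSucc, mergeAt_frame_zero, mergeAt_frame_last]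
  simp only [mergeAt_frame_inner, coeffVal_frame, Fin.val_zero, pow_zero, one_smul, Fin.val_succ,
    Fin.val_castSucc, Fin.val_last, MulOpposite.op_one, Algebra.TensorProduct.one_def]

end Coefficients
end NormalizedBar

/-! ### The edges of the digraph and their weights -/

namespace ExteriorBar

section Edges

variable {R : Type u} [CommRing R] {n : ℕ}

/-- The tuple `v` arises from `u` by merging the disjoint sets at the places `m` and `m + 1`. -/
def MergesAt {k : ℕ} (m : Fin k) (u : Fin (k + 1) → NE n) (v : Fin k → NE n) : Prop :=
  (∀ j < m, v j = u j.castSucc) ∧ Disjoint (u m.castSucc).1 (u m.succ).1 ∧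
    (v m).1 = (u m.castSucc).1 ∪ (u m.succ).1 ∧ ∀ j, m < j → v j = u j.succ

lemma prod_coord_eq {k : ℕ} (v w : Fin k → NE n) [Decidable (v = w)] :
    ∏ j, (extBasis R n).coord (v j).1 (extBasis R n (w j).1) = if v = w then 1 else 0 := by
  split_ifs with h
  · subst h
    simp
  · obtain ⟨j, hj⟩ := Function.ne_iff.1 h
    refine Finset.prod_eq_zero (Finset.mem_univ j) ?_
    rw [Module.Basis.coord_apply, Module.Basis.repr_self, Finsupp.single_eq_of_ne]
    exact fun h => hj (Subtype.ext h)

lemma coord_innerMerge {k : ℕ} (m : Fin k) (u : Fin (k + 1) → NE n) (v : Fin k → NE n) (j : Fin k) :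
    (extBasis R n).coord (v j).1 (innerMerge m (fun i => extBasis R n (u i).1) j) =
      if j < m then (if v j = u j.castSucc then 1 else 0) else
      if j = m then mulCoeff R (u m.castSucc).1 (u m.succ).1 (v m).1 else
      if v j = u j.succ then 1 else 0 := by
  rw [innerMerge]
  split_ifs with h1 h2 h3 h4
  · simp [h2]
  · rw [Module.Basis.coord_apply, Module.Basis.repr_self, Finsupp.single_eq_of_ne]
    exact fun h => h2 (Subtype.ext h)
  · subst h3
    rfl
  · simp [h4]
  · rw [Module.Basis.coord_apply, Module.Basis.repr_self, Finsupp.single_eq_of_ne]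
    exact fun h => h4 (Subtype.ext h)

open Classical in
lemma prod_innerMerge {k : ℕ} (m : Fin k) (u : Fin (k + 1) → NE n) (v : Fin k → NE n) :
    ∏ j, (extBasis R n).coord (v j).1 (innerMerge m (fun i => extBasis R n (u i).1) j) =
      if MergesAt m u v then mulCoeff R (u m.castSucc).1 (u m.succ).1 (v m).1 else 0 := by
  simp only [coord_innerMerge]
  split_ifs with h
  · rw [Finset.prod_eq_single m]
    · simp
    · intro j _ hj
      rcases lt_or_gt_of_ne hj with hj' | hj'
      · rw [if_pos hj', if_pos (h.1 j hj')]
      · rw [if_neg hj'.asymm, if_neg hj, if_pos (h.2.2.2 j hj')]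
    · simp
  · by_contra h0
    have h1 : ∀ j, _ ≠ (0 : R) := fun j hj => h0 (Finset.prod_eq_zero (Finset.mem_univ j) hj)
    refine h ⟨fun j hj => ?_, ?_, ?_, fun j hj => ?_⟩
    · by_contra h2
      exact h1 j (by rw [if_pos hj, if_neg h2])
    · have := h1 m
      rw [if_neg (lt_irrefl m), if_pos rfl] at this
      exact (mulCoeff_ne_zero this).1
    · have := h1 m
      rw [if_neg (lt_irrefl m), if_pos rfl] at this
      exact (mulCoeff_ne_zero this).2
    · by_contra h2
      exact h1 j (by rw [if_neg hj.asymm, if_neg hj.ne', if_neg h2])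

open Classical in
/-- The entries of the matrices of the bar differential, as the sum over the faces. -/
lemma edgeWeight_eq {k : ℕ} (u : Fin (k + 1) → NE n) (v : Fin k → NE n) :
    edgeWeight (barBasis R n) ⟨k + 1, u⟩ ⟨k, v⟩ =
      (if v = fun j => u j.succ then (1 : R) else 0) • (extBasis R n (u 0).1 ⊗ₜ[R] 1) +
      ((∑ m : Fin k, (-1 : ℤ) ^ (m + 1 : ℕ) •
        (if MergesAt m u v then mulCoeff R (u m.castSucc).1 (u m.succ).1 (v m).1 else 0) •
          (1 : Env R (ExtAlg R n))) +
      (-1 : ℤ) ^ (k + 1) • (if v = fun j => u j.castSucc then (1 : R) else 0) •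
        (1 ⊗ₜ[R] MulOpposite.op (extBasis R n (u (Fin.last k)).1))) := by
  have h : edgeWeight (barBasis R n) ⟨k + 1, u⟩ ⟨k, v⟩ =
      nbarCoeff (extBasis R n) ∅ (extBasis_empty R n) v
        (nbarD R (ExtAlg R n) k (tensor R fun j => extBasis R n (u j).1)) := by
    rw [← tensorBasis_repr, ← barBasis_apply]
    have hd : (extBar R n).d (k + 1) k = ModuleCat.ofHom (nbarD R (ExtAlg R n) k) :=
      ChainComplex.of_d (fun k => ModuleCat.of (Env R (ExtAlg R n)) (NBar R (ExtAlg R n) k))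
        (fun k => ModuleCat.ofHom (nbarD R (ExtAlg R n) k)) k
    rw [edgeWeight, hd]
    rfl
  rw [h, nbarCoeff_nbarD_tensor]
  simp only [prod_innerMerge, prod_coord_eq v fun j => u j.succ,
    prod_coord_eq v fun j => u j.castSucc]

/-- The merged set strictly contains both of its parts, since these are disjoint and nonempty; so
merging at `m` is not the omission of an outer set or the merging at another place. -/
lemma MergesAt.ne_castSucc {k : ℕ} {m : Fin k} {u : Fin (k + 1) → NE n} {v : Fin k → NE n}
    (h : MergesAt m u v) : v m ≠ u m.castSucc := fun h' => by
  have h1 := h.2.2.1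
  rw [h', eq_comm, Finset.union_eq_left] at h1
  exact (u m.succ).2 (Finset.disjoint_self_iff_empty _ |>.1 (h.2.1.mono_left h1))

lemma MergesAt.ne_succ {k : ℕ} {m : Fin k} {u : Fin (k + 1) → NE n} {v : Fin k → NE n}
    (h : MergesAt m u v) : v m ≠ u m.succ := fun h' => by
  have h1 := h.2.2.1
  rw [h', eq_comm, Finset.union_eq_right] at h1
  exact (u m.castSucc).2 (Finset.disjoint_self_iff_empty _ |>.1 (h.2.1.mono_right h1))

lemma MergesAt.unique {k : ℕ} {m m' : Fin k} {u : Fin (k + 1) → NE n} {v : Fin k → NE n}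
    (h : MergesAt m u v) (h' : MergesAt m' u v) : m = m' := by
  rcases lt_trichotomy m m' with hm | hm | hm
  · exact absurd (h'.1 m hm) h.ne_castSucc
  · exact hm
  · exact absurd (h'.2.2.2 m hm) h.ne_succ

/-- Different faces of a basis element never have a common term if one of the faces is an inner
one, so the weight of a merging is a single structure constant up to sign. -/
lemma edgeWeight_of_mergesAt {k : ℕ} {m : Fin k} {u : Fin (k + 1) → NE n} {v : Fin k → NE n}
    (h : MergesAt m u v) : edgeWeight (barBasis R n) ⟨k + 1, u⟩ ⟨k, v⟩ =
      ((-1) ^ (m + 1 : ℕ) * mulCoeff R (u m.castSucc).1 (u m.succ).1 (v m).1) •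
        (1 : Env R (ExtAlg R n)) := by
  classical
  rw [edgeWeight_eq, if_neg fun h' => h.ne_succ (congrFun h' m),
    if_neg fun h' => h.ne_castSucc (congrFun h' m), Finset.sum_eq_single m, if_pos h]
  · rw [zero_smul, zero_smul, smul_zero, add_zero, zero_add, ← Int.cast_smul_eq_zsmul R, smul_smul]
    push_cast
    rfl
  · intro m' _ hm'
    rw [if_neg fun h' => hm' (h'.unique h), zero_smul, smul_zero]
  · simp

lemma edgeWeight_cases {k : ℕ} {u : Fin (k + 1) → NE n} {v : Fin k → NE n}
    (h : edgeWeight (barBasis R n) ⟨k + 1, u⟩ ⟨k, v⟩ ≠ 0) :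
    (v = fun j => u j.succ) ∨ (v = fun j => u j.castSucc) ∨ ∃ m, MergesAt m u v := by
  classical
  by_contra h'
  push Not at h'
  refine h ?_
  rw [edgeWeight_eq, if_neg h'.1, if_neg h'.2.1, Finset.sum_eq_zero]
  · simp
  · intro m _
    rw [if_neg (h'.2.2 m), zero_smul, smul_zero]

lemma getElem_sets {k : ℕ} (u : Fin k → NE n) (i : ℕ)
    (h : i < (Vertex.sets ⟨k, u⟩).length) :
    (Vertex.sets ⟨k, u⟩)[i] = (u ⟨i, by rwa [length_sets] at h⟩).1 :=
  List.getElem_ofFn _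

lemma MergesAt.sets_eq {k : ℕ} {m : Fin k} {u : Fin (k + 1) → NE n} {v : Fin k → NE n}
    (h : MergesAt m u v) : ∃ P T : List (Finset (Fin n)),
      Vertex.sets ⟨k + 1, u⟩ = P ++ (u m.castSucc).1 :: (u m.succ).1 :: T ∧
      Vertex.sets ⟨k, v⟩ = P ++ ((u m.castSucc).1 ∪ (u m.succ).1) :: T := by
  have hu : (Vertex.sets (⟨k + 1, u⟩ : Vertex n)).length = k + 1 := length_sets _
  have hv : (Vertex.sets (⟨k, v⟩ : Vertex n)).length = k := length_sets _
  have hm := m.2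
  refine ⟨(Vertex.sets ⟨k + 1, u⟩).take m, (Vertex.sets ⟨k + 1, u⟩).drop (m + 2), ?_, ?_⟩
  · conv_lhs => rw [← List.take_append_drop m (Vertex.sets ⟨k + 1, u⟩),
      List.drop_eq_getElem_cons (by omega), List.drop_eq_getElem_cons (by omega), getElem_sets,
      getElem_sets]
    rfl
  · rw [← h.2.2.1]
    conv_lhs => rw [← List.take_append_drop m (Vertex.sets ⟨k, v⟩),
      List.drop_eq_getElem_cons (by omega), getElem_sets]
    congr 1
    · refine List.ext_getElem (by simp only [List.length_take, hu, hv]; omega) fun i h1 h2 => ?_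
      have hi : i < m := by rw [List.length_take] at h1; omega
      rw [List.getElem_take, List.getElem_take, getElem_sets, getElem_sets, h.1 _ (Fin.lt_def.2 hi)]
      rfl
    · congr 1
      refine List.ext_getElem (by simp only [List.length_drop, hu, hv]; omega) fun i h1 h2 => ?_
      rw [List.getElem_drop, List.getElem_drop, getElem_sets, getElem_sets,
        h.2.2.2 _ (Fin.lt_def.2 (by simp; omega))]
      congr 2
      simp [Fin.ext_iff]
      omega

lemma mergesAt_of_sets_eq {k : ℕ} {u : Fin (k + 1) → NE n} {v : Fin k → NE n}
    {P T : List (Finset (Fin n))} {A B : Finset (Fin n)}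
    (hu : Vertex.sets ⟨k + 1, u⟩ = P ++ A :: B :: T) (hv : Vertex.sets ⟨k, v⟩ = P ++ (A ∪ B) :: T)
    (hAB : Disjoint A B) : ∃ m : Fin k, MergesAt m u v ∧ (m : ℕ) = P.length ∧
      (u m.castSucc).1 = A ∧ (u m.succ).1 = B := by
  have hul : (Vertex.sets (⟨k + 1, u⟩ : Vertex n)).length = k + 1 := length_sets _
  have hvl : (Vertex.sets (⟨k, v⟩ : Vertex n)).length = k := length_sets _
  have hk : k = P.length + 1 + T.length := by
    rw [hv] at hvl; simp at hvl; omega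
  have hu' : ∀ i : Fin (k + 1), (u i).1 = (P ++ A :: B :: T)[(i : ℕ)]'(by
      have := i.2; simp; omega) := fun i => by
    have := getElem_sets u i (by rw [hul]; exact i.2)
    simp only [hu] at this
    exact this.symm
  have hv' : ∀ i : Fin k, (v i).1 = (P ++ (A ∪ B) :: T)[(i : ℕ)]'(by
      have := i.2; simp; omega) := fun i => by
    have := getElem_sets v i (by rw [hvl]; exact i.2)
    simp only [hv] at this
    exact this.symm
  let m : Fin k := ⟨P.length, by omega⟩
  have h1 : (u m.castSucc).1 = A := by
    rw [hu']
    simp [m]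
  have h2 : (u m.succ).1 = B := by
    rw [hu']
    simp [m]
  refine ⟨m, ⟨fun j hj => Subtype.ext ?_, ?_, ?_, fun j hj => Subtype.ext ?_⟩, rfl, h1, h2⟩
  · have : (j : ℕ) < P.length := hj
    rw [hu', hv']
    simp [this]
  · rwa [h1, h2]
  · rw [h1, h2, hv']
    simp [m]
  · obtain ⟨d, hd⟩ := Nat.exists_eq_add_of_lt (show P.length < (j : ℕ) from hj)
    rw [hu', hv']
    simp only [Fin.val_succ, hd]
    rw [List.getElem_append_right (by omega), List.getElem_append_right (by omega)]
    simp [show P.length + d + 1 - P.length = d + 1 by omega,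
      show P.length + d + 1 + 1 - P.length = d + 2 by omega]

/-- The weight of a merging is central and, up to sign, the structure constant of the exterior
algebra. It depends only on the lists of sets. -/
lemma edgeWeight_of_merge {u v : Vertex n} {P T : List (Finset (Fin n))} {A B : Finset (Fin n)}
    (hu : u.sets = P ++ A :: B :: T) (hv : v.sets = P ++ (A ∪ B) :: T) (hAB : Disjoint A B) :
    edgeWeight (barBasis R n) u v =
      ((-1) ^ (P.length + 1) * mulCoeff R A B (A ∪ B)) • (1 : Env R (ExtAlg R n)) := by
  obtain ⟨l, u⟩ := u
  obtain ⟨k, v⟩ := v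
  obtain rfl : l = k + 1 := by
    have h1 := congrArg List.length hu
    have h2 := congrArg List.length hv
    rw [length_sets] at h1 h2
    simp at h1 h2
    omega
  obtain ⟨m, hm, hmP, rfl, rfl⟩ := mergesAt_of_sets_eq hu hv hAB
  rw [edgeWeight_of_mergesAt hm, hmP, hm.2.2.1]

/-- The edges of the digraph: the outer faces shorten a list of sets, the inner faces merge two
neighbouring sets. -/
lemma edge_cases {u v : Vertex n} (h : edgeWeight (barBasis R n) u v ≠ 0) :
    size v.sets < size u.sets ∨ ∃ (P T : List (Finset (Fin n))) (A B : Finset (Fin n)),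
      u.sets = P ++ A :: B :: T ∧ v.sets = P ++ (A ∪ B) :: T ∧ Disjoint A B := by
  obtain ⟨l, u⟩ := u
  obtain ⟨k, v⟩ := v
  obtain rfl : l = k + 1 := edgeWeight_ne_zero h
  have hpos : ∀ σ : NE n, 0 < σ.1.card := fun σ =>
    Finset.card_pos.2 (Finset.nonempty_iff_ne_empty.2 σ.2)
  have hsize : ∀ (k : ℕ) (u : Fin k → NE n), size (Vertex.sets ⟨k, u⟩) = ∑ j, (u j).1.card := by
    intro k u
    rw [size, Vertex.sets, List.map_ofFn, List.sum_ofFn]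
    rfl
  rcases edgeWeight_cases h with rfl | rfl | ⟨m, hm⟩
  · refine .inl ?_
    rw [hsize, hsize, Fin.sum_univ_succ]
    have := hpos (u 0)
    omega
  · refine .inl ?_
    rw [hsize, hsize, Fin.sum_univ_castSucc]
    have := hpos (u (Fin.last k))
    omega
  · obtain ⟨P, T, hu, hv⟩ := hm.sets_eq
    exact .inr ⟨P, T, _, _, hu, hv, hm.2.1⟩

lemma rank_lt_of_morseStep {u v : Vertex n} (h : MorseStep (barBasis R n) matching u v) :
    rank v < rank u := by
  rcases h with ⟨h, hM⟩ | h
  · rcases edge_cases h with h | ⟨P, T, A, B, hu, hv, hAB⟩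
    · exact rank_lt_of_size_lt h
    · exact rank_lt_of_merge hu hv hAB hM
  · exact rank_lt_of_matching h

variable (R n) in
lemma wellFounded_morseStep :
    WellFounded fun v u : Vertex n => MorseStep (barBasis R n) matching u v :=
  Subrelation.wf (fun {v u} h => show rank v < rank u from rank_lt_of_morseStep h)
    (InvImage.wf rank wellFounded_lt)

/-- The augmentation of the exterior algebra induces a ring homomorphism from the enveloping algebra
to `R`. -/
instance [Nontrivial R] : Nontrivial (Env R (ExtAlg R n)) :=
  (Algebra.TensorProduct.lift (ExteriorAlgebra.algebraMapInv (R := R) (M := Fin n → R))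
    (ExteriorAlgebra.algebraMapInv.fromOpposite fun _ _ => Commute.all _ _)
    fun _ _ => Commute.all _ _).toRingHom.domain_nontrivial

variable (R n) in
lemma isMorseMatching [Nontrivial R] : IsMorseMatching (barBasis R n) matching where
  edge u v h := by
    suffices IsUnit (edgeWeight (barBasis R n) u v) from ⟨this.ne_zero, this⟩
    obtain ⟨P, T, A, B, hu, hv, hAB, -⟩ := ((matching_iff u v).1 h).exists_merge
    rw [edgeWeight_of_merge hu hv hAB, ← Algebra.algebraMap_eq_smul_one]
    exact (((isUnit_one.neg).pow _).mul (isUnit_mulCoeff hAB)).map _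
  matching u v u' v' h h' huv := by
    rw [matching_iff] at h h'
    rcases huv with rfl | rfl | rfl | rfl
    · exact ⟨rfl, Vertex.sets_injective (h.target_unique h')⟩
    · exact absurd h h'.not_matched
    · exact absurd h' h.not_matched
    · exact ⟨Vertex.sets_injective (h.source_unique h'), rfl⟩
  acyclic u h := by
    have : Relation.TransGen (fun v u => MorseStep (barBasis R n) matching u v) u u :=
      Relation.transGen_swap.1 h
    exact (wellFounded_morseStep R n).transGen.irrefl.irrefl u this
  noInfinitePath k f _ hf :=
    (wellFounded_iff_isEmpty_descending_chain.1 (wellFounded_morseStep R n)).false ⟨f, hf⟩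

end Edges
end ExteriorBar

/-! ### Words and descents -/

namespace ExteriorBar

section Words

variable {R : Type u} [CommRing R] {n : ℕ}

lemma sets_vars {k : ℕ} (a : Fin k → Fin n) :
    Vertex.sets ⟨k, vars a⟩ = (List.ofFn a).map ({·}) := by
  rw [List.map_ofFn]; rfl

lemma map_singleton_injective :
    Function.Injective (List.map fun i : Fin n => ({i} : Finset (Fin n))) :=
  List.map_injective_iff.2 Finset.singleton_injective

lemma length_le_size {l : List (Finset (Fin n))} (hl : ∅ ∉ l) : l.length ≤ size l := by
  induction l with
  | nil => exact Nat.zero_le _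
  | cons A l ih =>
    rw [List.mem_cons, not_or] at hl
    have := Finset.card_pos.2 (Finset.nonempty_iff_ne_empty.2 (Ne.symm hl.1))
    have := ih hl.2
    rw [size_cons, List.length_cons]
    omega

/-- Nonempty sets with as many entries in total as there are sets are singletons. -/
lemma exists_word_of_size_le {l : List (Finset (Fin n))} (hl : ∅ ∉ l) (h : size l ≤ l.length) :
    ∃ b : List (Fin n), l = b.map ({·}) := by
  induction l with
  | nil => exact ⟨[], rfl⟩
  | cons A l ih =>
    rw [List.mem_cons, not_or] at hl
    have h1 := Finset.card_pos.2 (Finset.nonempty_iff_ne_empty.2 (Ne.symm hl.1))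
    have h2 := length_le_size hl.2
    rw [size_cons, List.length_cons] at h
    obtain ⟨b, rfl⟩ := ih hl.2 (by omega)
    obtain ⟨i, rfl⟩ := Finset.card_eq_one.1 (show A.card = 1 by omega)
    exact ⟨i :: b, rfl⟩

lemma size_word (b : List (Fin n)) : size (b.map ({·})) = b.length := by
  rw [size, List.map_map]
  simp [Function.comp_def]

/-- Every word is weakly increasing or has a first descent. -/
lemma sorted_or_descent (b : List (Fin n)) : b.Pairwise (· ≤ ·) ∨
    ∃ (L : List (Fin n)) (i j : Fin n) (T : List (Fin n)), b = L ++ i :: j :: T ∧ j < i ∧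
      (L ++ [i]).Pairwise (· ≤ ·) := by
  induction b with
  | nil => exact .inl .nil
  | cons a b ih =>
    rcases ih with h | ⟨L, i, j, T, rfl, hij, hs⟩
    · rcases b with _ | ⟨c, b⟩
      · exact .inl (by simp)
      · rcases le_or_gt a c with hac | hac
        · refine .inl (List.pairwise_cons.2 ⟨fun d hd => ?_, h⟩)
          rcases List.mem_cons.1 hd with rfl | hd
          · exact hac
          · exact hac.trans ((List.pairwise_cons.1 h).1 d hd)
        · exact .inr ⟨[], a, c, b, rfl, hac, by simp⟩
    · rcases L with _ | ⟨c, L⟩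
      · rcases le_or_gt a i with hai | hai
        · exact .inr ⟨[a], i, j, T, rfl, hij, by simpa using hai⟩
        · exact .inr ⟨[], a, i, j :: T, rfl, hai, by simp⟩
      · rcases le_or_gt a c with hac | hac
        · refine .inr ⟨a :: c :: L, i, j, T, rfl, hij, List.pairwise_cons.2 ⟨fun d hd => ?_, hs⟩⟩
          rcases List.mem_cons.1 hd with rfl | hd
          · exact hac
          · exact hac.trans ((List.pairwise_cons.1 hs).1 d hd)
        · exact .inr ⟨[], a, c, L ++ i :: j :: T, rfl, hac, by simp⟩

lemma not_matched_word {b : ℕ} {m : List (Finset (Fin n))} {w : List (Fin n)} :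
    ¬ Matched b m (w.map ({·})) := by
  intro h
  obtain ⟨L, i, B, T, -, hw, -, -, hne, hlt⟩ := h.exists_append
  have : insert i B ∈ w.map fun i => ({i} : Finset (Fin n)) := by rw [hw]; simp
  obtain ⟨j, -, hj⟩ := List.mem_map.1 this
  exact insert_ne_singleton hne hlt hj.symm

/-- In a list with a single entry that is not a singleton, this entry is at a unique place. -/
lemma append_word_inj {P L : List (Fin n)} {X Y : Finset (Fin n)} {T T' : List (Fin n)}
    (hX : ∀ i, X ≠ {i}) (hY : ∀ i, Y ≠ {i})
    (h : P.map ({·}) ++ X :: T.map ({·}) = L.map ({·}) ++ Y :: T'.map ({·})) :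
    P = L ∧ X = Y ∧ T = T' := by
  induction P generalizing L with
  | nil =>
    rcases L with _ | ⟨c, L⟩
    · simp only [List.map_nil, List.nil_append, List.cons.injEq] at h
      exact ⟨rfl, h.1, map_singleton_injective h.2⟩
    · simp only [List.map_nil, List.nil_append, List.map_cons, List.cons_append,
        List.cons.injEq] at h
      exact absurd h.1 (hX c)
  | cons a P ih =>
    rcases L with _ | ⟨c, L⟩
    · simp only [List.map_nil, List.nil_append, List.map_cons, List.cons_append,
        List.cons.injEq] at h
      exact absurd h.1.symm (hY a)
    · simp only [List.map_cons, List.cons_append, List.cons.injEq] at h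
      obtain ⟨rfl, rfl, rfl⟩ := ih h.2
      exact ⟨by rw [Finset.singleton_injective h.1], rfl, rfl⟩

lemma size_le_of_rank_le {u v : Vertex n} (h : rank v ≤ rank u) : size v.sets ≤ size u.sets := by
  by_contra h'
  exact absurd (rank_lt_of_size_lt (not_le.1 h')) h.not_gt

lemma size_le_of_path {u v : Vertex n}
    (h : Relation.ReflTransGen (MorseStep (barBasis R n) matching) u v) :
    size v.sets ≤ size u.sets := by
  induction h with
  | refl => exact le_rfl
  | tail _ h ih => exact (size_le_of_rank_le (rank_lt_of_morseStep h).le).trans ih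

variable [Nontrivial R]

/-- The last two steps of a path that leads from a weakly increasing word to a word with first
descent `i > j` in the same degree come from exchanging `j` and `i`. -/
lemma exists_eq_append_swap {c v x y : Vertex n} (hc : IsCritical (matching (n := n)) c)
    (hcv : c.1 = v.1) {t L T : List (Fin n)} {i j : Fin n} (ht : c.sets = t.map ({·}))
    (hv : v.sets = (L ++ i :: j :: T).map ({·})) (hx : x.sets = (L ++ j :: i :: T).map ({·}))
    (hy : y.sets = L.map ({·}) ++ {i, j} :: T.map ({·})) (hij : j < i) (hvy : matching v y)
    (p : ZigZag (barBasis R n) matching c v) :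
    ∃ (q : ZigZag (barBasis R n) matching c x) (h : MorseStep (barBasis R n) matching x y)
      (h' : MorseStep (barBasis R n) matching y v), p = q.append (.cons h (.cons h' (.nil v))) := by
  have hM := isMorseMatching R n
  have hdeg : ∀ {u w : Vertex n}, matching u w → u.1 = w.1 + 1 := fun h =>
    edgeWeight_ne_zero (hM.edge _ _ h).1
  rcases p.eq_nil_or_snoc with ⟨rfl, -⟩ | ⟨y', q, h', rfl⟩
  · exact absurd hvy (hc y).1
  -- the last step goes up, as a path from a critical vertex does not rise above its degree
  have hvy' : matching v y' := by
    rcases h' with ⟨h', -⟩ | h'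
    · have := hc.degree_le_of_path_from hM q.reflTransGen
      have := edgeWeight_ne_zero h'
      omega
    · exact h'
  obtain ⟨-, rfl⟩ := hM.matching _ _ _ _ hvy hvy' (by simp)
  have hd := hdeg hvy
  rcases q.eq_nil_or_snoc with ⟨rfl, -⟩ | ⟨x', q, h, rfl⟩
  · omega
  suffices x' = x by
    subst this
    refine ⟨q, h, h', ?_⟩
    clear * -
    induction q with
    | nil => rfl
    | cons h'' q ih => simp only [ZigZag.append]; rw [ih]
  have h1 : edgeWeight (barBasis R n) x' y ≠ 0 ∧ ¬ matching x' y := by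
    rcases h with h | h
    · exact h
    · exact absurd h (hM.not_up_down hvy)
  have hd' := edgeWeight_ne_zero h1.1
  have hcl : size c.sets = c.1 := by
    rw [← length_sets, ht, size_word, List.length_map]
  have hvl : size v.sets = v.1 := by
    rw [← length_sets, hv, size_word, List.length_map]
  have hyl : size y.sets = size v.sets := by
    obtain ⟨P, T, A, B, hu, hv, hAB, -⟩ := ((matching_iff _ _).1 hvy).exists_merge
    rw [hu, hv, size_merge P T hAB]
  -- `x'` has at most as many entries as `c`, so all its sets are singletons
  have hxl := size_le_of_path q.reflTransGen
  obtain ⟨a, ha⟩ := exists_word_of_size_le (empty_notMem_sets x') (by rw [length_sets]; omega)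
  have hal : size (Vertex.sets x') = x'.1 := by
    rw [← length_sets, ha, size_word, List.length_map]
  rcases edge_cases h1.1 with h2 | ⟨P, T', A, B, hP, hQ, hAB⟩
  · omega
  rw [ha, List.map_eq_append_iff] at hP
  obtain ⟨P, Q, rfl, rfl, hQ1⟩ := hP
  obtain ⟨a, Q, rfl, rfl, hQ2⟩ := List.map_eq_cons_iff.1 hQ1
  obtain ⟨b, T', rfl, rfl, rfl⟩ := List.map_eq_cons_iff.1 hQ2
  have hab : a ≠ b := by
    rintro rfl
    simp at hAB
  have hns : ∀ {a b : Fin n}, a ≠ b → ∀ i, ({a, b} : Finset (Fin n)) ≠ {i} := fun hab i h => by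
    have := congrArg Finset.card h
    rw [Finset.card_pair hab, Finset.card_singleton] at this
    omega
  rw [hy] at hQ
  obtain ⟨rfl, hA, rfl⟩ := append_word_inj (hns hij.ne') (hns hab) hQ
  have hai : a ∈ ({i, j} : Finset (Fin n)) := hA ▸ by simp
  have hbi : b ∈ ({i, j} : Finset (Fin n)) := hA ▸ by simp
  simp only [Finset.mem_insert, Finset.mem_singleton] at hai hbi
  refine Vertex.sets_injective (ha.trans (Eq.trans ?_ hx.symm))
  -- splitting `{i, j}` into `i, j` is the edge of the matching itself, so it is split into `j, i`
  rcases hai with rfl | rfl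
  · obtain rfl := hbi.resolve_left hab.symm
    exact absurd hvy (Vertex.sets_injective (ha.trans hv.symm) ▸ h1.2)
  · obtain rfl := hbi.resolve_right hab.symm
    rfl

/-- Exchanging the letters `j < i` at the first descent of a word: there are two steps, of total
weight `1`, because `x_j x_i = -x_i x_j`. -/
lemma swap_steps {v x y : Vertex n} {L T : List (Fin n)} {i j : Fin n}
    (hv : v.sets = (L ++ i :: j :: T).map ({·})) (hx : x.sets = (L ++ j :: i :: T).map ({·}))
    (hy : y.sets = L.map ({·}) ++ {i, j} :: T.map ({·})) (hij : j < i) (hvy : matching v y) :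
    MorseStep (barBasis R n) matching x y ∧ MorseStep (barBasis R n) matching y v ∧
      stepWeight (barBasis R n) matching x y * stepWeight (barBasis R n) matching y v = 1 := by
  have hM := isMorseMatching R n
  rw [List.map_append, List.map_cons, List.map_cons] at hv hx
  have hd : Disjoint ({i} : Finset (Fin n)) {j} := by simpa using hij.ne'
  have hw1 := edgeWeight_of_merge (R := R) hv hy hd
  have hw2 := edgeWeight_of_merge (R := R) hx (hy.trans (by rw [Finset.pair_comm]; rfl)) hd.symm
  have h1 : ({i} ∪ {j} : Finset (Fin n)) = {j, i} := Finset.pair_comm i j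
  have h2 : ({j} ∪ {i} : Finset (Fin n)) = {j, i} := rfl
  rw [h1, (mulCoeff_of_lt hij).2] at hw1
  rw [h2, (mulCoeff_of_lt hij).1] at hw2
  have hss : ((-1 : R) ^ ((L.map fun i => ({i} : Finset (Fin n))).length + 1)) *
      (-1 : R) ^ ((L.map fun i => ({i} : Finset (Fin n))).length + 1) = 1 := by
    rw [← mul_pow]; simp
  generalize (-1 : R) ^ ((L.map fun i => ({i} : Finset (Fin n))).length + 1) = s at hss hw1 hw2
  -- the common factor of the two weights is a sign
  obtain ⟨w, hw, hww⟩ : ∃ w : Env R (ExtAlg R n), s • 1 = w ∧ w * w = 1 :=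
    ⟨_, rfl, by rw [smul_mul_smul_comm, hss, one_smul, one_mul]⟩
  rw [mul_one, hw] at hw2
  replace hw1 : edgeWeight (barBasis R n) v y = -w := by
    rw [hw1, mul_neg, mul_one, ← hw]
    exact neg_smul s (1 : Env R (ExtAlg R n))
  have hxy : ¬ matching x y := fun h => by
    obtain ⟨rfl, -⟩ := hM.matching _ _ _ _ h hvy (by simp)
    have := List.append_cancel_left (hx.symm.trans hv)
    simp only [List.cons.injEq, Finset.singleton_inj] at this
    exact hij.ne this.1
  have hinv : Ring.inverse (-w) = -w := by
    have h : -w * -w = 1 := (neg_mul_neg w w).trans hww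
    exact Ring.inverse_unit ⟨_, _, h, h⟩
  refine ⟨.inl ⟨fun h => ?_, hxy⟩, .inr hvy, ?_⟩
  · rw [← hw2, h, mul_zero] at hww
    exact zero_ne_one hww
  · rw [stepWeight, if_neg (hM.not_up_down hvy), stepWeight, if_pos hvy, hw1, hinv, hw2, neg_neg,
      hww]

end Words
end ExteriorBar

/-! ### Paths between words -/

namespace ExteriorBar

section PathsOfWords

variable {R : Type u} [CommRing R] {n : ℕ}

lemma eq_vars_get {t : List (Fin n)} {v : Fin t.length → NE n}
    (h : Vertex.sets ⟨t.length, v⟩ = t.map ({·})) : v = vars t.get := by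
  refine sigma_mk_injective (Vertex.sets_injective (h.trans ?_))
  rw [sets_vars, List.ofFn_get]

/-- A word `v` that is not weakly increasing is the upper end of an edge of the matching, to the
list `y` with its first descent `i, j` merged. The word `x` with the descent removed has larger
rank, so that an induction along the rank can pass from `v` to `x`. -/
lemma descent_cases {k : ℕ} (v : Fin k → NE n) {b : List (Fin n)}
    (hb : Vertex.sets ⟨k, v⟩ = b.map ({·})) : b.Pairwise (· ≤ ·) ∨
    ∃ (L : List (Fin n)) (i j : Fin n) (T : List (Fin n)) (x : Fin k → NE n) (y : Vertex n),
      b = L ++ i :: j :: T ∧ j < i ∧ Vertex.sets ⟨k, x⟩ = (L ++ j :: i :: T).map ({·}) ∧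
      y.sets = L.map ({·}) ++ {i, j} :: T.map ({·}) ∧ matching ⟨k, v⟩ y ∧
      rank ⟨k, v⟩ < rank (⟨k, x⟩ : Vertex n) := by
  rcases sorted_or_descent b with h | ⟨L, i, j, T, rfl, hij, hs⟩
  · exact .inl h
  have hlen : L.length + (T.length + 2) = k := by
    have := congrArg List.length hb
    rw [length_sets] at this
    simpa using this.symm
  obtain ⟨⟨l, x⟩, hx⟩ : ∃ x : Vertex n, x.sets = (L ++ j :: i :: T).map ({·}) :=
    exists_sets_eq (by simp)
  obtain rfl : l = k := by
    have := congrArg List.length hx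
    rw [length_sets] at this
    simp at this
    omega
  obtain ⟨y, hy⟩ : ∃ y : Vertex n, y.sets = L.map ({·}) ++ {i, j} :: T.map ({·}) :=
    exists_sets_eq (by simp [eq_comm (a := (∅ : Finset (Fin n)))])
  have hvy : matching ⟨l, v⟩ y := by
    rw [matching_iff, hb, hy, List.map_append]
    exact matched_append L _ hs (fun _ _ => Nat.zero_le _) (Finset.singleton_ne_empty j)
      (by simpa using hij)
  refine .inr ⟨L, i, j, T, x, y, rfl, hij, hx, hy, hvy, (rank_lt_of_matching hvy).trans ?_⟩
  rw [List.map_append] at hx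
  refine rank_lt_of_merge hx (hy.trans (by rw [Finset.pair_comm]; rfl)) (by simpa using hij.ne)
    fun h => ?_
  rw [matching_iff] at h hvy
  have := h.source_unique hvy
  rw [hx, hb, List.map_append] at this
  have := List.append_cancel_left this
  simp only [List.map_cons, List.cons.injEq, Finset.singleton_inj] at this
  exact hij.ne this.1

variable [Nontrivial R]

/-- There are no nontrivial paths between critical vertices of the same degree: the last step would
come from above. -/
lemma eq_of_path_isCritical {c v : Vertex n} (hc : IsCritical (matching (n := n)) c)
    (hv : IsCritical (matching (n := n)) v) (hcv : c.1 = v.1)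
    (p : ZigZag (barBasis R n) matching c v) : c = v := by
  have hM := isMorseMatching R n
  rcases p.eq_nil_or_snoc with ⟨h, -⟩ | ⟨y, q, h, -⟩
  · exact h
  · rcases h with ⟨h, -⟩ | h
    · have := hc.degree_le_of_path_from hM q.reflTransGen
      have := edgeWeight_ne_zero h
      omega
    · exact absurd h (hv y).1

lemma zigZag_self {v : Vertex n} (p : ZigZag (barBasis R n) matching v v) : p = .nil v := by
  rcases p.eq_nil_or_snoc with ⟨_, h⟩ | ⟨y, q, h, -⟩
  · exact h
  · exact absurd (Relation.TransGen.tail' q.reflTransGen h) ((isMorseMatching R n).acyclic v)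

/-- There are finitely many vertices of a given degree, so induction on decreasing distance from the
top of the rank is possible. -/
lemma wellFounded_rank (k : ℕ) :
    WellFounded fun x v : Fin k → NE n => rank (⟨k, v⟩ : Vertex n) < rank (⟨k, x⟩ : Vertex n) := by
  have : IsTrans (Fin k → NE n) fun x v => rank (⟨k, v⟩ : Vertex n) < rank (⟨k, x⟩ : Vertex n) :=
    ⟨fun _ _ _ h h' => h'.trans h⟩
  have : Std.Irrefl fun x v : Fin k → NE n =>
      rank (⟨k, v⟩ : Vertex n) < rank (⟨k, x⟩ : Vertex n) := ⟨fun _ => lt_irrefl _⟩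
  exact Finite.wellFounded_of_trans_of_irrefl _

variable (R) in
/-- From a weakly increasing word there is exactly one path to each rearrangement, and it has
weight `1`. -/
lemma exists_unique_path {c : Vertex n} (hc : IsCritical (matching (n := n)) c) {t : List (Fin n)}
    (ht : c.sets = t.map ({·})) (hts : t.Pairwise (· ≤ ·)) (v : Fin c.1 → NE n) {b : List (Fin n)}
    (hb : Vertex.sets ⟨c.1, v⟩ = b.map ({·})) (hbt : b.Perm t) :
    ∃ p : ZigZag (barBasis R n) matching c ⟨c.1, v⟩, p.weight = 1 ∧ ∀ q, q = p := by
  induction v using (wellFounded_rank c.1).induction generalizing b with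
  | _ v ih =>
  rcases descent_cases v hb with hbs | ⟨L, i, j, T, x, y, rfl, hij, hx, hy, hvy, hr⟩
  · obtain rfl : b = t := hbt.eq_of_pairwise' hbs hts
    have hcv : c = ⟨c.1, v⟩ := Vertex.sets_injective (ht.trans hb.symm)
    rw [← hcv]
    exact ⟨.nil c, rfl, zigZag_self⟩
  · obtain ⟨p, hp, hpu⟩ := ih x hr hx (by
      refine List.Perm.trans ?_ hbt
      exact (List.Perm.swap i j T).append_left L)
    obtain ⟨h1, h2, hw⟩ := swap_steps (R := R) hb hx hy hij hvy
    refine ⟨p.append (.cons h1 (.cons h2 (.nil _))), ?_, fun q => ?_⟩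
    · rw [ZigZag.weight_append, hp, one_mul, ZigZag.weight, ZigZag.weight, ZigZag.weight, mul_one,
        hw]
    · obtain ⟨q', _, _, rfl⟩ := exists_eq_append_swap (v := ⟨c.1, v⟩) hc rfl ht hb hx hy hij hvy q
      rw [hpu q']

/-- From a weakly increasing word, paths of total degree `0` lead only to its rearrangements. -/
lemma perm_of_path {c : Vertex n} (hc : IsCritical (matching (n := n)) c) {t : List (Fin n)}
    (ht : c.sets = t.map ({·})) (v : Fin c.1 → NE n)
    (p : ZigZag (barBasis R n) matching c ⟨c.1, v⟩) :
    ∃ b : List (Fin n), Vertex.sets ⟨c.1, v⟩ = b.map ({·}) ∧ b.Perm t := by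
  induction v using (wellFounded_rank c.1).induction with
  | _ v ih =>
  obtain ⟨b, hb⟩ := exists_word_of_size_le (empty_notMem_sets ⟨c.1, v⟩) (by
    refine (size_le_of_path p.reflTransGen).trans ?_
    rw [ht, size_word, length_sets, ← length_sets c, ht, List.length_map])
  refine ⟨b, hb, ?_⟩
  rcases descent_cases v hb with hbs | ⟨L, i, j, T, x, y, rfl, hij, hx, hy, hvy, hr⟩
  · have h := eq_of_path_isCritical hc ((isCritical_iff_sets _).2 ⟨b, hb, hbs⟩) rfl p
    rw [← h, ht] at hb
    rw [map_singleton_injective hb]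
  · obtain ⟨q, -⟩ := exists_eq_append_swap (v := ⟨c.1, v⟩) hc rfl ht hb hx hy hij hvy p
    obtain ⟨b', hb', hb't⟩ := ih x hr q
    obtain rfl := map_singleton_injective (hx.symm.trans hb')
    exact List.Perm.trans ((List.Perm.swap j i T).append_left L) hb't

/-- A path of total degree `0` from a word to a critical vertex is trivial, as no path from a word
starts with a step upwards. -/
lemma eq_of_path_word {v c : Vertex n} {b : List (Fin n)} (hv : v.sets = b.map ({·}))
    (hc : IsCritical (matching (n := n)) c) (hvc : v.1 = c.1)
    (p : ZigZag (barBasis R n) matching v c) : v = c := by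
  cases p with
  | nil => rfl
  | @cons _ w _ h p =>
    rcases h with ⟨h, -⟩ | h
    · have := hc.degree_le_of_path_to (isMorseMatching R n) p.reflTransGen
      have := edgeWeight_ne_zero h
      omega
    · rw [matching_iff, hv] at h
      exact absurd h not_matched_word

omit [Nontrivial R] in
lemma pathSum_of_unique {u v : Vertex n} (p : ZigZag (barBasis R n) matching u v)
    (hp : p.weight = 1) (hu : ∀ q, q = p) : pathSum (barBasis R n) matching u v = 1 := by
  have : Unique (ZigZag (barBasis R n) matching u v) := ⟨⟨p⟩, hu⟩
  rw [pathSum, finsum_unique]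
  exact (congrArg ZigZag.weight (hu default)).trans hp

omit [Nontrivial R] in
lemma pathSum_of_isEmpty {u v : Vertex n} (h : ZigZag (barBasis R n) matching u v → False) :
    pathSum (barBasis R n) matching u v = 0 := by
  have : IsEmpty (ZigZag (barBasis R n) matching u v) := ⟨h⟩
  rw [pathSum, finsum_of_isEmpty]

omit [Nontrivial R] in
lemma xTensor_eq {k : ℕ} (a : Fin k → Fin n) : xTensor R a = barBasis R n k (vars a) := by
  rw [barBasis_apply, xTensor]
  congr 1
  funext j
  exact (extBasis_singleton _).symm

omit [Nontrivial R] in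
lemma vars_injective {k : ℕ} : Function.Injective (vars (n := n) (k := k)) := fun a b h => by
  funext j
  exact Finset.singleton_injective (congrArg Subtype.val (congrFun h j))

lemma pairwise_of_monotone {k : ℕ} {τ : Fin k → Fin n} (hτ : Monotone τ) :
    (List.ofFn τ).Pairwise (· ≤ ·) := by
  rw [List.pairwise_ofFn]
  exact fun a b h => hτ h.le

lemma exists_perm {k : ℕ} {τ : Fin k → Fin n} (hτ : Monotone τ) {a : Fin k → Fin n}
    (h : (List.ofFn a).Perm (List.ofFn τ)) : ∃ π : Equiv.Perm (Fin k), τ ∘ π = a := by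
  have h1 : List.ofFn (a ∘ Tuple.sort a) = List.ofFn τ :=
    (((Tuple.sort a).ofFn_comp_perm a).trans h).eq_of_pairwise'
      (pairwise_of_monotone (Tuple.monotone_sort a)) (pairwise_of_monotone hτ)
  refine ⟨(Tuple.sort a)⁻¹, ?_⟩
  rw [← List.ofFn_injective h1]
  funext j
  simp

lemma morseHom_xMulti {k : ℕ} (τ : Fin k → Fin n) (hτ : Monotone τ) :
    morseHom (barBasis R n) matching k (xMulti R τ hτ) =
      ∑ a ∈ Finset.univ.image (fun π : Equiv.Perm (Fin k) => τ ∘ π), xTensor R a := by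
  classical
  refine (barBasis R n k).repr.injective (Finsupp.ext fun v => ?_)
  rw [xMulti, morseHom_single, map_sum, Finsupp.finsetSum_apply]
  simp only [xTensor_eq, Module.Basis.repr_self, Finsupp.single_apply]
  have ht := sets_vars τ
  have hc := isCritical_vars (n := n) hτ
  by_cases h : ∃ π : Equiv.Perm (Fin k), vars (τ ∘ π) = v
  · obtain ⟨π, rfl⟩ := h
    obtain ⟨p, hp, hpu⟩ := exists_unique_path R hc ht (pairwise_of_monotone hτ) _
      (sets_vars (τ ∘ π)) (π.ofFn_comp_perm τ)
    rw [pathSum_of_unique p hp hpu, Finset.sum_eq_single (τ ∘ π)]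
    · simp
    · intro a _ ha
      rw [if_neg fun h => ha (vars_injective h)]
    · intro h
      exact absurd (Finset.mem_image_of_mem _ (Finset.mem_univ π)) h
  · rw [pathSum_of_isEmpty, Finset.sum_eq_zero]
    · intro a ha
      obtain ⟨π, -, rfl⟩ := Finset.mem_image.1 ha
      exact if_neg fun h' => h ⟨π, h'⟩
    · intro p
      obtain ⟨b, hb, hbt⟩ := perm_of_path hc ht v p
      obtain rfl : b.length = k := by rw [← List.length_map, ← hb, length_sets]
      obtain ⟨π, hπ⟩ := exists_perm (a := b.get) hτ (by rwa [List.ofFn_get])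
      exact h ⟨π, by rw [hπ, eq_vars_get hb]⟩

lemma morseInv_xTensor {k : ℕ} (τ : Fin k → Fin n) (hτ : Monotone τ) (π : Equiv.Perm (Fin k)) :
    morseInv (barBasis R n) matching k (xTensor R (τ ∘ π)) =
      if τ ∘ π = τ then xMulti R τ hτ else 0 := by
  classical
  refine Finsupp.ext fun c => ?_
  rw [xTensor_eq, morseInv_basis]
  have key : ∀ p : ZigZag (barBasis R n) matching ⟨k, vars (τ ∘ π)⟩ ⟨k, c.1⟩,
      vars (τ ∘ π) = c.1 ∧ τ ∘ π = τ := fun p => by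
    have h1 := eq_of_path_word (sets_vars _) c.2 rfl p
    refine ⟨sigma_mk_injective h1, ?_⟩
    obtain ⟨t, ht, hts⟩ := (isCritical_iff_sets _).1 (h1 ▸ c.2)
    rw [sets_vars] at ht
    rw [← map_singleton_injective ht] at hts
    exact List.ofFn_injective ((π.ofFn_comp_perm τ).eq_of_pairwise' hts (pairwise_of_monotone hτ))
  split_ifs with h
  · rw [xMulti, Finsupp.single_apply]
    split_ifs with hc
    · subst hc
      rw [h]
      exact pathSum_of_unique (.nil _) rfl zigZag_self
    · exact pathSum_of_isEmpty fun p => hc (Subtype.ext (by rw [← (key p).1, h]))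
  · exact pathSum_of_isEmpty fun p => h (key p).2

end PathsOfWords

end ExteriorBar

theorem proposition2 (R : Type u) [CommRing R] [Nontrivial R] (n : ℕ) :
    IsMorseMatching (barBasis R n) matching ∧
    (∀ u v, Finite (ZigZag (barBasis R n) matching u v)) ∧
    (∀ (k : ℕ) (v : Fin k → NE n),
      IsCritical matching ⟨k, v⟩ ↔
        ∃ τ : Fin k → Fin n, Monotone τ ∧ v = vars τ) ∧
    (∃ hd : ∀ k,
        morseD (barBasis R n) matching (k + 1) ≫
          morseD (barBasis R n) matching k = 0,
      ∃ E : HomotopyEquiv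
          (ChainComplex.of
            (morseX matching (Env R (ExtAlg R n)))
            (morseD (barBasis R n) matching) hd)
          (extBar R n),
        ∀ k,
          E.hom.f k = morseHom (barBasis R n) matching k ∧
          E.inv.f k = morseInv (barBasis R n) matching k) ∧
    (∀ (k : ℕ) (τ : Fin k → Fin n) (hτ : Monotone τ),
      morseHom (barBasis R n) matching k
          (xMulti R τ hτ) =
        ∑ a ∈ Finset.univ.image (fun π : Equiv.Perm (Fin k) => τ ∘ π),
          xTensor R a) ∧
    (∀ (k : ℕ) (τ : Fin k → Fin n) (hτ : Monotone τ) (π : Equiv.Perm (Fin k)),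
      morseInv (barBasis R n) matching k
          (xTensor R (τ ∘ π)) =
        if τ ∘ π = τ then xMulti R τ hτ else 0) ∧
    (∀ (k : ℕ) (τ : Fin k → Fin n), Monotone τ → ∀ π : Equiv.Perm (Fin k),
      ∃ p : ZigZag (barBasis R n) matching
          ⟨k, vars τ⟩ ⟨k, vars (τ ∘ π)⟩,
        p.weight = 1 ∧ ∀ q, q = p) := by
  have hM := isMorseMatching R n
  have hwf := wellFounded_morseStep R n
  refine ⟨hM, finite_zigZag (fun u v h => (hM.edge u v h).1) hwf, fun k v => ⟨fun h => ?_, ?_⟩,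
    exists_homotopyEquiv hM hwf, fun k => morseHom_xMulti, fun k => morseInv_xTensor,
    fun k τ hτ π => ?_⟩
  · obtain ⟨t, ht, hts⟩ := (isCritical_iff_sets _).1 h
    obtain rfl : t.length = k := by rw [← List.length_map, ← ht, length_sets]
    exact ⟨t.get, List.SortedLE.monotone_get hts.sortedLE, eq_vars_get ht⟩
  · rintro ⟨τ, hτ, rfl⟩
    exact isCritical_vars hτ
  · exact exists_unique_path R (isCritical_vars hτ) (sets_vars τ) (pairwise_of_monotone hτ) _
      (sets_vars (τ ∘ π)) (π.ofFn_comp_perm τ)
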